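/- **Setting.** Let $\omega=dz^1\wedge dz^3+dz^2\wedge dz^4$ on $\mathbb C^4$, let $\mathrm{Sp}(2,\mathbb C)$ be its symplectic group and let $\mathbb Q_3$ be the complex 3-fold of Lagrangian 2-planes of $\mathbb C^4$. Let $S$ be a connected Riemann surface. An *isotropic curve* is a nonconstant holomorphic map $f:S\to\mathbb Q_3$ which is null for the conformal structure of $\mathbb Q_3$ (locally $f=[u_1\wedge u_2]$ with $u_1,u_2$ holomorphic and $\det(\omega(u_i,u_j'))=0$) and whose image is not contained in a null ray $\{P\mid \xi\in P\}$, $0\ne\xi\in\mathbb C^4$. Its *Legendre associate* $f^\sharp:S\to\mathbb{CP}^3$ assigns to $p$ (off the critical points of $f$, then by holomorphic extension) the kernel in $f(p)$ of the symmetric form $\omega(u_i,u_j')$. Let $S_\star$ be the set of points that are critical neither for $f$ nor for $f^\sharp$. Near each point of $S_\star$ there are *adapted frames*, i.e. holomorphic maps $A$ to $\mathrm{Sp}(2,\mathbb C)$ with $f=[A_1\wedge A_2]$ such that $\varphi=A^{-1}dA$ satisfies $\varphi^3_1=\varphi^4_1=\varphi^2_1-\varphi^4_2=\varphi^1_1-3\varphi^2_2=4\varphi^1_2-3\varphi^2_4=\varphi^1_4=0$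 and $\varphi^4_2\neq0$. The quartic differential $\delta_f=\varphi^1_3(\varphi^4_2)^3$ on $S_\star$ does not depend on the adapted frame; $f$ is of *general type* if $\delta_f\not\equiv0$, and a point of $S_\star$ is called *generic* if $\delta_f\ne0$ there. A local coordinate $w$ is *projective* for $f$ if there is an adapted frame with $\varphi^2_2=\varphi^2_4=0$ and $-6^{-1/3}\varphi^4_2=dw$; writing $\delta_f=Z\,dw^4$ in such a coordinate, the quadratic differential $\gamma_f=\mathfrak d(\delta_f)=\big(\tfrac12\tfrac{Z''}{Z}-\tfrac9{16}\tfrac{Z'^2}{Z^2}\big)dw^2$ does not depend on the choice of $w$. An isotropic curve $\hat f:U\to\mathbb Q_3$ on a connected open $U\subseteq S$ is a *$k$-th order conformal deformation* of $f|_U$ if there is a holomorphic $D:U\to\mathrm{Sp}(2,\mathbb C)$ such that, for every $p\in U$, the curves $\hat f$ and $D(p)\cdot f$ have the same $k$-jet at $p$. It is *congruent* to $f$ on $U$ (a *trivial* deformation) if $\hat f=X\cdot f$ on $U$ for a constant $X\in\mathrm{Sp}(2,\mathbb C)$. The curve $f$ is *deformable of order $k$* if for every generic point $p_0$ there are a connected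 open neighbourhood $U$ of $p_0$ and an isotropic curve of general type $\hat f:U\to\mathbb Q_3$ which is a nontrivial $k$-th order deformation of $f|_U$; otherwise $f$ is *rigid to order $k$*. **Theorem.** Let $f:S\to\mathbb Q_3$ be an isotropic curve of general type. 1. $f$ is deformable of order four. 2. Let $V\subseteq S$ be open and connected and let $\hat f:V\to\mathbb Q_3$ be an isotropic curve of general type such that all points of $V$ are generic for $f$ and for $\hat f$. Let $z$ be a coordinate on $V$ with $\delta_f=dz^4$, let $\hat a$ be a holomorphic function on $V$ with $\delta_{\hat f}=\hat a^4\,dz^4$ (such $z,\hat a$ exist near every point), and put $$\mathfrak s=\Big(2\frac{\hat a''}{\hat a}-3\Big(\frac{\hat a'}{\hat a}\Big)^2\Big)dz^2 ,\qquad {}'=\frac{d}{dz}.$$ Then $\hat f$ is locally (on some neighbourhood of each point of $V$) a fourth-order conformal deformation of $f$ if and only if $\gamma_{\hat f}=\gamma_f+\mathfrak s$ on $V$. 3. The local fourth-order deformations depend on one arbitrary holomorphic function: if $p_0$ is generic for $f$ and $h$ is a holomorphic function near $p_0$ with $h(p_0)\ne0$, then on some arbitrarily small connected open neighbourhood $U$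 of $p_0$ there is an isotropic curve of general type $\hat f$ which is a fourth-order deformation of $f|_U$ and satisfies $\delta_{\hat f}=h\,\delta_f$; and any two isotropic curves of general type on a connected open set $U\subseteq S$ that are fourth-order deformations of $f|_U$ and have the same quartic differential are congruent. 4. $f$ is rigid to order five; moreover, for every connected open $U\subseteq S$ (in particular $U=S$), every fifth-order conformal deformation $\hat f:U\to\mathbb Q_3$ of $f|_U$ is congruent to $f|_U$. -/

import Mathlib

open scoped Manifold ContDiff Topology

noncomputable section

namespace IsotropicCurve

/-! ### Linear algebra: `ℂ⁴`, the symplectic form, Lagrangian planes -/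

/-- `ℂ⁴`. The coordinates `z¹, z², z³, z⁴` are those with index
`inl 0, inl 1, inr 0, inr 1`. -/
abbrev C4 : Type := Fin 2 ⊕ Fin 2 → ℂ

/-- Complex `4 × 4` matrices; the entry in row `j` and column `i` of a form such as `A⁻¹ dA`
is written `φ^j_i` in comments. -/
abbrev Mat4 : Type := Matrix (Fin 2 ⊕ Fin 2) (Fin 2 ⊕ Fin 2) ℂ

/-- The complex symplectic group `Sp(2, ℂ)`. -/
abbrev Sp2 : Type := Matrix.symplecticGroup (Fin 2) ℂ

/-- The index `1` of `ℂ⁴`. -/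
abbrev i1 : Fin 2 ⊕ Fin 2 := Sum.inl 0
/-- The index `2` of `ℂ⁴`. -/
abbrev i2 : Fin 2 ⊕ Fin 2 := Sum.inl 1
/-- The index `3` of `ℂ⁴`. -/
abbrev i3 : Fin 2 ⊕ Fin 2 := Sum.inr 0
/-- The index `4` of `ℂ⁴`. -/
abbrev i4 : Fin 2 ⊕ Fin 2 := Sum.inr 1

/-- The symplectic form `ω = dz¹ ∧ dz³ + dz² ∧ dz⁴`. -/
def omega (v w : C4) : ℂ := v i1 * w i3 - v i3 * w i1 + v i2 * w i4 - v i4 * w i2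

theorem omega_eq (v w : C4) :
    omega v w = -(v ⬝ᵥ (Matrix.J (Fin 2) ℂ).mulVec w) := by
  simp [omega, Matrix.J, dotProduct, Matrix.mulVec, Fintype.sum_sum_type, Matrix.fromBlocks,
    Fin.sum_univ_two, Matrix.one_apply]
  ring

theorem omega_mulVec (A : Sp2) (v w : C4) :
    omega ((A : Mat4).mulVec v) ((A : Mat4).mulVec w) = omega v w := by
  have h := SymplecticGroup.mem_iff'.1 A.2
  rw [omega_eq, omega_eq, neg_inj, Matrix.mulVec_mulVec, Matrix.dotProduct_mulVec,
    Matrix.vecMul_mulVec, ← Matrix.mul_assoc, h, ← Matrix.dotProduct_mulVec]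

theorem mulVecLin_injective (A : Sp2) : Function.Injective (A : Mat4).mulVecLin := by
  have h : ((A⁻¹ : Sp2) : Mat4) * (A : Mat4) = 1 := congrArg Subtype.val (inv_mul_cancel A)
  intro v w hvw
  have := congrArg (((A⁻¹ : Sp2) : Mat4).mulVec) hvw
  simpa [Matrix.mulVec_mulVec, h] using this

/-- The quadric `ℚ₃`: the Lagrangian `2`-planes of `(ℂ⁴, ω)`. -/
@[ext]
structure Q3 where
  plane : Submodule ℂ C4
  finrank_plane : Module.finrank ℂ plane = 2
  isotropic : ∀ v ∈ plane, ∀ w ∈ plane, omega v w = 0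

/-- The action of `Sp(2, ℂ)` on `ℚ₃`. -/
def act (A : Sp2) (P : Q3) : Q3 where
  plane := P.plane.map (A : Mat4).mulVecLin
  finrank_plane :=
    ((Submodule.equivMapOfInjective _ (mulVecLin_injective A) P.plane).finrank_eq.symm).trans
      P.finrank_plane
  isotropic := by
    rintro _ ⟨v, hv, rfl⟩ _ ⟨w, hw, rfl⟩
    simpa [omega_mulVec] using P.isotropic v hv w hw

/-! ### Holomorphic functions and derivatives with respect to a local coordinate

`S` is a Riemann surface. Maps are total functions on `S`, considered on an open subset. -/

section Calculus

variable {S : Type*} [TopologicalSpace S] [ChartedSpace ℂ S]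

/-- `g` is holomorphic on `U`. -/
def HolOn (g : S → ℂ) (U : Set S) : Prop := MDifferentiableOn 𝓘(ℂ) 𝓘(ℂ) g U

/-- The derivative `dg/dz` at `p` of a function `g` with respect to a local coordinate `z`. -/
def cderiv (z g : S → ℂ) (p : S) : ℂ :=
  deriv (g ∘ (chartAt ℂ p).symm) (chartAt ℂ p p) /
    deriv (z ∘ (chartAt ℂ p).symm) (chartAt ℂ p p)

/-- The derivative `dv/dz` at `p` of a `ℂ⁴`-valued function `v`. -/
def vderiv (z : S → ℂ) (v : S → C4) (p : S) : C4 := fun c => cderiv z (fun q => v q c) p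

/-- `z` is a complex coordinate on the open set `V`. -/
structure IsCoordOn (z : S → ℂ) (V : Set S) : Prop where
  isOpen : IsOpen V
  hol : HolOn z V
  injOn : Set.InjOn z V

/-! ### Holomorphic and isotropic curves in `ℚ₃`, the Legendre associate -/

/-- On the open set `V`, the vector functions `u₁, u₂` are holomorphic and `f = [u₁ ∧ u₂]`. -/
structure IsLiftOn (f : S → Q3) (u : Fin 2 → S → C4) (V : Set S) : Prop where
  isOpen : IsOpen V
  hol : ∀ i c, HolOn (fun p => u i p c) V
  span_eq : ∀ p ∈ V, (f p).plane = Submodule.span ℂ (Set.range fun i => u i p)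

/-- `f : U → ℚ₃` is holomorphic: locally it is spanned by two holomorphic vector functions. -/
def HolCurveOn (f : S → Q3) (U : Set S) : Prop :=
  ∀ p ∈ U, ∃ V u, p ∈ V ∧ V ⊆ U ∧ IsLiftOn f u V

/-- The matrix `ω(uᵢ, uⱼ')` at `p`; it represents the differential of `[u₁ ∧ u₂]` at `p`, and its
determinant represents the pull-back of the conformal structure of `ℚ₃`. -/
def mdot (u : Fin 2 → S → C4) (p : S) : Matrix (Fin 2) (Fin 2) ℂ :=
  Matrix.of fun i j => omega (u i p) (vderiv (chartAt ℂ p) (u j) p)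

/-- `f : U → ℚ₃` is an isotropic curve, defined on a connected open set, nonconstant, and not
contained in a null ray `{P | ξ ∈ P}`. -/
structure IsIsotropicOn (f : S → Q3) (U : Set S) : Prop where
  isOpen : IsOpen U
  isConnected : IsConnected U
  hol : HolCurveOn f U
  nonconst : ¬ ∃ P, ∀ p ∈ U, f p = P
  isotropic : ∀ V u, V ⊆ U → IsLiftOn f u V → ∀ p ∈ V, (mdot u p).det = 0
  not_nullRay : ¬ ∃ ξ : C4, ξ ≠ 0 ∧ ∀ p ∈ U, ξ ∈ (f p).plane

/-- `v` is a holomorphic nowhere zero lift on `V` of the Legendre associate `f♯` of `f`: `v p`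
spans the kernel in `f p` of the symmetric form `ω(uᵢ, uⱼ')` (for an isotropic curve this form has
rank one off a discrete set, where the kernel is the line spanned by `-m₂₂ u₁ + m₁₂ u₂`). -/
structure IsLegendreLiftOn (f : S → Q3) (v : S → C4) (V : Set S) : Prop where
  isOpen : IsOpen V
  hol : ∀ c, HolOn (fun p => v p c) V
  ne_zero : ∀ p ∈ V, v p ≠ 0
  mem : ∀ p ∈ V, v p ∈ (f p).plane
  ker : ∀ p ∈ V, ∀ w ∈ (f p).plane, omega w (vderiv (chartAt ℂ p) v p) = 0

/-- `p` is a critical point neither of `f` nor of its Legendre associate `f♯`. -/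
def IsRegularAt (f : S → Q3) (p : S) : Prop :=
  (∃ V u, p ∈ V ∧ IsLiftOn f u V ∧ mdot u p ≠ 0) ∧
  (∃ V v, p ∈ V ∧ IsLegendreLiftOn f v V ∧
    LinearIndependent ℂ ![v p, vderiv (chartAt ℂ p) v p])

/-! ### Adapted frames, the quartic differential and the projective structure -/

/-- `A` is a symplectic frame along `f` on the open set `V`: a holomorphic `Sp(2, ℂ)`-valued map
with `f = [A₁ ∧ A₂]`. -/
structure IsFrameOn (f : S → Q3) (A : S → Mat4) (V : Set S) : Prop where
  isOpen : IsOpen V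
  hol : ∀ i j, HolOn (fun p => A p i j) V
  mem : ∀ p ∈ V, A p ∈ Matrix.symplecticGroup (Fin 2) ℂ
  span_eq : ∀ p ∈ V, (f p).plane = Submodule.span ℂ {(A p).col i1, (A p).col i2}

/-- The coefficient with respect to `dz` of the pull-back `A⁻¹ dA` of the Maurer-Cartan form. -/
def mc (z : S → ℂ) (A : S → Mat4) (p : S) : Mat4 :=
  (A p)⁻¹ * Matrix.of fun i j => cderiv z (fun q => A q i j) p

/-- The conditions `φ³₁ = φ⁴₁ = φ²₁ - φ⁴₂ = φ¹₁ - 3 φ²₂ = 4 φ¹₂ - 3 φ²₄ = φ¹₄ = 0`, `φ⁴₂ ≠ 0`. -/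
structure IsAdaptedForm (φ : Mat4) : Prop where
  e31 : φ i3 i1 = 0
  e41 : φ i4 i1 = 0
  e21 : φ i2 i1 - φ i4 i2 = 0
  e11 : φ i1 i1 - 3 * φ i2 i2 = 0
  e12 : 4 * φ i1 i2 - 3 * φ i2 i4 = 0
  e14 : φ i1 i4 = 0
  e42 : φ i4 i2 ≠ 0

/-- `A` is an adapted frame along `f` on `V`, that is, a section of the reduced frame bundle. -/
structure IsAdaptedFrameOn (f : S → Q3) (A : S → Mat4) (V : Set S) : Prop where
  frame : IsFrameOn f A V
  adapted : ∀ p ∈ V, IsAdaptedForm (mc (chartAt ℂ p) A p)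

open Classical in
/-- The coefficient at `p` with respect to `dz⁴` of the quartic differential
`δ_f = φ¹₃ (φ⁴₂)³`, computed in any adapted frame near `p`. -/
def quarticCoeff (f : S → Q3) (z : S → ℂ) (p : S) : ℂ :=
  if h : ∃ A V, p ∈ V ∧ IsAdaptedFrameOn f A V then
    mc z h.choose p i1 i3 * (mc z h.choose p i4 i2) ^ 3
  else 0

/-- The `𝔰𝔩(2, ℂ)`-valued form
`η = φ²₂ (a¹₁ - a²₂) - 6^{-1/3} φ⁴₂ a²₁ - (3/32)^{1/3} φ²₄ a¹₂`
(here `aʳₛ` is the elementary matrix with `1` in row `r` and column `s`). -/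
def cartanForm (φ : Mat4) : Matrix (Fin 2) (Fin 2) ℂ :=
  !![φ i2 i2, -(((3 / 32 : ℝ) ^ (1 / 3 : ℝ) : ℝ) : ℂ) * φ i2 i4;
    -(((6 : ℝ) ^ (-1 / 3 : ℝ) : ℝ) : ℂ) * φ i4 i2, -φ i2 i2]

/-- `z` is on `V` a chart adapted to the projective structure of `f`: there is an adapted frame on
`V` in which `η = a²₁ dz`. -/
def IsProjectiveChartOn (f : S → Q3) (z : S → ℂ) (V : Set S) : Prop :=
  IsCoordOn z V ∧ ∃ A, IsAdaptedFrameOn f A V ∧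
    ∀ p ∈ V, cartanForm (mc z A p) = !![0, 0; 1, 0]

/-- The operator `Z ↦ Z''/(2Z) - 9 Z'²/(16 Z²)` in the coordinate `w`. -/
def secondOrderOp (w Z : S → ℂ) (p : S) : ℂ :=
  1 / 2 * (cderiv w (cderiv w Z) p / Z p) - 9 / 16 * ((cderiv w Z p) ^ 2 / (Z p) ^ 2)

open Classical in
/-- The coefficient at `p` with respect to `dz²` of the quadratic differential
`γ_f = 𝔡(δ_f)`, computed in any chart `w` near `p` adapted to the projective structure of `f`. -/
def quadraticCoeff (f : S → Q3) (z : S → ℂ) (p : S) : ℂ :=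
  if h : ∃ w V, p ∈ V ∧ IsProjectiveChartOn f w V then
    secondOrderOp h.choose (quarticCoeff f h.choose) p * (cderiv z h.choose p) ^ 2
  else 0

/-- `p` is a critical point neither of `f` nor of `f♯`, and `δ_f` does not vanish at `p`. -/
def IsGenericAt (f : S → Q3) (p : S) : Prop :=
  IsRegularAt f p ∧ quarticCoeff f (chartAt ℂ p) p ≠ 0

/-- `f : U → ℚ₃` is an isotropic curve of general type: `δ_f` does not vanish identically. -/
structure IsGeneralTypeOn (f : S → Q3) (U : Set S) : Prop where
  isotropicOn : IsIsotropicOn f U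
  quartic_ne_zero : ∃ p ∈ U, IsGenericAt f p

/-! ### Contact, deformations, rigidity -/

/-- The curves `f` and `g` have analytic contact of order `k` at `p`, i.e. the same `k`-jet: they
have lifts near `p` whose derivatives of order `≤ k` agree at `p`. -/
def HasContact (k : ℕ) (f g : S → Q3) (p : S) : Prop :=
  ∃ V u v, p ∈ V ∧ IsLiftOn f u V ∧ IsLiftOn g v V ∧
    ∀ j ≤ k, ∀ i c,
      iteratedDeriv j (fun t => u i ((chartAt ℂ p).symm t) c) (chartAt ℂ p p) =
        iteratedDeriv j (fun t => v i ((chartAt ℂ p).symm t) c) (chartAt ℂ p p)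

/-- On `U`, the isotropic curve `fh` is a `k`-th order conformal deformation of the isotropic
curve `f`. -/
structure IsDeformationOn (k : ℕ) (f fh : S → Q3) (U : Set S) : Prop where
  isotropic_left : IsIsotropicOn f U
  isotropic_right : IsIsotropicOn fh U
  contact : ∃ D : S → Sp2, (∀ i j, HolOn (fun p => (D p : Mat4) i j) U) ∧
    ∀ p ∈ U, HasContact k fh (fun q => act (D p) (f q)) p

/-- `fh` is congruent to `f` on `U`. -/
def CongruentOn (f fh : S → Q3) (U : Set S) : Prop :=
  ∃ X : Sp2, ∀ p ∈ U, fh p = act X (f p)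

/-- `f` is deformable of order `k`: near every generic point there is a nontrivial `k`-th order
deformation of general type. -/
def IsDeformable (k : ℕ) (f : S → Q3) : Prop :=
  ∀ p₀, IsGenericAt f p₀ → ∃ U fh, p₀ ∈ U ∧ IsGeneralTypeOn fh U ∧
    IsDeformationOn k f fh U ∧ ¬ CongruentOn f fh U

/-- `f` is rigid to order `k`. -/
def IsRigid (k : ℕ) (f : S → Q3) : Prop := ¬ IsDeformable k f

end Calculus

end IsotropicCurve

end

open IsotropicCurve

/-!
An isotropic curve is governed by its Legendre associate. Near a point that is critical neither
for the curve `f` nor for `f♯`, and for a local coordinate `z`, a lift `l` of `f♯`, normalized by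
`ω(l', l'') = 1`, is the first column of a symplectic frame `A` along `f` with `A' = A N(k, r)`,
where `N(k, r)` is a fixed affine function of two holomorphic functions `k` and `r`
(`IsRegularAt.exists_normalAt`). Such a frame is called normal here; every adapted frame can be
changed into a normal one (`AdaptedAt.exists_normal`). Everything is read off from `k` and `r`.

* For two curves with normal frames `A`, `Â`, the matrix `T = Â⁻¹ D A` with `D` a constant motion
  satisfies `T' = T N(k, r) - N(k̂, r̂) T`, and contact of order `m` between `f̂` and `D f` means
  that its lower left block vanishes to order `m + 1`. Successive differentiation shows that
  contact of order four at a point forces `k = k̂` there (`TransitionAt.k_eq`), and, if `k = k̂`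
  nearby, contact of order five forces `r = r̂` (`TransitionAt.r_eq`). Conversely, if `k = k̂`, then
  `T = 1` at `p` already gives contact of order four (`TransitionAt.ordAt_five`). With `f̂ = f` this
  shows that `k` and `r` do not depend on the normal frame (`NormalAt.unique`).
* The quartic differential is `r dz⁴` (`NormalAt.quarticCoeff_eq`).
* The projective charts `w` are the quotients of two solutions of `u'' = (k/4) u`, so that `k` is
  `-2` times the Schwarzian derivative of `w` with respect to `z`. If the quartic differential is
  `a⁴ dz⁴`, the definition of the quadratic differential turns into
  `k + 2 a''/a - 3 (a'/a)²` (`NormalAt.quadraticCoeff_eq`).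

Hence fourth order deformations are the curves with the same `k`, which is the criterion by
quadratic differentials; integrating `A' = A N(k, h r)` produces one whose quartic differential is
`h` times the given one (`exists_normalAt`), and doubling the quartic differential gives a
nontrivial one. Equal `k` and equal `r` make `Â A⁻¹` constant, so that the curves are locally
congruent (`NormalAt.congruent`). This gives uniqueness and rigidity near a point where all curves
involved are regular. Such points exist because regular points are dense
(`IsIsotropicOn.exists_isRegularAt`), and the identity theorem
(`HolCurveOn.eq_of_eventually_eq`) extends the congruence to the whole domain.
-/

namespace IsotropicCurve

open Filter

/-! ### Holomorphic functions on a Riemann surface -/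

section Calculus

variable {S : Type*} [TopologicalSpace S] [ChartedSpace ℂ S]

/-- `g` is holomorphic near `p`: its expression in the preferred chart at `p` is analytic. -/
def HolAt (g : S → ℂ) (p : S) : Prop :=
  AnalyticAt ℂ (g ∘ (chartAt ℂ p).symm) (chartAt ℂ p p)

/-- The derivative of `g` at `p` in the preferred chart at `p`. -/
noncomputable def chartDeriv (g : S → ℂ) (p : S) : ℂ :=
  deriv (g ∘ (chartAt ℂ p).symm) (chartAt ℂ p p)

/-- `z` is a local coordinate at `p`, in the infinitesimal sense. -/
def IsCoordAt (z : S → ℂ) (p : S) : Prop := HolAt z p ∧ chartDeriv z p ≠ 0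

theorem cderiv_eq (z g : S → ℂ) (p : S) : cderiv z g p = chartDeriv g p / chartDeriv z p := rfl

theorem tendsto_chart_symm (p : S) :
    Tendsto (chartAt ℂ p).symm (𝓝 (chartAt ℂ p p)) (𝓝 p) :=
  (chartAt ℂ p).tendsto_symm (mem_chart_source ℂ p)

theorem tendsto_chart (p : S) : Tendsto (chartAt ℂ p) (𝓝 p) (𝓝 (chartAt ℂ p p)) :=
  (chartAt ℂ p).continuousAt (mem_chart_source ℂ p)

theorem eventually_chart_symm {p : S} {P : S → Prop} :
    (∀ᶠ t in 𝓝 (chartAt ℂ p p), P ((chartAt ℂ p).symm t)) ↔ ∀ᶠ q in 𝓝 p, P q := by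
  refine ⟨fun h => ?_, fun h => (tendsto_chart_symm p).eventually h⟩
  filter_upwards [(tendsto_chart p).eventually h, chart_source_mem_nhds ℂ p] with q hq hs
  rwa [(chartAt ℂ p).left_inv hs] at hq

theorem eventuallyEq_chart_symm {p : S} {g h : S → ℂ} (e : g =ᶠ[𝓝 p] h) :
    g ∘ (chartAt ℂ p).symm =ᶠ[𝓝 (chartAt ℂ p p)] h ∘ (chartAt ℂ p).symm :=
  (tendsto_chart_symm p).eventually e

theorem HolAt.congr {g h : S → ℂ} {p : S} (hg : HolAt g p) (e : g =ᶠ[𝓝 p] h) : HolAt h p :=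
  AnalyticAt.congr hg (eventuallyEq_chart_symm e)

theorem chartDeriv_congr {g h : S → ℂ} {p : S} (e : g =ᶠ[𝓝 p] h) :
    chartDeriv g p = chartDeriv h p :=
  (eventuallyEq_chart_symm e).deriv_eq

theorem cderiv_congr {z g h : S → ℂ} {p : S} (e : g =ᶠ[𝓝 p] h) :
    cderiv z g p = cderiv z h p := by
  rw [cderiv_eq, cderiv_eq, chartDeriv_congr e]

theorem HolAt.const (c : ℂ) (p : S) : HolAt (fun _ => c) p := analyticAt_const

theorem HolAt.add {g h : S → ℂ} {p : S} (hg : HolAt g p) (hh : HolAt h p) :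
    HolAt (fun q => g q + h q) p := AnalyticAt.add hg hh

theorem HolAt.sub {g h : S → ℂ} {p : S} (hg : HolAt g p) (hh : HolAt h p) :
    HolAt (fun q => g q - h q) p := AnalyticAt.sub hg hh

theorem HolAt.neg {g : S → ℂ} {p : S} (hg : HolAt g p) :
    HolAt (fun q => -g q) p := AnalyticAt.neg hg

theorem HolAt.mul {g h : S → ℂ} {p : S} (hg : HolAt g p) (hh : HolAt h p) :
    HolAt (fun q => g q * h q) p := AnalyticAt.mul hg hh

theorem HolAt.pow {g : S → ℂ} {p : S} (hg : HolAt g p) (n : ℕ) :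
    HolAt (fun q => g q ^ n) p := AnalyticAt.pow hg n

theorem chart_symm_self (p : S) : (chartAt ℂ p).symm (chartAt ℂ p p) = p :=
  (chartAt ℂ p).left_inv (mem_chart_source ℂ p)

theorem HolAt.inv {g : S → ℂ} {p : S} (hg : HolAt g p) (h0 : g p ≠ 0) :
    HolAt (fun q => (g q)⁻¹) p :=
  AnalyticAt.inv hg (by simpa [chart_symm_self] using h0)

theorem HolAt.div {g h : S → ℂ} {p : S} (hg : HolAt g p) (hh : HolAt h p) (h0 : h p ≠ 0) :
    HolAt (fun q => g q / h q) p :=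
  AnalyticAt.div hg hh (by simpa [chart_symm_self] using h0)

theorem HolAt.sum {ι : Type*} {s : Finset ι} {g : ι → S → ℂ} {p : S}
    (hg : ∀ i ∈ s, HolAt (g i) p) : HolAt (fun q => ∑ i ∈ s, g i q) p :=
  (Finset.analyticAt_fun_sum s hg :)

theorem HolAt.continuousAt {g : S → ℂ} {p : S} (hg : HolAt g p) : ContinuousAt g p := by
  have h1 : Tendsto (g ∘ (chartAt ℂ p).symm) (𝓝 (chartAt ℂ p p)) (𝓝 (g p)) := by
    have := (AnalyticAt.continuousAt hg).tendsto
    simpa [chart_symm_self] using this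
  refine (h1.comp (tendsto_chart p)).congr' ?_
  filter_upwards [chart_source_mem_nhds ℂ p] with q hs
  simp [(chartAt ℂ p).left_inv hs]

theorem HolAt.eventually_ne {g : S → ℂ} {p : S} (hg : HolAt g p) (h0 : g p ≠ 0) :
    ∀ᶠ q in 𝓝 p, g q ≠ 0 := hg.continuousAt.eventually_ne h0

/-- Zeros of holomorphic functions are isolated. -/
theorem HolAt.eventually_eq_zero_or {g : S → ℂ} {p : S} (hg : HolAt g p) :
    (∀ᶠ q in 𝓝 p, g q = 0) ∨ ∀ᶠ q in 𝓝[≠] p, g q ≠ 0 := by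
  rcases AnalyticAt.eventually_eq_zero_or_eventually_ne_zero hg with h | h
  · exact .inl (eventually_chart_symm.1 h)
  · right
    rw [eventually_nhdsWithin_iff] at h ⊢
    filter_upwards [(tendsto_chart p).eventually h, chart_source_mem_nhds ℂ p] with q hq hs hne
    have := hq fun hc => hne ((chartAt ℂ p).injOn hs (mem_chart_source ℂ p) hc)
    simpa [(chartAt ℂ p).left_inv hs] using this

@[simp] theorem cderiv_const (z : S → ℂ) (c : ℂ) (p : S) : cderiv z (fun _ => c) p = 0 := by
  have : (fun _ : S => c) ∘ (chartAt ℂ p).symm = fun _ => c := rfl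
  simp [cderiv, this]

theorem cderiv_add (z : S → ℂ) {g h : S → ℂ} {p : S} (hg : HolAt g p) (hh : HolAt h p) :
    cderiv z (fun q => g q + h q) p = cderiv z g p + cderiv z h p := by
  rw [cderiv, cderiv, cderiv, ← add_div]
  congr 1
  exact deriv_add (AnalyticAt.differentiableAt hg) (AnalyticAt.differentiableAt hh)

theorem cderiv_sub (z : S → ℂ) {g h : S → ℂ} {p : S} (hg : HolAt g p) (hh : HolAt h p) :
    cderiv z (fun q => g q - h q) p = cderiv z g p - cderiv z h p := by
  rw [cderiv, cderiv, cderiv, ← sub_div]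
  congr 1
  exact deriv_sub (AnalyticAt.differentiableAt hg) (AnalyticAt.differentiableAt hh)

theorem cderiv_mul (z : S → ℂ) {g h : S → ℂ} {p : S} (hg : HolAt g p) (hh : HolAt h p) :
    cderiv z (fun q => g q * h q) p = cderiv z g p * h p + g p * cderiv z h p := by
  have := deriv_mul (AnalyticAt.differentiableAt hg) (AnalyticAt.differentiableAt hh)
  simp only [Function.comp, chart_symm_self] at this
  simp only [cderiv, div_mul_eq_mul_div, mul_div_assoc', ← add_div]
  congr 1

theorem cderiv_const_mul (z : S → ℂ) (c : ℂ) {h : S → ℂ} {p : S} (hh : HolAt h p) :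
    cderiv z (fun q => c * h q) p = c * cderiv z h p := by
  rw [cderiv_mul z (.const c p) hh]; simp

theorem cderiv_sum (z : S → ℂ) {ι : Type*} {s : Finset ι} {g : ι → S → ℂ} {p : S}
    (hg : ∀ i ∈ s, HolAt (g i) p) :
    cderiv z (fun q => ∑ i ∈ s, g i q) p = ∑ i ∈ s, cderiv z (g i) p := by
  simp only [cderiv, ← Finset.sum_div]
  congr 1
  exact deriv_fun_sum fun i hi => AnalyticAt.differentiableAt (hg i hi)

theorem cderiv_inv (z : S → ℂ) {g : S → ℂ} {p : S} (hg : HolAt g p) (h0 : g p ≠ 0) :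
    cderiv z (fun q => (g q)⁻¹) p = -cderiv z g p / g p ^ 2 := by
  have h1 : cderiv z (fun q => (g q)⁻¹ * g q) p = 0 := by
    rw [cderiv_congr (h := fun _ => 1), cderiv_const]
    filter_upwards [hg.eventually_ne h0] with q hq using inv_mul_cancel₀ hq
  rw [cderiv_mul z (hg.inv h0) hg] at h1
  field_simp at h1 ⊢
  linear_combination h1

theorem cderiv_div (z : S → ℂ) {g h : S → ℂ} {p : S} (hg : HolAt g p) (hh : HolAt h p)
    (h0 : h p ≠ 0) :
    cderiv z (fun q => g q / h q) p = (cderiv z g p * h p - g p * cderiv z h p) / h p ^ 2 := by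
  simp only [div_eq_mul_inv]
  rw [cderiv_mul z hg (hh.inv h0), cderiv_inv z hh h0]
  field_simp
  ring

theorem cderiv_pow (z : S → ℂ) {g : S → ℂ} {p : S} (hg : HolAt g p) (n : ℕ) :
    cderiv z (fun q => g q ^ n) p = n * g p ^ (n - 1) * cderiv z g p := by
  induction n with
  | zero => simp
  | succ n ih =>
    simp only [pow_succ]
    rw [cderiv_mul z (hg.pow n) hg, ih]
    rcases n with _ | n
    · simp
    · simp; ring

theorem cderiv_self {z : S → ℂ} {p : S} (hz : IsCoordAt z p) : cderiv z z p = 1 :=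
  div_self hz.2

theorem cderiv_chain {z w : S → ℂ} (g : S → ℂ) {p : S} (hw : IsCoordAt w p) :
    cderiv z g p = cderiv z w p * cderiv w g p := by
  have := hw.2
  simp only [cderiv_eq]
  field_simp

theorem cderiv_ne_zero {z w : S → ℂ} {p : S} (hz : IsCoordAt z p) (hw : IsCoordAt w p) :
    cderiv z w p ≠ 0 := div_ne_zero hw.2 hz.2

theorem comp_chart_eventuallyEq (g : S → ℂ) {p q : S} (hq : q ∈ (chartAt ℂ p).source) :
    g ∘ (chartAt ℂ p).symm =ᶠ[𝓝 (chartAt ℂ p q)]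
      (g ∘ (chartAt ℂ q).symm) ∘ (chartAt ℂ q ∘ (chartAt ℂ p).symm) := by
  filter_upwards [((chartAt ℂ p).tendsto_symm hq).eventually (chart_source_mem_nhds ℂ q)]
    with t ht
  simp [(chartAt ℂ q).left_inv ht]

theorem transition_apply {p q : S} (hq : q ∈ (chartAt ℂ p).source) :
    (chartAt ℂ q ∘ (chartAt ℂ p).symm) (chartAt ℂ p q) = chartAt ℂ q q := by
  simp [(chartAt ℂ p).left_inv hq]

variable [IsManifold 𝓘(ℂ) ω S]

theorem HolOn.analyticAt_chart {g : S → ℂ} {V : Set S} (hV : IsOpen V) (hg : HolOn g V)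
    {p q : S} (hqp : q ∈ (chartAt ℂ p).source) (hq : q ∈ V) :
    AnalyticAt ℂ (g ∘ (chartAt ℂ p).symm) (chartAt ℂ p q) := by
  rw [Complex.analyticAt_iff_eventually_differentiableAt]
  have ht := (chartAt ℂ p).map_source hqp
  have h1 : ∀ᶠ t in 𝓝 (chartAt ℂ p q), (chartAt ℂ p).symm t ∈ V :=
    ((chartAt ℂ p).tendsto_symm hqp).eventually (hV.mem_nhds hq)
  filter_upwards [h1, (chartAt ℂ p).open_target.mem_nhds ht] with t ht1 ht2
  rw [← mdifferentiableAt_iff_differentiableAt]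
  exact ((hg _ ht1).mdifferentiableAt (hV.mem_nhds ht1)).comp t
    (mdifferentiableAt_atlas_symm (I := 𝓘(ℂ)) (chart_mem_atlas ℂ p) ht2)

theorem holOn_chart (p : S) : HolOn (chartAt ℂ p) (chartAt ℂ p).source :=
  mdifferentiableOn_atlas (I := 𝓘(ℂ)) (chart_mem_atlas ℂ p)

/-- The transition function from the chart at `p` to the chart at `q` is analytic at `q`, with
nonzero derivative. -/
theorem transition_analytic {p q : S} (hq : q ∈ (chartAt ℂ p).source) :
    AnalyticAt ℂ (chartAt ℂ q ∘ (chartAt ℂ p).symm) (chartAt ℂ p q) ∧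
      deriv (chartAt ℂ q ∘ (chartAt ℂ p).symm) (chartAt ℂ p q) ≠ 0 := by
  have h1 := (holOn_chart q).analyticAt_chart (chartAt ℂ q).open_source hq (mem_chart_source ℂ q)
  have h2 := (holOn_chart p).analyticAt_chart (chartAt ℂ p).open_source (mem_chart_source ℂ q) hq
  refine ⟨h1, fun h0 => ?_⟩
  have e : ((chartAt ℂ p ∘ (chartAt ℂ q).symm) ∘ (chartAt ℂ q ∘ (chartAt ℂ p).symm))
      =ᶠ[𝓝 (chartAt ℂ p q)] id := by
    filter_upwards [((chartAt ℂ p).tendsto_symm hq).eventually (chart_source_mem_nhds ℂ q),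
      (chartAt ℂ p).open_target.mem_nhds ((chartAt ℂ p).map_source hq)] with t ht1 ht2
    simp [(chartAt ℂ q).left_inv ht1, (chartAt ℂ p).right_inv ht2]
  have h3 := e.deriv_eq
  have hpt : (chartAt ℂ q ∘ (chartAt ℂ p).symm) (chartAt ℂ p q) = chartAt ℂ q q := by
    simp [(chartAt ℂ p).left_inv hq]
  rw [deriv_comp _ (by rw [hpt]; exact h2.differentiableAt) h1.differentiableAt, h0] at h3
  simp at h3

theorem holAt_iff_chart {g : S → ℂ} {p q : S} (hq : q ∈ (chartAt ℂ p).source) :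
    HolAt g q ↔ AnalyticAt ℂ (g ∘ (chartAt ℂ p).symm) (chartAt ℂ p q) := by
  obtain ⟨h1, h2⟩ := transition_analytic hq
  rw [analyticAt_congr (comp_chart_eventuallyEq g hq),
    analyticAt_comp_iff_of_deriv_ne_zero h1 h2, transition_apply hq]
  rfl

theorem deriv_chart {g : S → ℂ} {p q : S} (hq : q ∈ (chartAt ℂ p).source) (hg : HolAt g q) :
    deriv (g ∘ (chartAt ℂ p).symm) (chartAt ℂ p q) =
      chartDeriv g q * deriv (chartAt ℂ q ∘ (chartAt ℂ p).symm) (chartAt ℂ p q) := by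
  obtain ⟨h1, -⟩ := transition_analytic hq
  rw [(comp_chart_eventuallyEq g hq).deriv_eq, deriv_comp _ _ h1.differentiableAt,
    transition_apply hq]
  · rfl
  · rw [transition_apply hq]; exact AnalyticAt.differentiableAt hg

theorem HolAt.eventually {g : S → ℂ} {p : S} (hg : HolAt g p) : ∀ᶠ q in 𝓝 p, HolAt g q := by
  filter_upwards [(tendsto_chart p).eventually (AnalyticAt.eventually_analyticAt hg),
    chart_source_mem_nhds ℂ p] with q hq hs
  exact (holAt_iff_chart hs).2 hq

theorem HolOn.holAt {g : S → ℂ} {V : Set S} (hV : IsOpen V) (hg : HolOn g V) {p : S}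
    (hp : p ∈ V) : HolAt g p :=
  hg.analyticAt_chart hV (mem_chart_source ℂ p) hp

omit [IsManifold 𝓘(ℂ) ω S] in
theorem HolAt.mdifferentiableAt [IsManifold 𝓘(ℂ) 1 S] {g : S → ℂ} {p : S} (hg : HolAt g p) :
    MDifferentiableAt 𝓘(ℂ) 𝓘(ℂ) g p := by
  have h1 : MDifferentiableAt 𝓘(ℂ) 𝓘(ℂ) (chartAt ℂ p) p :=
    mdifferentiableAt_atlas (I := 𝓘(ℂ)) (chart_mem_atlas ℂ p) (mem_chart_source ℂ p)
  have h2 : MDifferentiableAt 𝓘(ℂ) 𝓘(ℂ) (g ∘ (chartAt ℂ p).symm) (chartAt ℂ p p) :=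
    (AnalyticAt.differentiableAt hg).mdifferentiableAt
  refine (h2.comp p h1).congr_of_eventuallyEq ?_
  filter_upwards [chart_source_mem_nhds ℂ p] with q hs
  simp [(chartAt ℂ p).left_inv hs]

theorem holOn_iff {g : S → ℂ} {V : Set S} (hV : IsOpen V) :
    HolOn g V ↔ ∀ p ∈ V, HolAt g p :=
  ⟨fun h _ hp => h.holAt hV hp, fun h p hp => (h p hp).mdifferentiableAt.mdifferentiableWithinAt⟩

theorem cderiv_eq_chart {z g : S → ℂ} {p q : S} (hq : q ∈ (chartAt ℂ p).source)
    (hz : HolAt z q) (hg : HolAt g q) :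
    cderiv z g q = deriv (g ∘ (chartAt ℂ p).symm) (chartAt ℂ p q) /
      deriv (z ∘ (chartAt ℂ p).symm) (chartAt ℂ p q) := by
  rw [deriv_chart hq hg, deriv_chart hq hz, mul_div_mul_right _ _ (transition_analytic hq).2]
  rfl

theorem cderiv_comp_chart {z g : S → ℂ} {p : S} (hz : HolAt z p) (hg : HolAt g p) :
    cderiv z g ∘ (chartAt ℂ p).symm =ᶠ[𝓝 (chartAt ℂ p p)]
      fun t => deriv (g ∘ (chartAt ℂ p).symm) t / deriv (z ∘ (chartAt ℂ p).symm) t := by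
  filter_upwards [eventually_chart_symm.2 hz.eventually, eventually_chart_symm.2 hg.eventually,
    eventually_chart_symm.2 (chart_source_mem_nhds ℂ p), (chartAt ℂ p).open_target.mem_nhds
      (mem_chart_target ℂ p)] with t h1 h2 h3 h4
  rw [Function.comp, cderiv_eq_chart h3 h1 h2, (chartAt ℂ p).right_inv h4]

theorem HolAt.cderiv {z g : S → ℂ} {p : S} (hg : HolAt g p) (hz : IsCoordAt z p) :
    HolAt (cderiv z g) p :=
  (AnalyticAt.div (AnalyticAt.deriv hg) (AnalyticAt.deriv hz.1) hz.2).congr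
    (cderiv_comp_chart hz.1 hg).symm

theorem IsCoordAt.eventually {z : S → ℂ} {p : S} (hz : IsCoordAt z p) :
    ∀ᶠ q in 𝓝 p, IsCoordAt z q := by
  have h1 := (AnalyticAt.deriv hz.1).continuousAt.eventually_ne hz.2
  filter_upwards [(tendsto_chart p).eventually h1, hz.1.eventually,
    chart_source_mem_nhds ℂ p] with q h1 h2 h3
  refine ⟨h2, fun h => h1 ?_⟩
  rw [deriv_chart h3 h2, h, zero_mul]

theorem isCoordAt_chart {p q : S} (hq : q ∈ (chartAt ℂ p).source) :
    IsCoordAt (chartAt ℂ p) q := by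
  have h1 : HolAt (chartAt ℂ p) q := (holOn_chart p).holAt (chartAt ℂ p).open_source hq
  refine ⟨h1, fun h0 => ?_⟩
  have h2 := deriv_chart hq h1
  have h3 : (chartAt ℂ p ∘ (chartAt ℂ p).symm) =ᶠ[𝓝 (chartAt ℂ p q)] id := by
    filter_upwards [(chartAt ℂ p).open_target.mem_nhds ((chartAt ℂ p).map_source hq)] with t ht
    simp [(chartAt ℂ p).right_inv ht]
  rw [h0, h3.deriv_eq] at h2
  simp at h2

/-- A holomorphic function with vanishing derivative is locally constant. -/
theorem HolAt.eventually_eq_of_cderiv_eq_zero {z g : S → ℂ} {p : S} (hz : IsCoordAt z p)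
    (hg : HolAt g p) (h0 : ∀ᶠ q in 𝓝 p, IsotropicCurve.cderiv z g q = 0) :
    ∀ᶠ q in 𝓝 p, g q = g p := by
  have h1 : ∀ᶠ t in 𝓝 (chartAt ℂ p p), deriv (g ∘ (chartAt ℂ p).symm) t = 0 := by
    filter_upwards [cderiv_comp_chart hz.1 hg, eventually_chart_symm.2 h0,
      (AnalyticAt.deriv hz.1).continuousAt.eventually_ne hz.2] with t h1 h2 h3
    rw [Function.comp, h2, eq_comm, div_eq_zero_iff] at h1
    exact h1.resolve_right h3
  obtain ⟨ε, hε, hb⟩ := Metric.eventually_nhds_iff_ball.1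
    (h1.and (AnalyticAt.eventually_analyticAt hg))
  rw [← eventually_chart_symm]
  filter_upwards [Metric.ball_mem_nhds _ hε] with t ht
  have := Metric.isOpen_ball.is_const_of_deriv_eq_zero (convex_ball _ ε).isPreconnected
    (fun t ht => (hb t ht).2.differentiableAt.differentiableWithinAt) (fun t ht => (hb t ht).1) ht
    (Metric.mem_ball_self hε)
  simpa [chart_symm_self] using this

end Calculus

/-! ### Roots, injectivity and linear differential equations in one variable -/

section OneVariable

/-- A nonvanishing analytic function has a local analytic `n`-th root. -/
theorem exists_analytic_root {g : ℂ → ℂ} {t₀ : ℂ} (hg : AnalyticAt ℂ g t₀) (h0 : g t₀ ≠ 0)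
    {n : ℕ} (hn : n ≠ 0) :
    ∃ k : ℂ → ℂ, AnalyticAt ℂ k t₀ ∧ k t₀ ≠ 0 ∧ ∀ᶠ t in 𝓝 t₀, k t ^ n = g t := by
  obtain ⟨c, hc⟩ := IsAlgClosed.exists_pow_nat_eq (g t₀) (Nat.pos_of_ne_zero hn)
  have hc0 : c ≠ 0 := by rintro rfl; simp [hn] at hc; exact h0 hc.symm
  have h1 : AnalyticAt ℂ (fun t => g t / g t₀) t₀ := hg.div analyticAt_const h0
  have h2 : AnalyticAt ℂ (fun t => Complex.log (g t / g t₀)) t₀ :=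
    h1.clog (by simp [div_self h0])
  refine ⟨fun t => c * Complex.exp (Complex.log (g t / g t₀) / n), ?_, ?_, ?_⟩
  · exact analyticAt_const.mul (h2.div analyticAt_const (by exact_mod_cast hn)).cexp
  · simp [hc0]
  · filter_upwards [hg.continuousAt.eventually_ne h0] with t ht
    rw [mul_pow, ← Complex.exp_nat_mul, mul_div_cancel₀ _ (by exact_mod_cast hn),
      Complex.exp_log (div_ne_zero ht h0), hc, mul_div_cancel₀ _ h0]

/-- An injective analytic function has nonzero derivative: otherwise it is locally, up to a
constant, an `n`-th power of a local coordinate with `n ≥ 2`. -/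
theorem deriv_ne_zero_of_injOn {g : ℂ → ℂ} {t₀ : ℂ} (hg : AnalyticAt ℂ g t₀) {V : Set ℂ}
    (hV : V ∈ 𝓝 t₀) (hinj : Set.InjOn g V) : deriv g t₀ ≠ 0 := by
  intro hd
  have hg' : AnalyticAt ℂ (g · - g t₀) t₀ := hg.sub analyticAt_const
  have hne : analyticOrderAt (g · - g t₀) t₀ ≠ ⊤ := by
    rw [ne_eq, analyticOrderAt_eq_top]
    intro h
    have h1 : ∀ᶠ t in 𝓝 t₀, t = t₀ := by
      filter_upwards [h, hV] with t h1 h2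
      exact hinj h2 (mem_of_mem_nhds hV) (sub_eq_zero.1 h1)
    have h2 : ∃ᶠ t in 𝓝[≠] t₀, t ≠ t₀ :=
      (eventually_mem_nhdsWithin (a := t₀) (s := {t₀}ᶜ)).frequently
    exact h2 (eventually_nhdsWithin_of_eventually_nhds (h1.mono fun t ht => not_not.2 ht))
  obtain ⟨n, hn⟩ := ENat.ne_top_iff_exists.1 hne
  have hn2 : 2 ≤ n := by
    have h1 := hg.analyticOrderAt_deriv_add_one
    have h2 : analyticOrderAt (deriv g) t₀ ≠ 0 :=
      (AnalyticAt.analyticOrderAt_ne_zero hg.deriv).2 hd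
    rw [← hn] at h1
    have h3 : (1 : ℕ∞) ≤ analyticOrderAt (deriv g) t₀ := Order.one_le_iff_ne_zero.2 h2
    have h4 : ((2 : ℕ) : ℕ∞) ≤ n := by
      rw [← h1]; exact (show ((2 : ℕ) : ℕ∞) = 1 + 1 by norm_num) ▸ add_le_add_left h3 1
    exact_mod_cast h4
  obtain ⟨k, hk, hk0, hk'⟩ := (hg'.analyticOrderAt_eq_natCast).1 hn.symm
  obtain ⟨l, hl, hl0, hl'⟩ := exists_analytic_root hk hk0 (n := n) (by omega)
  -- `φ` is a local coordinate with `g - g t₀ = φ ^ n`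
  set φ : ℂ → ℂ := fun t => (t - t₀) * l t with hφ
  have hφa : AnalyticAt ℂ φ t₀ := (analyticAt_id.sub analyticAt_const).mul hl
  have hφd : deriv φ t₀ = l t₀ := by
    have h1 : HasDerivAt (fun t => t - t₀) 1 t₀ := (hasDerivAt_id t₀).sub_const t₀
    have := h1.mul hl.differentiableAt.hasDerivAt
    have h2 := this.deriv
    simp only [sub_self, zero_mul, add_zero, one_mul] at h2
    exact h2
  have hφ0 : φ t₀ = 0 := by simp [hφ]
  have hs := hφa.hasStrictDerivAt
  have hd0 : deriv φ t₀ ≠ 0 := by rwa [hφd]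
  have hev : ∀ᶠ t in 𝓝 t₀, t ∈ V ∧ g t - g t₀ = φ t ^ n := by
    filter_upwards [hV, hk', hl'] with t h1 h2 h3
    exact ⟨h1, by rw [h2, hφ, mul_pow, h3]; rfl⟩
  set r := hs.localInverse φ _ t₀ hd0
  have hr : ∀ᶠ s in 𝓝 (0 : ℂ), φ (r s) = s := hφ0 ▸ hs.eventually_right_inverse hd0
  have hrt : Tendsto r (𝓝 0) (𝓝 t₀) := by
    have := (hs.to_localInverse hd0).hasDerivAt.continuousAt.tendsto
    rwa [hφ0, show hs.localInverse φ _ t₀ hd0 0 = t₀ from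
      hφ0 ▸ HasStrictFDerivAt.localInverse_apply_image ..] at this
  obtain ⟨ζ, hζ⟩ : ∃ ζ : ℂ, IsPrimitiveRoot ζ n :=
    ⟨_, Complex.isPrimitiveRoot_exp n (by omega)⟩
  have hmul : Tendsto (fun s : ℂ => ζ * s) (𝓝 0) (𝓝 0) := by
    have : ContinuousAt (fun s : ℂ => ζ * s) 0 := by fun_prop
    simpa using this.tendsto
  have hall := (((hr.and (hrt.eventually hev)).and
    (hmul.eventually (hr.and (hrt.eventually hev)))))
  obtain ⟨s, ⟨⟨h1, h2, h3⟩, h4, h5, h6⟩, hs0⟩ :=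
    ((hall.filter_mono nhdsWithin_le_nhds).and
      (eventually_mem_nhdsWithin (a := (0 : ℂ)) (s := {0}ᶜ))).exists
  have heq : g (r s) = g (r (ζ * s)) := by
    have : g (r s) - g t₀ = g (r (ζ * s)) - g t₀ := by
      rw [h3, h6, h1, h4, mul_pow, hζ.pow_eq_one, one_mul]
    simpa using this
  have h7 := congrArg φ (hinj h2 h5 heq)
  rw [h1, h4] at h7
  have h8 : ζ = 1 := by
    have : (ζ - 1) * s = 0 := by linear_combination -h7
    exact sub_eq_zero.1 ((mul_eq_zero.1 this).resolve_right hs0)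
  exact hζ.ne_one (by omega) h8

/-- Local existence for linear ordinary differential equations with analytic coefficients in a
complex Banach space, by Picard iteration: the iterates of `y ↦ ∫ a y` decay geometrically on a
small disc. -/
theorem exists_linear_ode_solution {E : Type*} [NormedAddCommGroup E] [NormedSpace ℂ E]
    [CompleteSpace E] {a : ℂ → E →L[ℂ] E} {t₀ : ℂ} (ha : AnalyticAt ℂ a t₀) (y₀ : E) :
    ∃ y : ℂ → E, AnalyticAt ℂ y t₀ ∧ y t₀ = y₀ ∧ ∀ᶠ t in 𝓝 t₀, deriv y t = a t (y t) := by
  obtain ⟨ε, hε, hb⟩ := Metric.eventually_nhds_iff_ball.1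
    (ha.eventually_analyticAt.and
      (ha.continuousAt.norm.eventually (gt_mem_nhds (lt_add_one ‖a t₀‖))))
  set C := ‖a t₀‖ + 1
  have hC : 0 < C := by positivity
  obtain ⟨R, hR0, hRε, hRC⟩ : ∃ R, 0 < R ∧ R ≤ ε ∧ C * R ≤ 1 / 2 :=
    ⟨min ε (1 / (2 * C)), by positivity, min_le_left _ _, by
      calc C * min ε (1 / (2 * C)) ≤ C * (1 / (2 * C)) := by gcongr; exact min_le_right _ _
        _ = 1 / 2 := by field_simp⟩
  set B := Metric.ball t₀ R
  have hBo : IsOpen B := Metric.isOpen_ball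
  have hsub : B ⊆ Metric.ball t₀ ε := Metric.ball_subset_ball hRε
  have had : DifferentiableOn ℂ a B := fun t ht =>
    (hb t (hsub ht)).1.differentiableAt.differentiableWithinAt
  have hac : ∀ t ∈ B, ‖a t‖ ≤ C := fun t ht => (hb t (hsub ht)).2.le
  have step : ∀ g : ℂ → E, DifferentiableOn ℂ g B →
      ∃ h : ℂ → E, h t₀ = 0 ∧ ∀ t ∈ B, HasDerivAt h (a t (g t)) t := fun g hg =>
    ((had.clm_apply hg).isExactOn_ball).with_val_at t₀ 0
  choose! K hK0 hK using step
  let Y : ℕ → ℂ → E := fun n => Nat.iterate K n fun _ => y₀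
  have hYs : ∀ n, Y (n + 1) = K (Y n) := fun n => Function.iterate_succ_apply' _ _ _
  have hY : ∀ n, DifferentiableOn ℂ (Y n) B ∧ ∀ t ∈ B, ‖Y n t‖ ≤ ‖y₀‖ * (1 / 2) ^ n := by
    intro n
    induction n with
    | zero => exact ⟨differentiableOn_const _, fun t _ => by simp [Y]⟩
    | succ n ih =>
      refine ⟨fun t ht => ?_, fun t ht => ?_⟩
      · rw [hYs]; exact (hK _ ih.1 t ht).differentiableAt.differentiableWithinAt
      · have h1 := Convex.norm_image_sub_le_of_norm_hasDerivWithin_le (s := B)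
          (f := K (Y n)) (C := C * (‖y₀‖ * (1 / 2) ^ n))
          (fun s hs => (hK _ ih.1 s hs).hasDerivWithinAt)
          (fun s hs => (ContinuousLinearMap.le_opNorm _ _).trans
            (mul_le_mul (hac s hs) (ih.2 s hs) (norm_nonneg _) hC.le))
          (convex_ball t₀ R) (Metric.mem_ball_self hR0) ht
        rw [hK0 _ ih.1, sub_zero] at h1
        rw [hYs]
        have h2 : ‖t - t₀‖ ≤ R := (mem_ball_iff_norm.1 ht).le
        calc ‖K (Y n) t‖ ≤ C * (‖y₀‖ * (1 / 2) ^ n) * ‖t - t₀‖ := h1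
          _ ≤ C * (‖y₀‖ * (1 / 2) ^ n) * R := by gcongr
          _ = C * R * (‖y₀‖ * (1 / 2) ^ n) := by ring
          _ ≤ 1 / 2 * (‖y₀‖ * (1 / 2) ^ n) := by gcongr
          _ = ‖y₀‖ * (1 / 2) ^ (n + 1) := by ring
  have hsum : Summable fun n : ℕ => ‖y₀‖ * (1 / 2 : ℝ) ^ n :=
    (summable_geometric_of_lt_one (by norm_num) (by norm_num)).mul_left _
  have hYsum : ∀ t ∈ B, Summable fun n => Y n t := fun t ht =>
    Summable.of_norm_bounded hsum fun n => (hY n).2 t ht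
  have hdiff := Complex.differentiableOn_tsum_of_summable_norm hsum (fun n => (hY n).1) hBo
    fun n t ht => (hY n).2 t ht
  refine ⟨fun t => ∑' n, Y n t, hdiff.analyticAt (hBo.mem_nhds (Metric.mem_ball_self hR0)), ?_, ?_⟩
  · change ∑' n, Y n t₀ = y₀
    rw [tsum_eq_single 0]
    · rfl
    · intro n hn
      obtain ⟨m, rfl⟩ := Nat.exists_eq_succ_of_ne_zero hn
      rw [hYs, hK0 _ (hY m).1]
  · filter_upwards [Metric.ball_mem_nhds t₀ hR0] with t ht
    have h1 := Complex.hasSum_deriv_of_summable_norm hsum (fun n => (hY n).1) hBo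
      (fun n t ht => (hY n).2 t ht) ht
    have h2 : HasSum (fun n => a t (Y n t)) (a t (∑' n, Y n t)) :=
      (a t).hasSum (hYsum t ht).hasSum
    have h3 : HasSum (fun n => deriv (Y n) t) (0 + a t (∑' n, Y n t)) := by
      have h0 : deriv (Y 0) t = 0 := deriv_const t y₀
      rw [← h0]
      refine HasSum.zero_add (f := fun n => deriv (Y n) t) ?_
      simpa only [hYs, fun n => (hK _ (hY n).1 t ht).deriv] using h2
    rw [zero_add] at h3
    exact h1.unique h3

end OneVariable

/-! ### Roots, vanishing orders, coordinates and differential equations on the surface -/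

section Surface

variable {S : Type*} [TopologicalSpace S] [ChartedSpace ℂ S]

theorem HolAt.exists_root {g : S → ℂ} {p : S} (hg : HolAt g p) (h0 : g p ≠ 0) {n : ℕ}
    (hn : n ≠ 0) : ∃ k : S → ℂ, HolAt k p ∧ k p ≠ 0 ∧ ∀ᶠ q in 𝓝 p, k q ^ n = g q := by
  obtain ⟨k, h1, h2, h3⟩ := exists_analytic_root hg (by simpa [chart_symm_self] using h0) hn
  have he : ∀ᶠ t in 𝓝 (chartAt ℂ p p), (k ∘ chartAt ℂ p) ((chartAt ℂ p).symm t) = k t := by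
    filter_upwards [(chartAt ℂ p).open_target.mem_nhds (mem_chart_target ℂ p)] with t ht
    simp [(chartAt ℂ p).right_inv ht]
  refine ⟨k ∘ chartAt ℂ p, h1.congr (he.mono fun t ht => ht.symm), h2, ?_⟩
  rw [← eventually_chart_symm]
  filter_upwards [he, h3] with t h4 h5
  rw [h4, h5]; rfl

/-- `g` vanishes at `p` to order at least `n`. -/
def OrdAt (n : ℕ) (g : S → ℂ) (p : S) : Prop :=
  HolAt g p ∧ n ≤ analyticOrderAt (g ∘ (chartAt ℂ p).symm) (chartAt ℂ p p)

theorem HolAt.ordAt_zero {g : S → ℂ} {p : S} (hg : HolAt g p) : OrdAt 0 g p := ⟨hg, by simp⟩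

theorem OrdAt.mono {m n : ℕ} {g : S → ℂ} {p : S} (h : OrdAt n g p) (hmn : m ≤ n) :
    OrdAt m g p := ⟨h.1, le_trans (by exact_mod_cast hmn) h.2⟩

theorem OrdAt.congr {n : ℕ} {g h : S → ℂ} {p : S} (hg : OrdAt n g p) (e : g =ᶠ[𝓝 p] h) :
    OrdAt n h p := by
  refine ⟨hg.1.congr e, ?_⟩
  rw [← analyticOrderAt_congr (eventuallyEq_chart_symm e)]
  exact hg.2

theorem OrdAt.add {n : ℕ} {g h : S → ℂ} {p : S} (hg : OrdAt n g p) (hh : OrdAt n h p) :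
    OrdAt n (fun q => g q + h q) p :=
  ⟨hg.1.add hh.1, (le_min hg.2 hh.2).trans le_analyticOrderAt_add⟩

theorem OrdAt.sub {n : ℕ} {g h : S → ℂ} {p : S} (hg : OrdAt n g p) (hh : OrdAt n h p) :
    OrdAt n (fun q => g q - h q) p :=
  ⟨hg.1.sub hh.1, (le_min hg.2 hh.2).trans le_analyticOrderAt_sub⟩

theorem OrdAt.mul_left {n : ℕ} {g h : S → ℂ} {p : S} (hg : HolAt g p) (hh : OrdAt n h p) :
    OrdAt n (fun q => g q * h q) p := by
  refine ⟨hg.mul hh.1, ?_⟩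
  have := analyticOrderAt_mul hg hh.1
  exact hh.2.trans (le_trans le_add_self this.ge)

theorem OrdAt.const_mul {n : ℕ} (c : ℂ) {h : S → ℂ} {p : S} (hh : OrdAt n h p) :
    OrdAt n (fun q => c * h q) p := hh.mul_left (.const c p)

theorem OrdAt.eq_zero {n : ℕ} {g : S → ℂ} {p : S} (h : OrdAt (n + 1) g p) : g p = 0 := by
  have h1 : analyticOrderAt (g ∘ (chartAt ℂ p).symm) (chartAt ℂ p p) ≠ 0 := by
    intro h0
    have := h.2
    rw [h0] at this
    simp at this
  simpa [chart_symm_self] using apply_eq_zero_of_analyticOrderAt_ne_zero h1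

theorem ordAt_iff_iteratedDeriv {n : ℕ} {g : S → ℂ} {p : S} (hg : HolAt g p) :
    OrdAt n g p ↔
      ∀ i < n, iteratedDeriv i (g ∘ (chartAt ℂ p).symm) (chartAt ℂ p p) = 0 :=
  ⟨fun h => (natCast_le_analyticOrderAt_iff_iteratedDeriv_eq_zero hg).1 h.2,
    fun h => ⟨hg, (natCast_le_analyticOrderAt_iff_iteratedDeriv_eq_zero hg).2 h⟩⟩

variable [IsManifold 𝓘(ℂ) ω S]

theorem ordAt_succ_iff {z : S → ℂ} {n : ℕ} {g : S → ℂ} {p : S} (hz : IsCoordAt z p)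
    (hg : HolAt g p) (h0 : g p = 0) : OrdAt (n + 1) g p ↔ OrdAt n (cderiv z g) p := by
  have h1 : (n : ℕ∞) ≤ analyticOrderAt (deriv (g ∘ (chartAt ℂ p).symm)) (chartAt ℂ p p) ↔
      ((n + 1 : ℕ) : ℕ∞) ≤ analyticOrderAt (g ∘ (chartAt ℂ p).symm) (chartAt ℂ p p) := by
    simpa using analyticOrderAt_deriv_ge_iff hg (by simpa [chart_symm_self] using h0)
  have hz1 : AnalyticAt ℂ (deriv (z ∘ (chartAt ℂ p).symm)) (chartAt ℂ p p) :=
    AnalyticAt.deriv hz.1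
  have h2 : (fun t => deriv (z ∘ (chartAt ℂ p).symm) t * (cderiv z g ∘ (chartAt ℂ p).symm) t)
      =ᶠ[𝓝 (chartAt ℂ p p)] deriv (g ∘ (chartAt ℂ p).symm) := by
    filter_upwards [cderiv_comp_chart hz.1 hg, hz1.continuousAt.eventually_ne hz.2] with t h3 h4
    rw [h3, mul_div_cancel₀ _ h4]
  have h3 : analyticOrderAt (deriv (g ∘ (chartAt ℂ p).symm)) (chartAt ℂ p p) =
      analyticOrderAt (cderiv z g ∘ (chartAt ℂ p).symm) (chartAt ℂ p p) := by
    rw [← analyticOrderAt_congr h2]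
    have := analyticOrderAt_mul hz1 (hg.cderiv hz)
    rw [hz1.analyticOrderAt_eq_zero.2 hz.2, zero_add] at this
    exact this
  rw [OrdAt, OrdAt, ← h1, h3]
  simp [hg, hg.cderiv hz]

theorem OrdAt.succ {z : S → ℂ} {n : ℕ} {g : S → ℂ} {p : S} (hz : IsCoordAt z p)
    (hg : HolAt g p) (h0 : g p = 0) (h : OrdAt n (IsotropicCurve.cderiv z g) p) :
    OrdAt (n + 1) g p := (ordAt_succ_iff hz hg h0).2 h

theorem OrdAt.cderiv {z : S → ℂ} {n : ℕ} {g : S → ℂ} {p : S} (hz : IsCoordAt z p)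
    (h : OrdAt (n + 1) g p) : OrdAt n (IsotropicCurve.cderiv z g) p :=
  (ordAt_succ_iff hz h.1 h.eq_zero).1 h

theorem IsCoordOn.isCoordAt {z : S → ℂ} {V : Set S} (hz : IsCoordOn z V) {p : S} (hp : p ∈ V) :
    IsCoordAt z p := by
  have h1 := hz.hol.holAt hz.isOpen hp
  have hmem : ∀ᶠ t in 𝓝 (chartAt ℂ p p), (chartAt ℂ p).symm t ∈ V ∧ t ∈ (chartAt ℂ p).target :=
    (eventually_chart_symm.2 (hz.isOpen.mem_nhds hp)).and
      ((chartAt ℂ p).open_target.mem_nhds (mem_chart_target ℂ p))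
  refine ⟨h1, deriv_ne_zero_of_injOn h1 hmem fun s hs t ht hst => ?_⟩
  exact (chartAt ℂ p).symm.injOn hs.2 ht.2 (hz.injOn hs.1 ht.1 hst)

/-- By the inverse function theorem, a function with nonzero derivative is a coordinate on some
neighbourhood. -/
theorem IsCoordAt.exists_isCoordOn {z : S → ℂ} {p : S} (hz : IsCoordAt z p) {P : S → Prop}
    (hP : ∀ᶠ q in 𝓝 p, P q) : ∃ V, p ∈ V ∧ IsCoordOn z V ∧ ∀ q ∈ V, P q := by
  have hs := AnalyticAt.hasStrictDerivAt hz.1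
  have h1 := hs.eventually_left_inverse hz.2
  have h2 : ∀ᶠ q in 𝓝 p, hs.localInverse _ _ _ hz.2 (z q) = chartAt ℂ p q := by
    filter_upwards [(tendsto_chart p).eventually h1, chart_source_mem_nhds ℂ p] with q h2 h3
    simpa [(chartAt ℂ p).left_inv h3] using h2
  obtain ⟨V, hV, hVo, hpV⟩ := eventually_nhds_iff.1
    (((h2.and (chart_source_mem_nhds ℂ p)).and hz.1.eventually).and hP)
  refine ⟨V, hpV, ⟨hVo, (holOn_iff hVo).2 fun q hq => (hV q hq).1.2, ?_⟩, fun q hq => (hV q hq).2⟩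
  intro q hq q' hq' h
  have h3 := (hV q hq).1.1
  have h4 := (hV q' hq').1.1
  exact (chartAt ℂ p).injOn h3.2 h4.2 (by rw [← h3.1, ← h4.1, h])

/-- Local existence for linear differential equations `Y' = Y M` on a Riemann surface. -/
theorem exists_matrix_ode_solution {n : Type*} [Fintype n] {z : S → ℂ} {p : S}
    (hz : IsCoordAt z p) {M : S → Matrix n n ℂ} (hM : ∀ i j, HolAt (fun q => M q i j) p)
    (Y₀ : Matrix n n ℂ) :
    ∃ Y : S → Matrix n n ℂ, (∀ i j, HolAt (fun q => Y q i j) p) ∧ Y p = Y₀ ∧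
      ∀ᶠ q in 𝓝 p, ∀ i j, cderiv z (fun q => Y q i j) q = (Y q * M q) i j := by
  classical
  let φ := (chartAt ℂ p).symm
  -- right multiplication by an elementary matrix, as an operator on families of entries
  let R : n → n → ((n × n → ℂ) →L[ℂ] (n × n → ℂ)) := fun k j =>
    ContinuousLinearMap.pi fun ij => if ij.2 = j then ContinuousLinearMap.proj (ij.1, k) else 0
  let a : ℂ → ((n × n → ℂ) →L[ℂ] (n × n → ℂ)) := fun t =>
    ∑ k, ∑ j, (deriv (z ∘ φ) t * M (φ t) k j) • R k j
  have ha : AnalyticAt ℂ a (chartAt ℂ p p) := by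
    refine Finset.analyticAt_fun_sum _ fun k _ => Finset.analyticAt_fun_sum _ fun j _ => ?_
    exact ((AnalyticAt.deriv hz.1).mul (hM k j)).smul analyticAt_const
  have haa : ∀ t (y : n × n → ℂ) i j, a t y (i, j) =
      deriv (z ∘ φ) t * ∑ k, y (i, k) * M (φ t) k j := by
    intro t y i j
    simp only [a, R, _root_.sum_apply, _root_.smul_apply,
      Finset.sum_apply, Pi.smul_apply, ContinuousLinearMap.pi_apply, smul_eq_mul, Finset.mul_sum]
    refine Finset.sum_congr rfl fun k _ => ?_
    rw [Finset.sum_eq_single j]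
    · simp; ring
    · intro b _ hb; simp [hb.symm]
    · simp
  obtain ⟨y, hy, hy0, hyd⟩ := exists_linear_ode_solution ha (fun ij => Y₀ ij.1 ij.2)
  have he : ∀ ij, (fun q => y (chartAt ℂ p q) ij) ∘ φ =ᶠ[𝓝 (chartAt ℂ p p)] fun t => y t ij := by
    intro ij
    filter_upwards [(chartAt ℂ p).open_target.mem_nhds (mem_chart_target ℂ p)] with t ht
    simp [φ, (chartAt ℂ p).right_inv ht]
  have hya : ∀ ij, AnalyticAt ℂ (fun t => y t ij) (chartAt ℂ p p) := fun ij =>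
    (ContinuousLinearMap.analyticAt
      (ContinuousLinearMap.proj (R := ℂ) (φ := fun _ : n × n => ℂ) ij) _).comp hy
  have hH : ∀ i j, HolAt (fun q => y (chartAt ℂ p q) (i, j)) p := fun i j =>
    (hya (i, j)).congr (he _).symm
  refine ⟨fun q => Matrix.of fun i j => y (chartAt ℂ p q) (i, j), hH, ?_, ?_⟩
  · ext i j; simp [hy0]
  · rw [← eventually_chart_symm]
    have hz1 : AnalyticAt ℂ (deriv (z ∘ φ)) (chartAt ℂ p p) := AnalyticAt.deriv hz.1
    have hall : ∀ᶠ t in 𝓝 (chartAt ℂ p p), ∀ i j,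
        cderiv z (fun q => y (chartAt ℂ p q) (i, j)) (φ t) =
          deriv (fun t => y t (i, j)) t / deriv (z ∘ φ) t := by
      rw [eventually_all]; intro i
      rw [eventually_all]; intro j
      filter_upwards [cderiv_comp_chart hz.1 (hH i j), (he (i, j)).eventuallyEq_nhds] with t h1 h2
      rw [← h2.deriv_eq, ← h1]; rfl
    filter_upwards [hall, hyd, hz1.continuousAt.eventually_ne hz.2, hy.eventually_analyticAt,
      (chartAt ℂ p).open_target.mem_nhds (mem_chart_target ℂ p)] with t h1 h2 h3 h4 h5 i j
    have h6 : deriv (fun t => y t (i, j)) t = a t (y t) (i, j) := by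
      rw [← h2]
      exact (hasDerivAt_pi.1 h4.differentiableAt.hasDerivAt (i, j)).deriv
    refine (h1 i j).trans ?_
    rw [h6, haa, mul_div_cancel_left₀ _ h3, Matrix.mul_apply]
    simp [φ, (chartAt ℂ p).right_inv h5]

end Surface

/-! ### Symplectic linear algebra -/

section Linear

theorem omega_add_left (u v w : C4) : omega (u + v) w = omega u w + omega v w := by
  simp only [omega, Pi.add_apply]; ring

theorem omega_add_right (u v w : C4) : omega u (v + w) = omega u v + omega u w := by
  simp only [omega, Pi.add_apply]; ring

theorem omega_smul_left (c : ℂ) (v w : C4) : omega (c • v) w = c * omega v w := by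
  simp only [omega, Pi.smul_apply, smul_eq_mul]; ring

theorem omega_smul_right (c : ℂ) (v w : C4) : omega v (c • w) = c * omega v w := by
  simp only [omega, Pi.smul_apply, smul_eq_mul]; ring

theorem omega_sub_left (u v w : C4) : omega (u - v) w = omega u w - omega v w := by
  simp only [omega, Pi.sub_apply]; ring

theorem omega_sub_right (u v w : C4) : omega u (v - w) = omega u v - omega u w := by
  simp only [omega, Pi.sub_apply]; ring

theorem omega_self (v : C4) : omega v v = 0 := by simp only [omega]; ring

theorem omega_swap (v w : C4) : omega v w = -omega w v := by simp only [omega]; ring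

/-- `ω` as a bilinear form. -/
noncomputable def omegaForm : LinearMap.BilinForm ℂ C4 :=
  LinearMap.mk₂ ℂ omega omega_add_left omega_smul_left omega_add_right omega_smul_right

@[simp] theorem omegaForm_apply (v w : C4) : omegaForm v w = omega v w := rfl

theorem omega_nondegenerate {v : C4} (h : ∀ w, omega v w = 0) : v = 0 := by
  have h1 := h (Pi.single i1 1)
  have h2 := h (Pi.single i2 1)
  have h3 := h (Pi.single i3 1)
  have h4 := h (Pi.single i4 1)
  simp [omega] at h1 h2 h3 h4
  ext (i | i) <;> fin_cases i <;> simpa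

theorem omegaForm_isRefl : omegaForm.IsRefl := fun v w h => by
  rw [omegaForm_apply] at h ⊢; rw [omega_swap, h, neg_zero]

theorem omegaForm_nondegenerate : omegaForm.Nondegenerate := by
  refine (LinearMap.IsRefl.nondegenerate_iff_separatingLeft omegaForm_isRefl).2 ?_
  exact fun v hv => omega_nondegenerate hv

/-- A Lagrangian plane is its own `ω`-orthogonal. -/
theorem Q3.mem_of_omega (P : Q3) {w : C4} (h : ∀ v ∈ P.plane, omega v w = 0) : w ∈ P.plane := by
  have h1 : P.plane ≤ omegaForm.orthogonal P.plane := fun w hw v hv => P.isotropic v hv w hw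
  have h2 := LinearMap.BilinForm.finrank_orthogonal omegaForm_nondegenerate P.plane
  have h3 : Module.finrank ℂ C4 = 4 := by simp
  have h4 : P.plane = omegaForm.orthogonal P.plane :=
    Submodule.eq_of_le_of_finrank_eq h1 (by rw [h2, h3, P.finrank_plane])
  rw [h4]
  exact h

theorem Q3.eq_of_omega {P Q : Q3} (h : ∀ v ∈ P.plane, ∀ w ∈ Q.plane, omega v w = 0) : P = Q := by
  have h1 : Q.plane ≤ P.plane := fun w hw => P.mem_of_omega fun v hv => h v hv w hw
  ext1
  exact (Submodule.eq_of_le_of_finrank_eq h1 (by rw [P.finrank_plane, Q.finrank_plane])).symm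

theorem omega_col (A : Mat4) (i j : Fin 2 ⊕ Fin 2) :
    omega (A.col i) (A.col j) = -(A.transpose * Matrix.J (Fin 2) ℂ * A) i j := by
  rw [omega_eq, Matrix.mul_assoc, Matrix.mul_apply]
  rfl

theorem J_apply_eq : Matrix.J (Fin 2) ℂ = Matrix.fromBlocks 0 (-1) 1 0 := rfl

theorem mem_symplectic_iff_col (A : Mat4) : A ∈ Matrix.symplecticGroup (Fin 2) ℂ ↔
    omega (A.col i1) (A.col i2) = 0 ∧ omega (A.col i1) (A.col i3) = 1 ∧
    omega (A.col i1) (A.col i4) = 0 ∧ omega (A.col i2) (A.col i3) = 0 ∧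
    omega (A.col i2) (A.col i4) = 1 ∧ omega (A.col i3) (A.col i4) = 0 := by
  rw [SymplecticGroup.mem_iff']
  constructor
  · intro h
    simp only [omega_col, h]
    simp [J_apply_eq]
  · rintro ⟨h12, h13, h14, h23, h24, h34⟩
    have key : ∀ i j, (A.transpose * Matrix.J (Fin 2) ℂ * A) i j =
        -omega (A.col i) (A.col j) := fun i j => by rw [omega_col, neg_neg]
    have e21 := omega_swap (A.col i2) (A.col i1)
    have e31 := omega_swap (A.col i3) (A.col i1)
    have e41 := omega_swap (A.col i4) (A.col i1)
    have e32 := omega_swap (A.col i3) (A.col i2)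
    have e42 := omega_swap (A.col i4) (A.col i2)
    have e43 := omega_swap (A.col i4) (A.col i3)
    rw [h12] at e21; rw [h13] at e31; rw [h14] at e41; rw [h23] at e32; rw [h24] at e42
    rw [h34] at e43
    ext i j
    rw [key, J_apply_eq]
    rcases i with i | i <;> rcases j with j | j <;> fin_cases i <;> fin_cases j <;>
      simp [*, omega_self]

theorem isUnit_of_mem_symplectic {A : Mat4} (hA : A ∈ Matrix.symplecticGroup (Fin 2) ℂ) :
    IsUnit A.det := SymplecticGroup.symplectic_det hA

theorem inv_mulVec_apply {A : Mat4} (hA : A ∈ Matrix.symplecticGroup (Fin 2) ℂ) (w : C4) :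
    (A⁻¹.mulVec w) i1 = omega w (A.col i3) ∧ (A⁻¹.mulVec w) i2 = omega w (A.col i4) ∧
    (A⁻¹.mulVec w) i3 = -omega w (A.col i1) ∧ (A⁻¹.mulVec w) i4 = -omega w (A.col i2) := by
  have h : A⁻¹ = -(Matrix.J (Fin 2) ℂ * A.transpose * Matrix.J (Fin 2) ℂ) :=
    Matrix.inv_eq_left_inv (by rw [Matrix.neg_mul]; exact SymplecticGroup.inv_left_mul_aux hA)
  rw [h, J_apply_eq]
  refine ⟨?_, ?_, ?_, ?_⟩ <;>
  · simp [Matrix.mulVec, dotProduct, Matrix.mul_apply, Fintype.sum_sum_type, Fin.sum_univ_two,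
      Matrix.fromBlocks, Matrix.one_apply, omega]
    ring

theorem mulVec_eq_sum_col (A : Mat4) (v : C4) : A.mulVec v =
    v i1 • A.col i1 + v i2 • A.col i2 + v i3 • A.col i3 + v i4 • A.col i4 := by
  ext c
  simp [Matrix.mulVec, dotProduct, Fintype.sum_sum_type, Fin.sum_univ_two]
  ring

/-- The expansion of a vector in a symplectic basis. -/
theorem eq_sum_col {A : Mat4} (hA : A ∈ Matrix.symplecticGroup (Fin 2) ℂ) (w : C4) :
    w = omega w (A.col i3) • A.col i1 + omega w (A.col i4) • A.col i2 +
      (-omega w (A.col i1)) • A.col i3 + (-omega w (A.col i2)) • A.col i4 := by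
  obtain ⟨h1, h2, h3, h4⟩ := inv_mulVec_apply hA w
  rw [← h1, ← h2, ← h3, ← h4, ← mulVec_eq_sum_col, Matrix.mulVec_mulVec,
    Matrix.mul_nonsing_inv _ (isUnit_of_mem_symplectic hA), Matrix.one_mulVec]

end Linear

/-! ### Vector and matrix valued functions, the Maurer-Cartan form -/

section VectorCalculus

variable {S : Type*} [TopologicalSpace S] [ChartedSpace ℂ S]

/-- A vector function is holomorphic near `p`. -/
def VHolAt (v : S → C4) (p : S) : Prop := ∀ c, HolAt (fun q => v q c) p

/-- A matrix function is holomorphic near `p`. -/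
def MHolAt (A : S → Mat4) (p : S) : Prop := ∀ i j, HolAt (fun q => A q i j) p

/-- The entrywise derivative of a matrix function with respect to `z`. -/
noncomputable def mderiv (z : S → ℂ) (A : S → Mat4) (p : S) : Mat4 :=
  Matrix.of fun i j => cderiv z (fun q => A q i j) p

theorem mc_eq (z : S → ℂ) (A : S → Mat4) (p : S) : mc z A p = (A p)⁻¹ * mderiv z A p := rfl

theorem MHolAt.col {A : S → Mat4} {p : S} (h : MHolAt A p) (j : Fin 2 ⊕ Fin 2) :
    VHolAt (fun q => (A q).col j) p := fun c => h c j

theorem VHolAt.add {v w : S → C4} {p : S} (hv : VHolAt v p) (hw : VHolAt w p) :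
    VHolAt (fun q => v q + w q) p := fun c => (hv c).add (hw c)

theorem VHolAt.sub {v w : S → C4} {p : S} (hv : VHolAt v p) (hw : VHolAt w p) :
    VHolAt (fun q => v q - w q) p := fun c => (hv c).sub (hw c)

theorem VHolAt.smul {g : S → ℂ} {v : S → C4} {p : S} (hg : HolAt g p) (hv : VHolAt v p) :
    VHolAt (fun q => g q • v q) p := fun c => hg.mul (hv c)

theorem MHolAt.congr {A B : S → Mat4} {p : S} (hA : MHolAt A p) (e : A =ᶠ[𝓝 p] B) :
    MHolAt B p := fun i j => (hA i j).congr (e.mono fun q hq => by simp only [hq])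

theorem VHolAt.const (v : C4) (p : S) : VHolAt (fun _ => v) p := fun c => .const (v c) p

theorem MHolAt.const (A : Mat4) (p : S) : MHolAt (fun _ => A) p := fun i j => .const (A i j) p

theorem MHolAt.mul {A B : S → Mat4} {p : S} (hA : MHolAt A p) (hB : MHolAt B p) :
    MHolAt (fun q => A q * B q) p := fun i j => by
  simp only [Matrix.mul_apply]
  exact HolAt.sum fun k _ => (hA i k).mul (hB k j)

theorem MHolAt.inv {A : S → Mat4} {p : S} (hA : MHolAt A p)
    (hmem : ∀ᶠ q in 𝓝 p, A q ∈ Matrix.symplecticGroup (Fin 2) ℂ) :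
    MHolAt (fun q => (A q)⁻¹) p := by
  have h1 : MHolAt (fun q => (-Matrix.J (Fin 2) ℂ) * (A q).transpose * Matrix.J (Fin 2) ℂ) p :=
    ((MHolAt.const _ p).mul fun i j => hA j i).mul (.const _ p)
  refine h1.congr ?_
  filter_upwards [hmem] with q hq
  have := SymplecticGroup.inv_left_mul_aux hq
  rw [Matrix.inv_eq_left_inv (B := (-Matrix.J (Fin 2) ℂ) * (A q).transpose * Matrix.J (Fin 2) ℂ)]
  simpa [Matrix.neg_mul] using this

theorem VHolAt.omega {v w : S → C4} {p : S} (hv : VHolAt v p) (hw : VHolAt w p) :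
    HolAt (fun q => omega (v q) (w q)) p :=
  ((((hv i1).mul (hw i3)).sub ((hv i3).mul (hw i1))).add ((hv i2).mul (hw i4))).sub
    ((hv i4).mul (hw i2))

theorem cderiv_omega (z : S → ℂ) {v w : S → C4} {p : S} (hv : VHolAt v p) (hw : VHolAt w p) :
    cderiv z (fun q => omega (v q) (w q)) p =
      omega (vderiv z v p) (w p) + omega (v p) (vderiv z w p) := by
  simp only [omega]
  rw [cderiv_sub z ((((hv i1).mul (hw i3)).sub ((hv i3).mul (hw i1))).add ((hv i2).mul (hw i4)))
    ((hv i4).mul (hw i2)), cderiv_add z (((hv i1).mul (hw i3)).sub ((hv i3).mul (hw i1)))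
    ((hv i2).mul (hw i4)), cderiv_sub z ((hv i1).mul (hw i3)) ((hv i3).mul (hw i1)),
    cderiv_mul z (hv i1) (hw i3), cderiv_mul z (hv i3) (hw i1), cderiv_mul z (hv i2) (hw i4),
    cderiv_mul z (hv i4) (hw i2)]
  simp only [vderiv]
  ring

theorem vderiv_add (z : S → ℂ) {v w : S → C4} {p : S} (hv : VHolAt v p) (hw : VHolAt w p) :
    vderiv z (fun q => v q + w q) p = vderiv z v p + vderiv z w p :=
  funext fun c => cderiv_add z (hv c) (hw c)

theorem vderiv_sub (z : S → ℂ) {v w : S → C4} {p : S} (hv : VHolAt v p) (hw : VHolAt w p) :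
    vderiv z (fun q => v q - w q) p = vderiv z v p - vderiv z w p :=
  funext fun c => cderiv_sub z (hv c) (hw c)

theorem vderiv_smul (z : S → ℂ) {g : S → ℂ} {v : S → C4} {p : S} (hg : HolAt g p)
    (hv : VHolAt v p) :
    vderiv z (fun q => g q • v q) p = cderiv z g p • v p + g p • vderiv z v p :=
  funext fun c => cderiv_mul z hg (hv c)

@[simp] theorem vderiv_const (z : S → ℂ) (v : C4) (p : S) : vderiv z (fun _ => v) p = 0 :=
  funext fun c => cderiv_const z (v c) p

theorem vderiv_congr {z : S → ℂ} {v w : S → C4} {p : S} (e : v =ᶠ[𝓝 p] w) :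
    vderiv z v p = vderiv z w p :=
  funext fun c => cderiv_congr (e.mono fun q hq => by simp only [hq])

theorem mderiv_congr {z : S → ℂ} {A B : S → Mat4} {p : S} (e : A =ᶠ[𝓝 p] B) :
    mderiv z A p = mderiv z B p := by
  ext i j; exact cderiv_congr (e.mono fun q hq => by simp only [hq])

theorem vderiv_chain {z w : S → ℂ} (v : S → C4) {p : S} (hw : IsCoordAt w p) :
    vderiv z v p = cderiv z w p • vderiv w v p := funext fun _ => cderiv_chain _ hw

theorem mderiv_chain {z w : S → ℂ} (A : S → Mat4) {p : S} (hw : IsCoordAt w p) :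
    mderiv z A p = cderiv z w p • mderiv w A p := by
  ext i j; exact cderiv_chain _ hw

theorem mc_chain {z w : S → ℂ} (A : S → Mat4) {p : S} (hw : IsCoordAt w p) :
    mc z A p = cderiv z w p • mc w A p := by
  rw [mc_eq, mc_eq, mderiv_chain A hw, Matrix.mul_smul]

@[simp] theorem mderiv_const (z : S → ℂ) (A : Mat4) (p : S) : mderiv z (fun _ => A) p = 0 := by
  ext i j; exact cderiv_const z (A i j) p

theorem mderiv_mul (z : S → ℂ) {A B : S → Mat4} {p : S} (hA : MHolAt A p) (hB : MHolAt B p) :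
    mderiv z (fun q => A q * B q) p = mderiv z A p * B p + A p * mderiv z B p := by
  ext i j
  simp only [mderiv, Matrix.of_apply, Matrix.add_apply, Matrix.mul_apply]
  rw [cderiv_sum z fun k _ => (hA i k).mul (hB k j), ← Finset.sum_add_distrib]
  exact Finset.sum_congr rfl fun k _ => cderiv_mul z (hA i k) (hB k j)

theorem mderiv_const_mul (z : S → ℂ) (X : Mat4) {A : S → Mat4} {p : S} (hA : MHolAt A p) :
    mderiv z (fun q => X * A q) p = X * mderiv z A p := by
  rw [mderiv_mul z (.const X p) hA]; simp

theorem mderiv_eq_iff_mc {z : S → ℂ} {A : S → Mat4} {p : S} {M : Mat4}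
    (hA : A p ∈ Matrix.symplecticGroup (Fin 2) ℂ) : mderiv z A p = A p * M ↔ mc z A p = M := by
  have hu := isUnit_of_mem_symplectic hA
  rw [mc_eq]
  constructor
  · intro h; rw [h, ← Matrix.mul_assoc, Matrix.nonsing_inv_mul _ hu, Matrix.one_mul]
  · intro h; rw [← h, ← Matrix.mul_assoc, Matrix.mul_nonsing_inv _ hu, Matrix.one_mul]

/-- The entries of the Maurer-Cartan form of a symplectic frame as `ω`-products. -/
theorem mc_apply {z : S → ℂ} {A : S → Mat4} {p : S}
    (hA : A p ∈ Matrix.symplecticGroup (Fin 2) ℂ) (j : Fin 2 ⊕ Fin 2) :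
    mc z A p i1 j = omega (vderiv z (fun q => (A q).col j) p) ((A p).col i3) ∧
    mc z A p i2 j = omega (vderiv z (fun q => (A q).col j) p) ((A p).col i4) ∧
    mc z A p i3 j = -omega (vderiv z (fun q => (A q).col j) p) ((A p).col i1) ∧
    mc z A p i4 j = -omega (vderiv z (fun q => (A q).col j) p) ((A p).col i2) :=
  inv_mulVec_apply hA _

/-- The Maurer-Cartan form of a symplectic frame takes values in the symplectic Lie algebra. -/
theorem mc_mem_lie {z : S → ℂ} {A : S → Mat4} {p : S} (hA : MHolAt A p)
    (hmem : ∀ᶠ q in 𝓝 p, A q ∈ Matrix.symplecticGroup (Fin 2) ℂ) :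
    mc z A p i3 i3 = -mc z A p i1 i1 ∧ mc z A p i4 i4 = -mc z A p i2 i2 ∧
    mc z A p i3 i4 = -mc z A p i2 i1 ∧ mc z A p i4 i3 = -mc z A p i1 i2 ∧
    mc z A p i2 i3 = mc z A p i1 i4 ∧ mc z A p i3 i2 = mc z A p i4 i1 := by
  have key : ∀ i j, omega (vderiv z (fun q => (A q).col i) p) ((A p).col j) =
      omega (vderiv z (fun q => (A q).col j) p) ((A p).col i) := by
    intro i j
    have h1 := cderiv_omega z (hA.col i) (hA.col j)
    rw [cderiv_congr (h := fun _ => omega ((A p).col i) ((A p).col j)), cderiv_const] at h1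
    · rw [omega_swap ((A p).col i)] at h1
      linear_combination -h1
    · filter_upwards [hmem] with q hq
      rw [omega_col, omega_col, SymplecticGroup.mem_iff'.1 hq,
        SymplecticGroup.mem_iff'.1 hmem.self_of_nhds]
  obtain ⟨h11, h21, h31, h41⟩ := mc_apply (z := z) hmem.self_of_nhds i1
  obtain ⟨h12, h22, h32, h42⟩ := mc_apply (z := z) hmem.self_of_nhds i2
  obtain ⟨h13, h23, h33, h43⟩ := mc_apply (z := z) hmem.self_of_nhds i3
  obtain ⟨h14, h24, h34, h44⟩ := mc_apply (z := z) hmem.self_of_nhds i4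
  rw [h33, h11, h44, h22, h34, h21, h43, h12, h23, h14, h32, h41, key i3 i1, key i4 i2, key i4 i1,
    key i3 i2, key i3 i4, key i2 i1]
  simp

variable [IsManifold 𝓘(ℂ) ω S]

theorem VHolAt.eventually {v : S → C4} {p : S} (hv : VHolAt v p) : ∀ᶠ q in 𝓝 p, VHolAt v q :=
  eventually_all.2 fun c => (hv c).eventually

theorem MHolAt.eventually {A : S → Mat4} {p : S} (hA : MHolAt A p) : ∀ᶠ q in 𝓝 p, MHolAt A q :=
  eventually_all.2 fun i => eventually_all.2 fun j => (hA i j).eventually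

theorem VHolAt.vderiv {z : S → ℂ} {v : S → C4} {p : S} (hv : VHolAt v p) (hz : IsCoordAt z p) :
    VHolAt (vderiv z v) p := fun c => (hv c).cderiv hz

theorem MHolAt.mderiv {z : S → ℂ} {A : S → Mat4} {p : S} (hA : MHolAt A p)
    (hz : IsCoordAt z p) : MHolAt (mderiv z A) p := fun i j => (hA i j).cderiv hz

theorem MHolAt.mc {z : S → ℂ} {A : S → Mat4} {p : S} (hA : MHolAt A p) (hz : IsCoordAt z p)
    (hmem : ∀ᶠ q in 𝓝 p, A q ∈ Matrix.symplecticGroup (Fin 2) ℂ) : MHolAt (mc z A) p :=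
  (hA.inv hmem).mul (hA.mderiv hz)

end VectorCalculus

/-! ### Adapted forms and their changes of frame -/

section Gauge

/-- The value of the Maurer-Cartan form of an adapted frame, in terms of its four independent
entries `θ = φ⁴₂`, `s = φ²₂`, `k = φ²₄` and `r = φ¹₃`. -/
noncomputable def Phi (θ s k r : ℂ) : Mat4 :=
  Matrix.fromBlocks !![3 * s, 3 / 4 * k; θ, s] !![r, 0; 0, k] !![0, 0; 0, θ]
    !![-(3 * s), -θ; -(3 / 4 * k), -s]

theorem Phi_smul (c θ s k r : ℂ) : c • Phi θ s k r = Phi (c * θ) (c * s) (c * k) (c * r) := by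
  ext i j
  rcases i with i | i <;> rcases j with j | j <;> fin_cases i <;> fin_cases j <;>
    simp [Phi] <;> ring

/-- The change of adapted frames with parameters `b`, `τ`: a unipotent element followed by a
diagonal one, in the image of a Borel subgroup of `SL(2, ℂ)` under its irreducible
four-dimensional representation. -/
noncomputable def gaugeMatrix (b τ : ℂ) : Mat4 :=
  Matrix.fromBlocks !![b ^ 3, 3 / 4 * (τ * b); 0, b]
    !![-(3 / 32) * (τ ^ 3 * b⁻¹ ^ 3), 3 / 8 * (τ ^ 2 * b⁻¹);
      -(3 / 8) * (τ ^ 2 * b⁻¹ ^ 3), τ * b⁻¹]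
    !![0, 0; 0, 0] !![b⁻¹ ^ 3, 0; -(3 / 4) * (τ * b⁻¹ ^ 3), b⁻¹]

theorem gaugeMatrix_mem {b : ℂ} (hb : b ≠ 0) (τ : ℂ) :
    gaugeMatrix b τ ∈ Matrix.symplecticGroup (Fin 2) ℂ := by
  rw [mem_symplectic_iff_col]
  simp only [omega, Matrix.col, gaugeMatrix]
  refine ⟨?_, ?_, ?_, ?_, ?_, ?_⟩ <;> simp <;> field_simp <;> ring

variable {S : Type*} [TopologicalSpace S] [ChartedSpace ℂ S]

theorem mderiv_gaugeMatrix (z : S → ℂ) {b τ : S → ℂ} {p : S} (hb : HolAt b p) (hτ : HolAt τ p)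
    (hb0 : b p ≠ 0) : MHolAt (fun q => gaugeMatrix (b q) (τ q)) p ∧
    mderiv z (fun q => gaugeMatrix (b q) (τ q)) p =
      Matrix.fromBlocks
        !![3 * b p ^ 2 * cderiv z b p, 3 / 4 * (cderiv z τ p * b p + τ p * cderiv z b p);
          0, cderiv z b p]
        !![-(3 / 32) * (3 * τ p ^ 2 * cderiv z τ p * (b p)⁻¹ ^ 3 +
            τ p ^ 3 * (3 * (b p)⁻¹ ^ 2 * (-cderiv z b p / b p ^ 2))),
          3 / 8 * (2 * τ p * cderiv z τ p * (b p)⁻¹ + τ p ^ 2 * (-cderiv z b p / b p ^ 2));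
          -(3 / 8) * (2 * τ p * cderiv z τ p * (b p)⁻¹ ^ 3 +
            τ p ^ 2 * (3 * (b p)⁻¹ ^ 2 * (-cderiv z b p / b p ^ 2))),
          cderiv z τ p * (b p)⁻¹ + τ p * (-cderiv z b p / b p ^ 2)]
        !![0, 0; 0, 0]
        !![3 * (b p)⁻¹ ^ 2 * (-cderiv z b p / b p ^ 2), 0;
          -(3 / 4) * (cderiv z τ p * (b p)⁻¹ ^ 3 +
            τ p * (3 * (b p)⁻¹ ^ 2 * (-cderiv z b p / b p ^ 2))),
          -cderiv z b p / b p ^ 2] := by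
  have hc := hb.inv hb0
  have hd := cderiv_inv z hb hb0
  have t2 := hτ.pow 2
  have t3 := hτ.pow 3
  have b3 := hb.pow 3
  have c3 := hc.pow 3
  have m1 := hτ.mul hb
  have m2 := t3.mul c3
  have m3 := t2.mul hc
  have m4 := t2.mul c3
  have m5 := hτ.mul hc
  have m6 := hτ.mul c3
  constructor
  · intro i j
    rcases i with i | i <;> rcases j with j | j <;> fin_cases i <;> fin_cases j <;>
      simp [gaugeMatrix, -neg_mul, -inv_pow, HolAt.mul, HolAt.const, *]
  · ext i j
    rcases i with i | i <;> rcases j with j | j <;> fin_cases i <;> fin_cases j <;>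
      simp [gaugeMatrix, mderiv, -neg_mul, -inv_pow, HolAt.const, cderiv_mul, cderiv_pow, *]

theorem gaugeMatrix_transform {b : ℂ} (hb : b ≠ 0) (τ θ s k r db dτ : ℂ) :
    Phi θ s k r * gaugeMatrix b τ + Matrix.fromBlocks
        !![3 * b ^ 2 * db, 3 / 4 * (dτ * b + τ * db); 0, db]
        !![-(3 / 32) * (3 * τ ^ 2 * dτ * b⁻¹ ^ 3 + τ ^ 3 * (3 * b⁻¹ ^ 2 * (-db / b ^ 2))),
          3 / 8 * (2 * τ * dτ * b⁻¹ + τ ^ 2 * (-db / b ^ 2));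
          -(3 / 8) * (2 * τ * dτ * b⁻¹ ^ 3 + τ ^ 2 * (3 * b⁻¹ ^ 2 * (-db / b ^ 2))),
          dτ * b⁻¹ + τ * (-db / b ^ 2)]
        !![0, 0; 0, 0]
        !![3 * b⁻¹ ^ 2 * (-db / b ^ 2), 0;
          -(3 / 4) * (dτ * b⁻¹ ^ 3 + τ * (3 * b⁻¹ ^ 2 * (-db / b ^ 2))), -db / b ^ 2] =
      gaugeMatrix b τ * Phi (b ^ 2 * θ) (s - θ * τ / 4 + db / b)
        ((k + dτ + 2 * τ * s - θ * τ ^ 2 / 4) / b ^ 2) (r / b ^ 6) := by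
  simp only [Phi, gaugeMatrix, Matrix.fromBlocks_multiply, Matrix.fromBlocks_add]
  congr 1 <;> ext i j <;> fin_cases i <;> fin_cases j <;>
    simp <;> field_simp <;> ring

end Gauge

/-! ### Adapted and normal frames -/

section Frames

variable {S : Type*} [TopologicalSpace S] [ChartedSpace ℂ S]

/-- `A` is a symplectic frame along `f` near `p`. -/
structure FrameAt (f : S → Q3) (A : S → Mat4) (p : S) : Prop where
  hol : MHolAt A p
  mem : ∀ᶠ q in 𝓝 p, A q ∈ Matrix.symplecticGroup (Fin 2) ℂ
  span_eq : ∀ᶠ q in 𝓝 p, (f q).plane = Submodule.span ℂ {(A q).col i1, (A q).col i2}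

/-- `A` is near `p` an adapted frame along `f`, with the independent entries of `A⁻¹ dA/dz` named
`θ`, `s`, `k`, `r`. -/
structure AdaptedAt (f : S → Q3) (z : S → ℂ) (A : S → Mat4) (θ s k r : S → ℂ) (p : S) :
    Prop where
  frame : FrameAt f A p
  holθ : HolAt θ p
  hols : HolAt s p
  holk : HolAt k p
  holr : HolAt r p
  ne : θ p ≠ 0
  eq : ∀ᶠ q in 𝓝 p, mc z A q = Phi (θ q) (s q) (k q) (r q)

/-- A normal frame for `f` with respect to the coordinate `z`: an adapted frame with
`φ⁴₂ = dz` and `φ²₂ = 0`. The functions `k = φ²₄/dz` and `r = φ¹₃/dz` turn out to be invariants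
of `f` and `z`. -/
abbrev NormalAt (f : S → Q3) (z : S → ℂ) (A : S → Mat4) (k r : S → ℂ) (p : S) : Prop :=
  AdaptedAt f z A (fun _ => 1) (fun _ => 0) k r p

/-- The Maurer-Cartan matrix of a normal frame. -/
noncomputable abbrev Phi1 (k r : ℂ) : Mat4 := Phi 1 0 k r

theorem eq_Phi_of_isAdaptedForm {z : S → ℂ} {A : S → Mat4} {p : S} (hA : MHolAt A p)
    (hmem : ∀ᶠ q in 𝓝 p, A q ∈ Matrix.symplecticGroup (Fin 2) ℂ)
    (h : IsAdaptedForm (mc z A p)) :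
    mc z A p = Phi (mc z A p i4 i2) (mc z A p i2 i2) (mc z A p i2 i4) (mc z A p i1 i3) := by
  obtain ⟨l1, l2, l3, l4, l5, l6⟩ := mc_mem_lie (z := z) hA hmem
  obtain ⟨a1, a2, a3, a4, a5, a6, -⟩ := h
  generalize mc z A p = M at *
  ext i j
  rcases i with i | i <;> rcases j with j | j <;> fin_cases i <;> fin_cases j <;>
    simp [Phi]
  · linear_combination a4
  · linear_combination a5 / 4
  · linear_combination a3
  · linear_combination a6
  · linear_combination l5 + a6
  · exact a1
  · linear_combination l6 + a2
  · exact a2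
  · linear_combination l1 - a4
  · linear_combination l3 - a3
  · linear_combination l4 - a5 / 4
  · exact l2

theorem isAdaptedForm_Phi {θ : ℂ} (hθ : θ ≠ 0) (s k r : ℂ) : IsAdaptedForm (Phi θ s k r) := by
  constructor <;> simp [Phi] <;> first | exact hθ | ring

theorem IsAdaptedForm.smul {M : Mat4} (h : IsAdaptedForm M) {c : ℂ} (hc : c ≠ 0) :
    IsAdaptedForm (c • M) := by
  obtain ⟨a1, a2, a3, a4, a5, a6, a7⟩ := h
  constructor <;> simp only [Matrix.smul_apply, smul_eq_mul]
  · rw [a1, mul_zero]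
  · rw [a2, mul_zero]
  · linear_combination c * a3
  · linear_combination c * a4
  · linear_combination c * a5
  · rw [a6, mul_zero]
  · exact mul_ne_zero hc a7

theorem AdaptedAt.mderiv_eq {f : S → Q3} {z : S → ℂ} {A : S → Mat4} {θ s k r : S → ℂ} {p : S}
    (h : AdaptedAt f z A θ s k r p) :
    ∀ᶠ q in 𝓝 p, mderiv z A q = A q * Phi (θ q) (s q) (k q) (r q) := by
  filter_upwards [h.eq, h.frame.mem] with q h1 h2 using (mderiv_eq_iff_mc h2).2 h1

theorem AdaptedAt.congr {f : S → Q3} {z : S → ℂ} {A : S → Mat4} {θ s k r θ' s' k' r' : S → ℂ}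
    {p : S} (h : AdaptedAt f z A θ s k r p) (hθ : θ =ᶠ[𝓝 p] θ') (hs : s =ᶠ[𝓝 p] s')
    (hk : k =ᶠ[𝓝 p] k') (hr : r =ᶠ[𝓝 p] r') : AdaptedAt f z A θ' s' k' r' p where
  frame := h.frame
  holθ := h.holθ.congr hθ
  hols := h.hols.congr hs
  holk := h.holk.congr hk
  holr := h.holr.congr hr
  ne := hθ.eq_of_nhds ▸ h.ne
  eq := by
    filter_upwards [h.eq, hθ, hs, hk, hr] with q h0 h1 h2 h3 h4
    rw [h0, h1, h2, h3, h4]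

theorem span_pair_triangular {u v : C4} {a b : ℂ} (ha : a ≠ 0) (hb : b ≠ 0) (c : ℂ) :
    Submodule.span ℂ {a • u, c • u + b • v} = Submodule.span ℂ {u, v} := by
  ext w
  simp only [Submodule.mem_span_pair]
  constructor
  · rintro ⟨x, y, rfl⟩
    exact ⟨x * a + y * c, y * b, by module⟩
  · rintro ⟨x, y, rfl⟩
    refine ⟨(x - y * c / b) / a, y / b, ?_⟩
    rw [smul_add, smul_smul, smul_smul, smul_smul, ← add_assoc, ← add_smul]
    congr 2 <;> field_simp
    ring

theorem span_pair_gaugeMatrix {A : Mat4} {b : ℂ} (hb : b ≠ 0) (τ : ℂ) :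
    Submodule.span ℂ {(A * gaugeMatrix b τ).col i1, (A * gaugeMatrix b τ).col i2} =
      Submodule.span ℂ {A.col i1, A.col i2} := by
  have h1 : (A * gaugeMatrix b τ).col i1 = b ^ 3 • A.col i1 := by
    ext c
    simp [Matrix.mul_apply, Fintype.sum_sum_type, gaugeMatrix, mul_comm]
  have h2 : (A * gaugeMatrix b τ).col i2 = (3 / 4 * (τ * b)) • A.col i1 + b • A.col i2 := by
    ext c
    simp [Matrix.mul_apply, Fintype.sum_sum_type, gaugeMatrix]
    ring
  rw [h1, h2, span_pair_triangular (pow_ne_zero 3 hb) hb]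

variable [IsManifold 𝓘(ℂ) ω S]

theorem FrameAt.eventually {f : S → Q3} {A : S → Mat4} {p : S} (h : FrameAt f A p) :
    ∀ᶠ q in 𝓝 p, FrameAt f A q := by
  filter_upwards [h.hol.eventually, eventually_eventually_nhds.2 h.mem,
    eventually_eventually_nhds.2 h.span_eq] with q h1 h2 h3 using ⟨h1, h2, h3⟩

theorem AdaptedAt.eventually {f : S → Q3} {z : S → ℂ} {A : S → Mat4} {θ s k r : S → ℂ} {p : S}
    (h : AdaptedAt f z A θ s k r p) : ∀ᶠ q in 𝓝 p, AdaptedAt f z A θ s k r q := by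
  filter_upwards [h.frame.eventually, h.holθ.eventually, h.hols.eventually, h.holk.eventually,
    h.holr.eventually, h.holθ.eventually_ne h.ne, eventually_eventually_nhds.2 h.eq]
    with q h1 h2 h3 h4 h5 h6 h7 using ⟨h1, h2, h3, h4, h5, h6, h7⟩

/-- The transformation law of the Maurer-Cartan form under a change of adapted frame. -/
theorem AdaptedAt.gauge {f : S → Q3} {z : S → ℂ} {A : S → Mat4} {θ s k r b τ : S → ℂ} {p : S}
    (h : AdaptedAt f z A θ s k r p) (hz : IsCoordAt z p) (hb : HolAt b p) (hτ : HolAt τ p)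
    (hb0 : b p ≠ 0) :
    AdaptedAt f z (fun q => A q * gaugeMatrix (b q) (τ q)) (fun q => b q ^ 2 * θ q)
      (fun q => s q - θ q * τ q / 4 + cderiv z b q / b q)
      (fun q => (k q + cderiv z τ q + 2 * τ q * s q - θ q * τ q ^ 2 / 4) / b q ^ 2)
      (fun q => r q / b q ^ 6) p where
  frame := by
    refine ⟨h.frame.hol.mul (mderiv_gaugeMatrix z hb hτ hb0).1, ?_, ?_⟩
    · filter_upwards [h.frame.mem, hb.eventually_ne hb0] with q h1 h2
      exact mul_mem h1 (gaugeMatrix_mem h2 _)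
    · filter_upwards [h.frame.span_eq, hb.eventually_ne hb0] with q h1 h2
      rw [h1, span_pair_gaugeMatrix h2]
  holθ := (hb.pow 2).mul h.holθ
  hols := (h.hols.sub ((h.holθ.mul hτ).div (.const 4 p) (by norm_num))).add
    ((hb.cderiv hz).div hb hb0)
  holk := (((h.holk.add (hτ.cderiv hz)).add (((HolAt.const 2 p).mul hτ).mul h.hols)).sub
    ((h.holθ.mul (hτ.pow 2)).div (.const 4 p) (by norm_num))).div (hb.pow 2) (pow_ne_zero 2 hb0)
  holr := h.holr.div (hb.pow 6) (pow_ne_zero 6 hb0)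
  ne := mul_ne_zero (pow_ne_zero 2 hb0) h.ne
  eq := by
    filter_upwards [h.mderiv_eq, h.frame.mem, hb.eventually_ne hb0, hb.eventually,
      hτ.eventually, h.frame.hol.eventually] with q h1 h2 h3 h4 h5 h6
    obtain ⟨g1, g2⟩ := mderiv_gaugeMatrix z h4 h5 h3
    refine (mderiv_eq_iff_mc (A := fun q => A q * gaugeMatrix (b q) (τ q))
      (mul_mem h2 (gaugeMatrix_mem h3 _))).1 ?_
    rw [mderiv_mul z h6 g1, h1, g2,
      Matrix.mul_assoc, ← Matrix.mul_add, gaugeMatrix_transform h3, Matrix.mul_assoc]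

/-- Every adapted frame can be changed into a normal frame: `b = θ^(-1/2)` makes `φ⁴₂` equal to
`dz`, and then `τ` makes `φ²₂` vanish. -/
theorem AdaptedAt.exists_normal {f : S → Q3} {z : S → ℂ} {A : S → Mat4} {θ s k r : S → ℂ}
    {p : S} (h : AdaptedAt f z A θ s k r p) (hz : IsCoordAt z p) (τ : S → ℂ)
    (hτ : τ =ᶠ[𝓝 p] fun q => 4 * (s q - cderiv z θ q / (2 * θ q)) / θ q) :
    ∃ B, NormalAt f z B
      (fun q => θ q * (k q + cderiv z τ q + 2 * τ q * s q - θ q * τ q ^ 2 / 4))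
      (fun q => r q * θ q ^ 3) p := by
  obtain ⟨b, hb, hb0, hbθ⟩ := (h.holθ.inv h.ne).exists_root (inv_ne_zero h.ne) two_ne_zero
  have hτh : HolAt τ p := by
    refine HolAt.congr ?_ hτ.symm
    exact ((HolAt.const 4 p).mul (h.hols.sub ((h.holθ.cderiv hz).div
      ((HolAt.const 2 p).mul h.holθ) (mul_ne_zero two_ne_zero h.ne)))).div h.holθ h.ne
  have hall : ∀ᶠ q in 𝓝 p, θ q ≠ 0 ∧ b q ≠ 0 ∧ b q ^ 2 * θ q = 1 ∧
      τ q = 4 * (s q - cderiv z θ q / (2 * θ q)) / θ q ∧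
      2 * cderiv z b q * θ q + b q * cderiv z θ q = 0 := by
    have hbθ' : (fun q => b q ^ 2 * θ q) =ᶠ[𝓝 p] fun _ => 1 := by
      filter_upwards [hbθ, h.holθ.eventually_ne h.ne] with q h1 h2
      rw [h1, inv_mul_cancel₀ h2]
    filter_upwards [hbθ', h.holθ.eventually_ne h.ne, hb.eventually_ne hb0, hτ, hb.eventually,
      h.holθ.eventually, hbθ'.eventuallyEq_nhds] with q h1 h2 h3 h4 h5 h6 h7
    refine ⟨h2, h3, h1, h4, ?_⟩
    have h8 := cderiv_congr (z := z) h7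
    rw [cderiv_const, cderiv_mul z (h5.pow 2) h6, cderiv_pow z h5] at h8
    have : b q * (2 * cderiv z b q * θ q + b q * cderiv z θ q) = 0 := by
      push_cast at h8; linear_combination h8
    exact (mul_eq_zero.1 this).resolve_left h3
  refine ⟨_, (h.gauge hz hb hτh hb0).congr ?_ ?_ ?_ ?_⟩
  · exact hall.mono fun q hq => hq.2.2.1
  · filter_upwards [hall] with q ⟨h1, h2, h3, h4, h5⟩
    have h6 : cderiv z b q = -(b q * cderiv z θ q) / (2 * θ q) := by
      field_simp; linear_combination h5
    rw [h4, h6]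
    field_simp
    ring
  · filter_upwards [hall] with q ⟨h1, h2, h3, _, _⟩
    rw [div_eq_iff (pow_ne_zero 2 h2)]
    linear_combination -(k q + cderiv z τ q + 2 * τ q * s q - θ q * τ q ^ 2 / 4) * h3
  · filter_upwards [hall] with q ⟨h1, h2, h3, _, _⟩
    rw [div_eq_iff (pow_ne_zero 6 h2)]
    linear_combination -r q * ((b q ^ 2 * θ q) ^ 2 + b q ^ 2 * θ q + 1) * h3

end Frames

/-! ### The transition matrix of two normal frames -/

section Transition

theorem mul_Phi1_apply (T : Mat4) (k r : ℂ) (i : Fin 2 ⊕ Fin 2) :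
    (T * Phi1 k r) i i1 = T i i2 ∧
    (T * Phi1 k r) i i2 = 3 / 4 * (k * T i i1) + T i i4 ∧
    (T * Phi1 k r) i i3 = r * T i i1 - 3 / 4 * (k * T i i4) ∧
    (T * Phi1 k r) i i4 = k * T i i2 - T i i3 := by
  refine ⟨?_, ?_, ?_, ?_⟩ <;> simp [Phi, Matrix.mul_apply, Fintype.sum_sum_type] <;> ring

theorem Phi1_mul_apply (T : Mat4) (k r : ℂ) (j : Fin 2 ⊕ Fin 2) :
    (Phi1 k r * T) i1 j = 3 / 4 * (k * T i2 j) + r * T i3 j ∧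
    (Phi1 k r * T) i2 j = T i1 j + k * T i4 j ∧
    (Phi1 k r * T) i3 j = -T i4 j ∧
    (Phi1 k r * T) i4 j = T i2 j - 3 / 4 * (k * T i3 j) := by
  refine ⟨?_, ?_, ?_, ?_⟩ <;> simp [Phi, Matrix.mul_apply, Fintype.sum_sum_type] <;> ring

variable {S : Type*} [TopologicalSpace S] [ChartedSpace ℂ S]

/-- The differential system `T' = T N - N̂ T` satisfied by the matrix `T` relating two normal
frames with Maurer-Cartan matrices `N` and `N̂`. -/
structure TransitionAt (z k r kh rh : S → ℂ) (T : S → Mat4) (p : S) : Prop where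
  coord : IsCoordAt z p
  hol : MHolAt T p
  holk : HolAt k p
  holr : HolAt r p
  holkh : HolAt kh p
  holrh : HolAt rh p
  eq : ∀ᶠ q in 𝓝 p, mderiv z T q = T q * Phi1 (k q) (r q) - Phi1 (kh q) (rh q) * T q

variable {z k r kh rh : S → ℂ} {T : S → Mat4} {p : S}

/-- The transition system, entry by entry. -/
theorem TransitionAt.cderiv_entries (h : TransitionAt z k r kh rh T p) :
    ∀ᶠ q in 𝓝 p,
    (cderiv z (fun q => T q i3 i1) q = T q i3 i2 + T q i4 i1 ∧
     cderiv z (fun q => T q i3 i2) q = 3 / 4 * (k q * T q i3 i1) + T q i3 i4 + T q i4 i2 ∧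
     cderiv z (fun q => T q i4 i1) q =
      T q i4 i2 - T q i2 i1 + 3 / 4 * (kh q * T q i3 i1) ∧
     cderiv z (fun q => T q i4 i2) q =
      3 / 4 * (k q * T q i4 i1) + T q i4 i4 - T q i2 i2 + 3 / 4 * (kh q * T q i3 i2)) ∧
    (cderiv z (fun q => T q i3 i4) q = k q * T q i3 i2 - T q i3 i3 + T q i4 i4 ∧
     cderiv z (fun q => T q i2 i1) q = T q i2 i2 - T q i1 i1 - kh q * T q i4 i1 ∧
     cderiv z (fun q => T q i2 i2) q =
      3 / 4 * (k q * T q i2 i1) + T q i2 i4 - T q i1 i2 - kh q * T q i4 i2 ∧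
     cderiv z (fun q => T q i4 i4) q =
      k q * T q i4 i2 - T q i4 i3 - T q i2 i4 + 3 / 4 * (kh q * T q i3 i4)) ∧
    (cderiv z (fun q => T q i3 i3) q =
      r q * T q i3 i1 - 3 / 4 * (k q * T q i3 i4) + T q i4 i3 ∧
     cderiv z (fun q => T q i1 i1) q =
      T q i1 i2 - 3 / 4 * (kh q * T q i2 i1) - rh q * T q i3 i1 ∧
     cderiv z (fun q => T q i1 i2) q =
      3 / 4 * (k q * T q i1 i1) + T q i1 i4 - 3 / 4 * (kh q * T q i2 i2) - rh q * T q i3 i2 ∧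
     cderiv z (fun q => T q i2 i4) q =
      k q * T q i2 i2 - T q i2 i3 - T q i1 i4 - kh q * T q i4 i4) ∧
    (cderiv z (fun q => T q i4 i3) q =
      r q * T q i4 i1 - 3 / 4 * (k q * T q i4 i4) - T q i2 i3 + 3 / 4 * (kh q * T q i3 i3) ∧
     cderiv z (fun q => T q i1 i4) q =
      k q * T q i1 i2 - T q i1 i3 - 3 / 4 * (kh q * T q i2 i4) - rh q * T q i3 i4 ∧
     cderiv z (fun q => T q i2 i3) q =
      r q * T q i2 i1 - 3 / 4 * (k q * T q i2 i4) - T q i1 i3 - kh q * T q i4 i3 ∧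
     cderiv z (fun q => T q i1 i3) q =
      r q * T q i1 i1 - 3 / 4 * (k q * T q i1 i4) - 3 / 4 * (kh q * T q i2 i3) -
        rh q * T q i3 i3) := by
  filter_upwards [h.eq] with q hq
  have e : ∀ i j, cderiv z (fun q => T q i j) q =
      (T q * Phi1 (k q) (r q)) i j - (Phi1 (kh q) (rh q) * T q) i j := fun i j =>
    congrFun (congrFun hq i) j
  have c := mul_Phi1_apply (T q) (k q) (r q)
  have d := Phi1_mul_apply (T q) (kh q) (rh q)
  simp only [e, (c _).1, (c _).2.1, (c _).2.2.1, (c _).2.2.2, (d _).1, (d _).2.1, (d _).2.2.1,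
    (d _).2.2.2]
  refine ⟨⟨?_, ?_, ?_, ?_⟩, ⟨?_, ?_, ?_, ?_⟩, ⟨?_, ?_, ?_, ?_⟩, ⟨?_, ?_, ?_, ?_⟩⟩ <;> ring

theorem OrdAt.of_eq {n : ℕ} {g h : S → ℂ} {p : S} (hg : OrdAt n g p) (e : ∀ q, g q = h q) :
    OrdAt n h p := hg.congr (Eventually.of_forall e)

theorem TransitionAt.diag_ne_zero (hdet : (T p).det ≠ 0)
    (x12 : OrdAt 1 (fun q => T q i1 i1 - T q i2 i2) p) (a21 : OrdAt 1 (fun q => T q i2 i1) p)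
    (a31 : OrdAt 1 (fun q => T q i3 i1) p) (a41 : OrdAt 1 (fun q => T q i4 i1) p) :
    T p i2 i2 ≠ 0 := by
  intro h0
  have e := x12.eq_zero
  rw [h0, sub_zero] at e
  refine hdet (Matrix.det_eq_zero_of_column_eq_zero i1 fun i => ?_)
  rcases i with i | i <;> fin_cases i
  exacts [e, a21.eq_zero, a31.eq_zero, a41.eq_zero]

variable [IsManifold 𝓘(ℂ) ω S]

theorem OrdAt.succ_of_eq {n : ℕ} {g h : S → ℂ} (hz : IsCoordAt z p) (hg : HolAt g p)
    (h0 : g p = 0) (e : ∀ᶠ q in 𝓝 p, IsotropicCurve.cderiv z g q = h q) (hh : OrdAt n h p) :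
    OrdAt (n + 1) g p :=
  .succ hz hg h0 (hh.congr (e.mono fun _ hq => hq.symm))

theorem OrdAt.deriv_eq {n : ℕ} {g h : S → ℂ} (hz : IsCoordAt z p)
    (hg : OrdAt (n + 1) g p) (e : ∀ᶠ q in 𝓝 p, IsotropicCurve.cderiv z g q = h q) :
    OrdAt n h p := (hg.cderiv hz).congr e

theorem HolAt.ordAt_one (z : S → ℂ) (hz : IsCoordAt z p) {g : S → ℂ} (hg : HolAt g p)
    (h0 : g p = 0) : OrdAt 1 g p := .succ hz hg h0 (hg.cderiv hz).ordAt_zero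

/-- If two normal frames have the same `k` and agree at `p`, then their planes have contact of
order four at `p`. -/
theorem TransitionAt.ordAt_five (h : TransitionAt z k r k rh T p) (h1 : T p = 1) :
    OrdAt 5 (fun q => T q i3 i1) p ∧ OrdAt 5 (fun q => T q i3 i2) p ∧
    OrdAt 5 (fun q => T q i4 i1) p ∧ OrdAt 5 (fun q => T q i4 i2) p := by
  have hz := h.coord
  have hk := h.holk
  have hr := h.holr
  have hrh := h.holrh
  have H := h.hol
  have E := h.cderiv_entries
  have z0 : ∀ i j, i ≠ j → T p i j = 0 := fun i j hij => by rw [h1, Matrix.one_apply_ne hij]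
  have o : ∀ i j, i ≠ j → OrdAt 1 (fun q => T q i j) p := fun i j hij =>
    (H i j).ordAt_one z hz (z0 i j hij)
  have hx : ∀ i j, HolAt (fun q => T q i i - T q j j) p := fun i j => (H i i).sub (H j j)
  have zx : ∀ i j, T p i i - T p j j = 0 := fun i j => by simp [h1]
  have ox : ∀ i j, OrdAt 1 (fun q => T q i i - T q j j) p := fun i j =>
    (hx i j).ordAt_one z hz (zx i j)
  have Ev := H.eventually
  -- the derivatives of the differences of diagonal entries
  have Ex12 : ∀ᶠ q in 𝓝 p, cderiv z (fun q => T q i1 i1 - T q i2 i2) q =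
      2 * T q i1 i2 - T q i2 i4 - 3 / 2 * (k q * T q i2 i1) - rh q * T q i3 i1 +
        k q * T q i4 i2 := by
    filter_upwards [E, Ev] with q hq hv
    rw [cderiv_sub z (hv _ _) (hv _ _), hq.2.2.1.2.1, hq.2.1.2.2.1]; ring
  have Ex24 : ∀ᶠ q in 𝓝 p, cderiv z (fun q => T q i2 i2 - T q i4 i4) q =
      2 * T q i2 i4 - T q i1 i2 + T q i4 i3 + 3 / 4 * (k q * T q i2 i1) -
        2 * (k q * T q i4 i2) - 3 / 4 * (k q * T q i3 i4) := by
    filter_upwards [E, Ev] with q hq hv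
    rw [cderiv_sub z (hv _ _) (hv _ _), hq.2.1.2.2.1, hq.2.1.2.2.2]; ring
  have Ex43 : ∀ᶠ q in 𝓝 p, cderiv z (fun q => T q i4 i4 - T q i3 i3) q =
      k q * T q i4 i2 - 2 * T q i4 i3 - T q i2 i4 + 3 / 2 * (k q * T q i3 i4) -
        r q * T q i3 i1 := by
    filter_upwards [E, Ev] with q hq hv
    rw [cderiv_sub z (hv _ _) (hv _ _), hq.2.1.2.2.2, hq.2.2.1.1]; ring
  -- The four implications below raise vanishing orders: the derivative of each entry is a
  -- combination of entries whose order is already known.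
  have lower : ∀ n, OrdAt n (fun q => T q i3 i1) p ∧ OrdAt n (fun q => T q i3 i2) p ∧
      OrdAt n (fun q => T q i4 i1) p ∧ OrdAt n (fun q => T q i4 i2) p →
      OrdAt n (fun q => T q i3 i4) p → OrdAt n (fun q => T q i2 i1) p →
      OrdAt n (fun q => T q i2 i2 - T q i4 i4) p →
      OrdAt (n + 1) (fun q => T q i3 i1) p ∧ OrdAt (n + 1) (fun q => T q i3 i2) p ∧
      OrdAt (n + 1) (fun q => T q i4 i1) p ∧ OrdAt (n + 1) (fun q => T q i4 i2) p := by
    rintro n ⟨a31, a32, a41, a42⟩ a34 a21 ax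
    refine ⟨.succ_of_eq hz (H _ _) (z0 _ _ (by simp)) (E.mono fun q hq => hq.1.1) (a32.add a41),
      .succ_of_eq hz (H _ _) (z0 _ _ (by simp)) (E.mono fun q hq => hq.1.2.1)
        ((((a31.mul_left hk).const_mul _).add a34).add a42),
      .succ_of_eq hz (H _ _) (z0 _ _ (by simp)) (E.mono fun q hq => hq.1.2.2.1)
        ((a42.sub a21).add ((a31.mul_left hk).const_mul _)),
      .succ_of_eq hz (H _ _) (z0 _ _ (by simp)) (E.mono fun q hq => hq.1.2.2.2) ?_⟩
    refine ((((a41.mul_left hk).const_mul (3 / 4)).sub ax).add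
      ((a32.mul_left hk).const_mul (3 / 4))).of_eq fun q => ?_
    ring
  have middle : ∀ n, OrdAt n (fun q => T q i3 i2) p → OrdAt n (fun q => T q i4 i1) p →
      OrdAt n (fun q => T q i4 i4 - T q i3 i3) p → OrdAt n (fun q => T q i1 i1 - T q i2 i2) p →
      OrdAt (n + 1) (fun q => T q i3 i4) p ∧ OrdAt (n + 1) (fun q => T q i2 i1) p := by
    intro n a32 a41 x43 x12
    refine ⟨.succ_of_eq hz (H _ _) (z0 _ _ (by simp)) (E.mono fun q hq => hq.2.1.1)
      (((a32.mul_left hk).add x43).of_eq fun q => by ring),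
      .succ_of_eq hz (H _ _) (z0 _ _ (by simp)) (E.mono fun q hq => hq.2.1.2.1) ?_⟩
    exact ((x12.const_mul (-1)).sub (a41.mul_left hk)).of_eq fun q => by ring
  have diag : ∀ n, OrdAt n (fun q => T q i1 i2) p → OrdAt n (fun q => T q i2 i4) p →
      OrdAt n (fun q => T q i4 i3) p → OrdAt n (fun q => T q i2 i1) p →
      OrdAt n (fun q => T q i3 i4) p → OrdAt n (fun q => T q i3 i1) p →
      OrdAt n (fun q => T q i4 i2) p →
      OrdAt (n + 1) (fun q => T q i1 i1 - T q i2 i2) p ∧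
      OrdAt (n + 1) (fun q => T q i2 i2 - T q i4 i4) p ∧
      OrdAt (n + 1) (fun q => T q i4 i4 - T q i3 i3) p := by
    intro n a12 a24 a43 a21 a34 a31 a42
    refine ⟨.succ_of_eq hz (hx _ _) (zx _ _) Ex12 ?_, .succ_of_eq hz (hx _ _) (zx _ _) Ex24 ?_,
      .succ_of_eq hz (hx _ _) (zx _ _) Ex43 ?_⟩
    · exact ((((a12.const_mul _).sub a24).sub ((a21.mul_left hk).const_mul _)).sub
        (a31.mul_left hrh)).add (a42.mul_left hk)
    · exact (((((a24.const_mul _).sub a12).add a43).add ((a21.mul_left hk).const_mul _)).sub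
        ((a42.mul_left hk).const_mul _)).sub ((a34.mul_left hk).const_mul _)
    · exact ((((a42.mul_left hk).sub (a43.const_mul _)).sub a24).add
        ((a34.mul_left hk).const_mul _)).sub (a31.mul_left hr)
  have upper : ∀ n, OrdAt n (fun q => T q i1 i1 - T q i2 i2) p →
      OrdAt n (fun q => T q i2 i2 - T q i4 i4) p → OrdAt n (fun q => T q i4 i4 - T q i3 i3) p →
      OrdAt n (fun q => T q i1 i4) p → OrdAt n (fun q => T q i2 i3) p →
      OrdAt n (fun q => T q i3 i2) p → OrdAt n (fun q => T q i4 i1) p →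
      OrdAt (n + 1) (fun q => T q i1 i2) p ∧ OrdAt (n + 1) (fun q => T q i2 i4) p ∧
      OrdAt (n + 1) (fun q => T q i4 i3) p := by
    intro n x12 x24 x43 a14 a23 a32 a41
    refine ⟨.succ_of_eq hz (H _ _) (z0 _ _ (by simp)) (E.mono fun q hq => hq.2.2.1.2.2.1) ?_,
      .succ_of_eq hz (H _ _) (z0 _ _ (by simp)) (E.mono fun q hq => hq.2.2.1.2.2.2) ?_,
      .succ_of_eq hz (H _ _) (z0 _ _ (by simp)) (E.mono fun q hq => hq.2.2.2.1) ?_⟩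
    · exact ((((x12.mul_left hk).const_mul (3 / 4)).add a14).sub (a32.mul_left hrh)).of_eq
        fun q => by ring
    · exact (((x24.mul_left hk).sub a23).sub a14).of_eq fun q => by ring
    · exact (((a41.mul_left hr).sub ((x43.mul_left hk).const_mul (3 / 4))).sub a23).of_eq
        fun q => by ring
  have a14 : OrdAt 2 (fun q => T q i1 i4) p :=
    .succ_of_eq hz (H _ _) (z0 _ _ (by simp)) (E.mono fun q hq => hq.2.2.2.2.1)
      (((((o i1 i2 (by simp)).mul_left hk).sub (o i1 i3 (by simp))).sub
        (((o i2 i4 (by simp)).mul_left hk).const_mul _)).sub ((o i3 i4 (by simp)).mul_left hrh))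
  have a23 : OrdAt 2 (fun q => T q i2 i3) p :=
    .succ_of_eq hz (H _ _) (z0 _ _ (by simp)) (E.mono fun q hq => hq.2.2.2.2.2.1)
      (((((o i2 i1 (by simp)).mul_left hr).sub (((o i2 i4 (by simp)).mul_left hk).const_mul _)).sub
        (o i1 i3 (by simp))).sub ((o i4 i3 (by simp)).mul_left hk))
  obtain ⟨b12, b24, b43⟩ := upper 1 (ox _ _) (ox _ _) (ox _ _) (o _ _ (by simp))
    (o _ _ (by simp)) (o _ _ (by simp)) (o _ _ (by simp))
  obtain ⟨x12, x24, x43⟩ := diag 1 (o _ _ (by simp)) (o _ _ (by simp)) (o _ _ (by simp))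
    (o _ _ (by simp)) (o _ _ (by simp)) (o _ _ (by simp)) (o _ _ (by simp))
  obtain ⟨b34, b21⟩ := middle 1 (o _ _ (by simp)) (o _ _ (by simp)) (ox _ _) (ox _ _)
  have b := lower 1 ⟨o _ _ (by simp), o _ _ (by simp), o _ _ (by simp), o _ _ (by simp)⟩
    (o _ _ (by simp)) (o _ _ (by simp)) (ox _ _)
  obtain ⟨c12, c24, c43⟩ := upper 2 x12 x24 x43 a14 a23 b.2.1 b.2.2.1
  obtain ⟨y12, y24, y43⟩ := diag 2 b12 b24 b43 b21 b34 b.1 b.2.2.2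
  obtain ⟨c34, c21⟩ := middle 2 b.2.1 b.2.2.1 x43 x12
  have c := lower 2 b b34 b21 x24
  obtain ⟨-, w24, -⟩ := diag 3 c12 c24 c43 c21 c34 c.1 c.2.2.2
  obtain ⟨d34, d21⟩ := middle 3 c.2.1 c.2.2.1 y43 y12
  exact lower 4 (lower 3 c c34 c21 y24) d34 d21 w24

/-- Contact of order `m + 3` forces the listed vanishing orders of the entries of the transition
matrix: differentiate the entries of its lower left block repeatedly, and solve the resulting
linear relations for the remaining entries. -/
theorem TransitionAt.orders (h : TransitionAt z k r kh rh T p) (m : ℕ)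
    (a31 : OrdAt (m + 4) (fun q => T q i3 i1) p) (a32 : OrdAt (m + 4) (fun q => T q i3 i2) p)
    (a41 : OrdAt (m + 4) (fun q => T q i4 i1) p) (a42 : OrdAt (m + 4) (fun q => T q i4 i2) p) :
    (OrdAt (m + 3) (fun q => T q i3 i4) p ∧ OrdAt (m + 3) (fun q => T q i2 i1) p) ∧
    (OrdAt (m + 3) (fun q => T q i2 i2 - T q i4 i4) p ∧
      OrdAt (m + 2) (fun q => T q i1 i1 - T q i2 i2) p ∧
      OrdAt (m + 2) (fun q => T q i4 i4 - T q i3 i3) p) ∧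
    (OrdAt (m + 2) (fun q => 2 * T q i2 i4 - T q i1 i2 + T q i4 i3) p ∧
      OrdAt (m + 1) (fun q => T q i1 i2) p ∧ OrdAt (m + 1) (fun q => T q i2 i4) p ∧
      OrdAt (m + 1) (fun q => T q i4 i3) p) := by
  have hz := h.coord
  have hk := h.holk
  have hr := h.holr
  have hkh := h.holkh
  have hrh := h.holrh
  have H := h.hol
  have E := h.cderiv_entries
  have Ev := H.eventually
  have b31 := a31.mono (m := m + 3) (by omega)
  have b32 := a32.mono (m := m + 3) (by omega)
  have b41 := a41.mono (m := m + 3) (by omega)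
  have b42 := a42.mono (m := m + 3) (by omega)
  have c34 : OrdAt (m + 3) (fun q => T q i3 i4) p :=
    (((a32.deriv_eq hz (E.mono fun q hq => hq.1.2.1)).sub
      ((b31.mul_left hk).const_mul (3 / 4))).sub b42).of_eq fun q => by ring
  have c21 : OrdAt (m + 3) (fun q => T q i2 i1) p :=
    ((b42.add ((b31.mul_left hkh).const_mul (3 / 4))).sub
      (a41.deriv_eq hz (E.mono fun q hq => hq.1.2.2.1))).of_eq fun q => by ring
  have x24 : OrdAt (m + 3) (fun q => T q i2 i2 - T q i4 i4) p :=
    ((((b41.mul_left hk).const_mul (3 / 4)).add ((b32.mul_left hkh).const_mul (3 / 4))).sub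
      (a42.deriv_eq hz (E.mono fun q hq => hq.1.2.2.2))).of_eq fun q => by ring
  have d31 := a31.mono (m := m + 2) (by omega)
  have d32 := a32.mono (m := m + 2) (by omega)
  have d41 := a41.mono (m := m + 2) (by omega)
  have d42 := a42.mono (m := m + 2) (by omega)
  have x43 : OrdAt (m + 2) (fun q => T q i4 i4 - T q i3 i3) p :=
    ((c34.deriv_eq hz (E.mono fun q hq => hq.2.1.1)).sub (d32.mul_left hk)).of_eq
      fun q => by ring
  have x12 : OrdAt (m + 2) (fun q => T q i1 i1 - T q i2 i2) p :=
    (((c21.deriv_eq hz (E.mono fun q hq => hq.2.1.2.1)).add (d41.mul_left hkh)).const_mul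
      (-1)).of_eq fun q => by ring
  have Ex24 : ∀ᶠ q in 𝓝 p, cderiv z (fun q => T q i2 i2 - T q i4 i4) q =
      2 * T q i2 i4 - T q i1 i2 + T q i4 i3 + 3 / 4 * (k q * T q i2 i1) - kh q * T q i4 i2 -
        k q * T q i4 i2 - 3 / 4 * (kh q * T q i3 i4) := by
    filter_upwards [E, Ev] with q hq hv
    rw [cderiv_sub z (hv _ _) (hv _ _), hq.2.1.2.2.1, hq.2.1.2.2.2]; ring
  have y : OrdAt (m + 2) (fun q => 2 * T q i2 i4 - T q i1 i2 + T q i4 i3) p :=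
    (((((x24.deriv_eq hz Ex24).sub (((c21.mono (by omega)).mul_left hk).const_mul (3 / 4))).add
      (d42.mul_left hkh)).add (d42.mul_left hk)).add
      (((c34.mono (by omega)).mul_left hkh).const_mul (3 / 4))).of_eq fun q => by ring
  have Ex12 : ∀ᶠ q in 𝓝 p, cderiv z (fun q => T q i1 i1 - T q i2 i2) q =
      2 * T q i1 i2 - T q i2 i4 - 3 / 4 * (kh q * T q i2 i1) - 3 / 4 * (k q * T q i2 i1) -
        rh q * T q i3 i1 + kh q * T q i4 i2 := by
    filter_upwards [E, Ev] with q hq hv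
    rw [cderiv_sub z (hv _ _) (hv _ _), hq.2.2.1.2.1, hq.2.1.2.2.1]; ring
  have Ex43 : ∀ᶠ q in 𝓝 p, cderiv z (fun q => T q i4 i4 - T q i3 i3) q =
      k q * T q i4 i2 - 2 * T q i4 i3 - T q i2 i4 + 3 / 4 * (kh q * T q i3 i4) +
        3 / 4 * (k q * T q i3 i4) - r q * T q i3 i1 := by
    filter_upwards [E, Ev] with q hq hv
    rw [cderiv_sub z (hv _ _) (hv _ _), hq.2.1.2.2.2, hq.2.2.1.1]; ring
  have e21 := c21.mono (m := m + 1) (by omega)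
  have e34 := c34.mono (m := m + 1) (by omega)
  have e42 := a42.mono (m := m + 1) (by omega)
  have e31 := a31.mono (m := m + 1) (by omega)
  have w12 : OrdAt (m + 1) (fun q => 2 * T q i1 i2 - T q i2 i4) p :=
    (((((x12.deriv_eq hz Ex12).add ((e21.mul_left hkh).const_mul (3 / 4))).add
      ((e21.mul_left hk).const_mul (3 / 4))).add (e31.mul_left hrh)).sub
      (e42.mul_left hkh)).of_eq fun q => by ring
  have w43 : OrdAt (m + 1) (fun q => 2 * T q i4 i3 + T q i2 i4) p :=
    (((((e42.mul_left hk).add ((e34.mul_left hkh).const_mul (3 / 4))).add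
      ((e34.mul_left hk).const_mul (3 / 4))).sub (e31.mul_left hr)).sub
      (x43.deriv_eq hz Ex43)).of_eq fun q => by ring
  have a24 : OrdAt (m + 1) (fun q => T q i2 i4) p :=
    (((y.mono (m := m + 1) (by omega)).add (w12.const_mul (1 / 2))).sub
      (w43.const_mul (1 / 2))).of_eq fun q => by ring
  refine ⟨⟨c34, c21⟩, ⟨x24, x12, x43⟩, y, ?_, a24, ?_⟩
  · exact ((w12.add a24).const_mul (1 / 2)).of_eq fun q => by ring
  · exact ((w43.sub a24).const_mul (1 / 2)).of_eq fun q => by ring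

/-- Contact of order four forces the invariants `k` of the two normal frames to agree: at `p` the
derivatives of `T₁₂`, `T₂₄` and `T₄₃`, which all vanish, combine to a multiple of
`(k - k̂) T₂₂`. -/
theorem TransitionAt.k_eq (h : TransitionAt z k r kh rh T p) (hdet : (T p).det ≠ 0)
    (a31 : OrdAt 5 (fun q => T q i3 i1) p) (a32 : OrdAt 5 (fun q => T q i3 i2) p)
    (a41 : OrdAt 5 (fun q => T q i4 i1) p) (a42 : OrdAt 5 (fun q => T q i4 i2) p) :
    k p = kh p := by
  have hz := h.coord
  have E := h.cderiv_entries
  obtain ⟨⟨a34, a21⟩, ⟨x24, x12, x43⟩, y, a12, a24, a43⟩ := h.orders 1 a31 a32 a41 a42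
  have hne := diag_ne_zero hdet (x12.mono (by norm_num)) (a21.mono (by norm_num))
    (a31.mono (by norm_num)) (a41.mono (by norm_num))
  have d24 := (a24.deriv_eq hz (E.mono fun q hq => hq.2.2.1.2.2.2)).eq_zero
  have d12 := (a12.deriv_eq hz (E.mono fun q hq => hq.2.2.1.2.2.1)).eq_zero
  have d43 := (a43.deriv_eq hz (E.mono fun q hq => hq.2.2.2.1)).eq_zero
  have e24 := x24.eq_zero
  have e12 := x12.eq_zero
  have e43 := x43.eq_zero
  have e32 := a32.eq_zero
  have e41 := a41.eq_zero
  have : (k p - kh p) * T p i2 i2 = 0 := by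
    linear_combination (2 / 5) * (d24 + d12 - d43 - kh p * e24 + rh p * e32 + r p * e41
      - 3 / 4 * k p * e12 - 3 / 4 * k p * (-e24) + 3 / 4 * kh p * (-e43 - e24))
  exact sub_eq_zero.1 ((mul_eq_zero.1 this).resolve_right hne)

/-- If the invariants `k` agree, contact of order five forces the invariants `r` to agree: at `p`
the derivative of `T₁₃` vanishes, and it equals `(r - r̂) T₂₂`. -/
theorem TransitionAt.r_eq (h : TransitionAt z k r k rh T p) (hdet : (T p).det ≠ 0)
    (a31 : OrdAt 6 (fun q => T q i3 i1) p) (a32 : OrdAt 6 (fun q => T q i3 i2) p)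
    (a41 : OrdAt 6 (fun q => T q i4 i1) p) (a42 : OrdAt 6 (fun q => T q i4 i2) p) :
    r p = rh p := by
  have hz := h.coord
  have hk := h.holk
  have hr := h.holr
  have hrh := h.holrh
  have E := h.cderiv_entries
  have Ev := h.hol.eventually
  obtain ⟨⟨a34, a21⟩, ⟨x24, x12, x43⟩, y, a12, a24, a43⟩ := h.orders 2 a31 a32 a41 a42
  have hne := diag_ne_zero hdet (x12.mono (by norm_num)) (a21.mono (by norm_num))
    (a31.mono (by norm_num)) (a41.mono (by norm_num))
  have a14 : OrdAt 2 (fun q => T q i1 i4) p :=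
    (((a12.deriv_eq hz (E.mono fun q hq => hq.2.2.1.2.2.1)).sub
      (((x12.mono (m := 2) (by norm_num)).mul_left hk).const_mul (3 / 4))).add
      ((a32.mono (m := 2) (by norm_num)).mul_left hrh)).of_eq fun q => by ring
  have a23 : OrdAt 2 (fun q => T q i2 i3) p :=
    ((((a41.mono (m := 2) (by norm_num)).mul_left hr).sub
      (((x43.mono (m := 2) (by norm_num)).mul_left hk).const_mul (3 / 4))).sub
      (a43.deriv_eq hz (E.mono fun q hq => hq.2.2.2.1))).of_eq fun q => by ring
  have Ey : ∀ᶠ q in 𝓝 p, cderiv z (fun q => 2 * T q i2 i4 - T q i1 i2 + T q i4 i3) q =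
      -3 * (T q i1 i4 + T q i2 i3) + 2 * (k q * (T q i2 i2 - T q i4 i4)) -
        3 / 4 * (k q * (T q i1 i1 - T q i2 i2)) - 3 / 4 * (k q * (T q i4 i4 - T q i3 i3)) +
        rh q * T q i3 i2 + r q * T q i4 i1 := by
    filter_upwards [E, Ev] with q hq hv
    rw [cderiv_add z (((HolAt.const 2 q).mul (hv _ _)).sub (hv _ _)) (hv _ _),
      cderiv_sub z ((HolAt.const 2 q).mul (hv _ _)) (hv _ _), cderiv_const_mul z 2 (hv _ _),
      hq.2.2.1.2.2.2, hq.2.2.1.2.2.1, hq.2.2.2.1]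
    ring
  have w : OrdAt 3 (fun q => T q i1 i4 + T q i2 i3) p :=
    ((((((y.deriv_eq hz Ey).sub (((x24.mono (m := 3) (by norm_num)).mul_left hk).const_mul
      2)).add (((x12.mono (m := 3) (by norm_num)).mul_left hk).const_mul (3 / 4))).add
      (((x43.mono (m := 3) (by norm_num)).mul_left hk).const_mul (3 / 4))).sub
      ((a32.mono (m := 3) (by norm_num)).mul_left hrh)).sub
      ((a41.mono (m := 3) (by norm_num)).mul_left hr)).const_mul (-1 / 3) |>.of_eq
      fun q => by ring
  have Ew : ∀ᶠ q in 𝓝 p, cderiv z (fun q => T q i1 i4 + T q i2 i3) q =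
      k q * T q i1 i2 - 2 * T q i1 i3 - 3 / 2 * (k q * T q i2 i4) - rh q * T q i3 i4 +
        r q * T q i2 i1 - k q * T q i4 i3 := by
    filter_upwards [E, Ev] with q hq hv
    rw [cderiv_add z (hv _ _) (hv _ _), hq.2.2.2.2.1, hq.2.2.2.2.2.1]; ring
  have a13 : OrdAt 2 (fun q => T q i1 i3) p :=
    ((((((a12.mono (m := 2) (by norm_num)).mul_left hk).sub
      (((a24.mono (m := 2) (by norm_num)).mul_left hk).const_mul (3 / 2))).sub
      ((a34.mono (m := 2) (by norm_num)).mul_left hrh)).add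
      ((a21.mono (m := 2) (by norm_num)).mul_left hr)).sub
      ((a43.mono (m := 2) (by norm_num)).mul_left hk)).sub (w.deriv_eq hz Ew)
      |>.const_mul (1 / 2) |>.of_eq fun q => by ring
  have d13 := (a13.deriv_eq hz (E.mono fun q hq => hq.2.2.2.2.2.2)).eq_zero
  have e14 := a14.eq_zero
  have e23 := a23.eq_zero
  have e24 := x24.eq_zero
  have e12 := x12.eq_zero
  have e43 := x43.eq_zero
  have : (r p - rh p) * T p i2 i2 = 0 := by
    linear_combination d13 + 3 / 4 * k p * e14 + 3 / 4 * k p * e23 - r p * e12 -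
      rh p * (e43 + e24)
  exact sub_eq_zero.1 ((mul_eq_zero.1 this).resolve_right hne)

end Transition

/-! ### Lifts, frames and contact -/

section Lifts

variable {S : Type*} [TopologicalSpace S] [ChartedSpace ℂ S]

theorem range_fin_two_apply {X Y : Type*} (u : Fin 2 → X → Y) (p : X) :
    Set.range (fun i => u i p) = {u 0 p, u 1 p} := by
  ext w; simp [Fin.exists_fin_two, eq_comm]

theorem IsLiftOn.linearIndependent {f : S → Q3} {u : Fin 2 → S → C4} {V : Set S}
    (h : IsLiftOn f u V) {p : S} (hp : p ∈ V) : LinearIndependent ℂ fun i => u i p := by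
  rw [linearIndependent_iff_card_eq_finrank_span, Set.finrank, ← h.span_eq p hp,
    (f p).finrank_plane]
  simp

theorem IsLiftOn.mem {f : S → Q3} {u : Fin 2 → S → C4} {V : Set S}
    (h : IsLiftOn f u V) {p : S} (hp : p ∈ V) (i : Fin 2) : u i p ∈ (f p).plane := by
  rw [h.span_eq p hp]; exact Submodule.subset_span ⟨i, rfl⟩

theorem IsLiftOn.exists_of_mem {f : S → Q3} {u : Fin 2 → S → C4} {V : Set S}
    (h : IsLiftOn f u V) {p : S} (hp : p ∈ V) {w : C4} (hw : w ∈ (f p).plane) :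
    ∃ a b : ℂ, w = a • u 0 p + b • u 1 p := by
  rw [h.span_eq p hp, range_fin_two_apply, Submodule.mem_span_pair] at hw
  obtain ⟨a, b, hab⟩ := hw
  exact ⟨a, b, hab.symm⟩

theorem IsLiftOn.eq_zero {f : S → Q3} {u : Fin 2 → S → C4} {V : Set S}
    (h : IsLiftOn f u V) {p : S} (hp : p ∈ V) {a b : ℂ} (hab : a • u 0 p + b • u 1 p = 0) :
    a = 0 ∧ b = 0 := by
  have := Fintype.linearIndependent_iff.1 (h.linearIndependent hp) ![a, b] (by simpa using hab)
  exact ⟨this 0, this 1⟩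

theorem span_pair_of_det_ne_zero {u v : C4} {a b c d : ℂ} (h : a * d - b * c ≠ 0) :
    Submodule.span ℂ {a • u + c • v, b • u + d • v} = Submodule.span ℂ {u, v} := by
  ext w
  simp only [Submodule.mem_span_pair]
  constructor
  · rintro ⟨x, y, rfl⟩
    exact ⟨x * a + y * b, x * c + y * d, by module⟩
  · rintro ⟨x, y, rfl⟩
    refine ⟨(x * d - y * b) / (a * d - b * c), (y * a - x * c) / (a * d - b * c), ?_⟩
    rw [smul_add, smul_add, smul_smul, smul_smul, smul_smul, smul_smul, add_add_add_comm,
      ← add_smul, ← add_smul]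
    congr 2 <;> rw [div_mul_eq_mul_div, div_mul_eq_mul_div, ← add_div, div_eq_iff h] <;> ring

theorem FrameAt.mem_plane {f : S → Q3} {A : S → Mat4} {p : S} (h : FrameAt f A p) :
    ∀ᶠ q in 𝓝 p, ∀ a, (A q).col (Sum.inl a) ∈ (f q).plane := by
  filter_upwards [h.span_eq] with q hq a
  rw [hq]
  fin_cases a <;> exact Submodule.subset_span (by simp)

theorem FrameAt.act {f : S → Q3} {A : S → Mat4} {p : S} (h : FrameAt f A p) (D : Sp2) :
    FrameAt (fun q => act D (f q)) (fun q => (D : Mat4) * A q) p where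
  hol := (MHolAt.const _ p).mul h.hol
  mem := h.mem.mono fun q hq => mul_mem D.2 hq
  span_eq := by
    filter_upwards [h.span_eq] with q hq
    change Submodule.map _ _ = _
    rw [hq, Submodule.map_span, Set.image_pair]
    rfl

theorem OrdAt.omega_left {n : ℕ} {v w : S → C4} {p : S} (hv : ∀ c, OrdAt n (fun q => v q c) p)
    (hw : VHolAt w p) : OrdAt n (fun q => omega (v q) (w q)) p :=
  (((((hv i1).mul_left (hw i3)).sub ((hv i3).mul_left (hw i1))).add
    ((hv i2).mul_left (hw i4))).sub ((hv i4).mul_left (hw i2))).of_eq fun q => by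
      simp only [omega]; ring

variable [IsManifold 𝓘(ℂ) ω S]

theorem IsLiftOn.vHolAt {f : S → Q3} {u : Fin 2 → S → C4} {V : Set S}
    (h : IsLiftOn f u V) {p : S} (hp : p ∈ V) (i : Fin 2) : VHolAt (u i) p :=
  fun c => (h.hol i c).holAt h.isOpen hp

/-- The first two columns of a frame are combinations, with holomorphic coefficients, of any
lift. -/
theorem FrameAt.exists_coeff {f : S → Q3} {A : S → Mat4} {u : Fin 2 → S → C4} {V : Set S} {p : S}
    (h : FrameAt f A p) (hu : IsLiftOn f u V) (hp : p ∈ V) :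
    ∃ g : Fin 2 → Fin 2 → S → ℂ, (∀ a i, HolAt (g a i) p) ∧
      ∀ᶠ q in 𝓝 p, ∀ a, (A q).col (Sum.inl a) = g a 0 q • u 0 q + g a 1 q • u 1 q := by
  set α : Fin 2 → Fin 2 → S → ℂ := fun i a q => omega (u i q) ((A q).col (Sum.inr a)) with hα
  have hαh : ∀ i a, HolAt (α i a) p := fun i a => (hu.vHolAt hp i).omega (h.hol.col _)
  have hexp : ∀ᶠ q in 𝓝 p, ∀ i, u i q = α i 0 q • (A q).col i1 + α i 1 q • (A q).col i2 := by
    filter_upwards [h.mem, h.mem_plane, hu.isOpen.mem_nhds hp] with q h1 h2 h3 i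
    have h4 := eq_sum_col h1 (u i q)
    rwa [(f q).isotropic _ (hu.mem h3 i) _ (h2 0), (f q).isotropic _ (hu.mem h3 i) _ (h2 1),
      neg_zero, zero_smul, zero_smul, add_zero, add_zero] at h4
  set d : S → ℂ := fun q => α 0 0 q * α 1 1 q - α 0 1 q * α 1 0 q with hd
  have hdh : HolAt d p := ((hαh 0 0).mul (hαh 1 1)).sub ((hαh 0 1).mul (hαh 1 0))
  have hsol : ∀ᶠ q in 𝓝 p, d q • (A q).col i1 = α 1 1 q • u 0 q + (-α 0 1 q) • u 1 q ∧
      d q • (A q).col i2 = (-α 1 0 q) • u 0 q + α 0 0 q • u 1 q := by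
    filter_upwards [hexp] with q hq
    rw [hq 0, hq 1]
    constructor <;> module
  have hd0 : d p ≠ 0 := by
    intro h0
    obtain ⟨h1, h2⟩ := hsol.self_of_nhds
    rw [h0, zero_smul] at h1 h2
    obtain ⟨h3, h4⟩ := hu.eq_zero hp h1.symm
    obtain ⟨h5, h6⟩ := hu.eq_zero hp h2.symm
    have h7 := hexp.self_of_nhds 0
    rw [h6, neg_eq_zero.1 h4, zero_smul, zero_smul, add_zero] at h7
    have h8 := hu.eq_zero hp (a := 1) (b := 0) (by rw [h7]; simp)
    exact one_ne_zero h8.1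
  refine ⟨![![fun q => α 1 1 q / d q, fun q => -α 0 1 q / d q],
    ![fun q => -α 1 0 q / d q, fun q => α 0 0 q / d q]], ?_, ?_⟩
  · rw [Fin.forall_fin_two, Fin.forall_fin_two, Fin.forall_fin_two]
    exact ⟨⟨(hαh 1 1).div hdh hd0, (hαh 0 1).neg.div hdh hd0⟩,
      ⟨(hαh 1 0).neg.div hdh hd0, (hαh 0 0).div hdh hd0⟩⟩
  · filter_upwards [hsol, hdh.eventually_ne hd0] with q ⟨h1, h2⟩ h3
    rw [Fin.forall_fin_two]
    have e : ∀ (x y : ℂ) (v w1 w2 : C4), d q • v = x • w1 + y • w2 →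
        v = (x / d q) • w1 + (y / d q) • w2 := by
      intro x y v w1 w2 hv
      rw [div_eq_inv_mul, div_eq_inv_mul, mul_smul, mul_smul, ← smul_add, ← hv,
        inv_smul_smul₀ h3]
    exact ⟨e _ _ _ _ _ h1, e _ _ _ _ _ h2⟩

/-- Contact of order `m` of two Lagrangian curves means that the `ω`-products of lifts vanish to
order `m + 1`. -/
theorem HasContact.ordAt {m : ℕ} {f g : S → Q3} {A B : S → Mat4} {p : S} (h : HasContact m f g p)
    (hA : FrameAt f A p) (hB : FrameAt g B p) (a b : Fin 2) :
    OrdAt (m + 1) (fun q => omega ((A q).col (Sum.inl a)) ((B q).col (Sum.inl b))) p := by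
  obtain ⟨V, u, v, hp, hu, hv, huv⟩ := h
  have h1 : ∀ i c, OrdAt (m + 1) (fun q => u i q c - v i q c) p := by
    intro i c
    have h2 := hu.vHolAt hp i c
    have h3 := hv.vHolAt hp i c
    rw [ordAt_iff_iteratedDeriv (h2.sub h3)]
    intro j hj
    have h4 := iteratedDeriv_sub (n := j) (AnalyticAt.contDiffAt h2) (AnalyticAt.contDiffAt h3)
    refine h4.trans (sub_eq_zero.2 ?_)
    exact huv j (by omega) i c
  have h2 : ∀ i j, OrdAt (m + 1) (fun q => omega (u i q) (v j q)) p := by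
    intro i j
    refine (OrdAt.omega_left (h1 i) (hv.vHolAt hp j)).congr ?_
    filter_upwards [hv.isOpen.mem_nhds hp] with q hq
    rw [show (fun c => u i q c - v i q c) = u i q - v i q from rfl, omega_sub_left,
      (g q).isotropic _ (hv.mem hq i) _ (hv.mem hq j), sub_zero]
  obtain ⟨α, hα, hα'⟩ := hA.exists_coeff hu hp
  obtain ⟨β, hβ, hβ'⟩ := hB.exists_coeff hv hp
  have h3 : ∀ i j, OrdAt (m + 1) (fun q => α a i q * (β b j q * omega (u i q) (v j q))) p :=
    fun i j => ((h2 i j).mul_left (hβ b j)).mul_left (hα a i)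
  refine ((((h3 0 0).add (h3 0 1)).add (h3 1 0)).add (h3 1 1)).congr ?_
  filter_upwards [hα', hβ'] with q h4 h5
  rw [h4, h5]
  simp only [omega_add_left, omega_add_right, omega_smul_left, omega_smul_right]
  ring

/-- The lower left block of the matrix relating two symplectic frames. -/
theorem inv_mul_apply_inr {A B : Mat4} (hA : A ∈ Matrix.symplecticGroup (Fin 2) ℂ) (a : Fin 2)
    (j : Fin 2 ⊕ Fin 2) : (A⁻¹ * B) (Sum.inr a) j = omega (A.col (Sum.inl a)) (B.col j) := by
  obtain ⟨-, -, h3, h4⟩ := inv_mulVec_apply hA (B.col j)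
  rw [omega_swap]
  fin_cases a
  exacts [h3, h4]

theorem HasContact.of_ordAt {m : ℕ} {f g : S → Q3} {A B : S → Mat4} {p : S}
    (hA : FrameAt f A p) (hB : FrameAt g B p) (hAB : A p = B p)
    (h : ∀ a b, OrdAt (m + 1) (fun q => ((A q)⁻¹ * B q) (Sum.inr a) (Sum.inl b)) p) :
    HasContact m f g p := by
  set T : S → Mat4 := fun q => (A q)⁻¹ * B q
  have hT : MHolAt T p := (hA.hol.inv hA.mem).mul hB.hol
  have hT1 : T p = 1 := by
    simp only [T]
    rw [hAB, Matrix.nonsing_inv_mul _ (isUnit_of_mem_symplectic hB.mem.self_of_nhds)]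
  have hBA : ∀ᶠ q in 𝓝 p, ∀ j, (B q).col j = T q i1 j • (A q).col i1 + T q i2 j • (A q).col i2 +
      T q i3 j • (A q).col i3 + T q i4 j • (A q).col i4 := by
    filter_upwards [hA.mem] with q hq j
    have h1 := mulVec_eq_sum_col (A q) ((T q).col j)
    have h2 : (A q).mulVec ((T q).col j) = (B q).col j := by
      change (A q * T q).col j = _
      simp only [T]
      rw [← Matrix.mul_assoc, Matrix.mul_nonsing_inv _ (isUnit_of_mem_symplectic hq),
        Matrix.one_mul]
    rw [← h2, h1]
    rfl
  let u : Fin 2 → S → C4 := fun b q =>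
    T q i1 (Sum.inl b) • (A q).col i1 + T q i2 (Sum.inl b) • (A q).col i2
  let v : Fin 2 → S → C4 := fun b q => (B q).col (Sum.inl b)
  have hu : ∀ b, VHolAt (u b) p := fun b =>
    (VHolAt.smul (hT _ _) (hA.hol.col _)).add (VHolAt.smul (hT _ _) (hA.hol.col _))
  have hv : ∀ b, VHolAt (v b) p := fun b => hB.hol.col _
  have hdet : ∀ᶠ q in 𝓝 p, T q i1 i1 * T q i2 i2 - T q i1 i2 * T q i2 i1 ≠ 0 := by
    refine HolAt.eventually_ne (((hT _ _).mul (hT _ _)).sub ((hT _ _).mul (hT _ _))) ?_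
    rw [hT1]; simp
  obtain ⟨V, hV, hVo, hpV⟩ := eventually_nhds_iff.1 (((((hdet.and hA.span_eq).and hB.span_eq).and
    (eventually_all.2 fun b => (hu b).eventually)).and
    (eventually_all.2 fun b => (hv b).eventually)))
  refine ⟨V, u, v, hpV, ⟨hVo, fun i c => (holOn_iff hVo).2 fun q hq => (hV q hq).1.2 i c, ?_⟩,
    ⟨hVo, fun i c => (holOn_iff hVo).2 fun q hq => (hV q hq).2 i c, ?_⟩, ?_⟩
  · intro q hq
    rw [(hV q hq).1.1.1.2, range_fin_two_apply, span_pair_of_det_ne_zero (hV q hq).1.1.1.1]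
  · intro q hq
    rw [(hV q hq).1.1.2, range_fin_two_apply]
  · intro j hj i c
    have h1 : OrdAt (m + 1) (fun q => v i q c - u i q c) p := by
      refine (((h 0 i).mul_left (hA.hol c i3)).add ((h 1 i).mul_left (hA.hol c i4))).congr ?_
      filter_upwards [hBA] with q hq
      have h2 := congrFun (hq (Sum.inl i)) c
      simp only [Pi.add_apply, Pi.smul_apply, smul_eq_mul] at h2
      simp only [v, u, Pi.add_apply, Pi.smul_apply, smul_eq_mul]
      rw [h2]
      simp only [T, Matrix.col, Matrix.transpose_apply]
      ring
    have h2 := (ordAt_iff_iteratedDeriv ((hv i c).sub (hu i c))).1 h1 j (by omega)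
    have h4 := iteratedDeriv_sub (n := j) (AnalyticAt.contDiffAt (hv i c))
      (AnalyticAt.contDiffAt (hu i c))
    exact (sub_eq_zero.1 (h4.symm.trans h2)).symm

end Lifts

/-! ### Contact and the invariants of normal frames -/

section Invariants

variable {S : Type*} [TopologicalSpace S] [ChartedSpace ℂ S] {f fh : S → Q3} {z : S → ℂ}
  {A Ah : S → Mat4} {k r kh rh : S → ℂ} {p : S}

/-- The matrix relating two normal frames satisfies the transition system. -/
theorem NormalAt.transitionAt (h : NormalAt f z A k r p) (hh : NormalAt fh z Ah kh rh p)
    (hz : IsCoordAt z p) [IsManifold 𝓘(ℂ) ω S] :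
    TransitionAt z k r kh rh (fun q => (Ah q)⁻¹ * A q) p where
  coord := hz
  hol := (hh.frame.hol.inv hh.frame.mem).mul h.frame.hol
  holk := h.holk
  holr := h.holr
  holkh := hh.holk
  holrh := hh.holr
  eq := by
    have hT : MHolAt (fun q => (Ah q)⁻¹ * A q) p :=
      (hh.frame.hol.inv hh.frame.mem).mul h.frame.hol
    have e : (fun q => Ah q * ((Ah q)⁻¹ * A q)) =ᶠ[𝓝 p] A := by
      filter_upwards [hh.frame.mem] with q hq
      rw [← Matrix.mul_assoc, Matrix.mul_nonsing_inv _ (isUnit_of_mem_symplectic hq),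
        Matrix.one_mul]
    filter_upwards [h.mderiv_eq, hh.mderiv_eq, hh.frame.mem, hh.frame.hol.eventually,
      hT.eventually, e.eventuallyEq_nhds] with q h1 h2 h3 h4 h5 h6
    have h7 := mderiv_congr (z := z) h6
    rw [mderiv_mul z h4 h5, h1, h2] at h7
    have hu := isUnit_of_mem_symplectic h3
    have h8 := congrArg (fun M => (Ah q)⁻¹ * M) h7
    simp only [Matrix.mul_add, ← Matrix.mul_assoc, Matrix.nonsing_inv_mul _ hu,
      Matrix.one_mul] at h8
    rw [eq_sub_iff_add_eq, add_comm]
    simpa only [Matrix.mul_assoc] using h8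

theorem NormalAt.act (h : NormalAt f z A k r p) (D : Sp2) [IsManifold 𝓘(ℂ) ω S] :
    NormalAt (fun q => act D (f q)) z (fun q => (D : Mat4) * A q) k r p where
  frame := h.frame.act D
  holθ := h.holθ
  hols := h.hols
  holk := h.holk
  holr := h.holr
  ne := h.ne
  eq := by
    filter_upwards [h.mderiv_eq, h.frame.hol.eventually, h.frame.mem] with q h1 h2 h3
    refine (mderiv_eq_iff_mc (A := fun q => (D : Mat4) * A q) (mul_mem D.2 h3)).1 ?_
    rw [mderiv_const_mul z _ h2, h1, Matrix.mul_assoc]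

theorem NormalAt.det_ne_zero (h : NormalAt f z A k r p) (hh : NormalAt fh z Ah kh rh p) :
    ((Ah p)⁻¹ * A p).det ≠ 0 := by
  have h1 := isUnit_of_mem_symplectic h.frame.mem.self_of_nhds
  have h2 := isUnit_of_mem_symplectic hh.frame.mem.self_of_nhds
  rw [Matrix.det_mul]
  exact mul_ne_zero ((Matrix.isUnit_nonsing_inv_det _ h2).ne_zero) h1.ne_zero

theorem FrameAt.ordAt_lower_left (h : FrameAt f A p) (hh : FrameAt f Ah p) (m : ℕ) :
    ∀ a b, OrdAt m (fun q => ((Ah q)⁻¹ * A q) (Sum.inr a) (Sum.inl b)) p := by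
  intro a b
  have h0 : OrdAt m (fun _ : S => (0 : ℂ)) p := by
    refine (ordAt_iff_iteratedDeriv (.const 0 p)).2 fun i _ => ?_
    have : (fun _ : S => (0 : ℂ)) ∘ (chartAt ℂ p).symm = fun _ => 0 := rfl
    rw [this]; simp
  refine h0.congr ?_
  filter_upwards [hh.mem, h.mem_plane, hh.mem_plane] with q h1 h2 h3
  rw [inv_mul_apply_inr h1, (f q).isotropic _ (h3 a) _ (h2 b)]

variable [IsManifold 𝓘(ℂ) ω S]

theorem NormalAt.lower_left (h : NormalAt f z A k r p) (hh : NormalAt fh z Ah kh rh p)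
    {m : ℕ} (hc : HasContact m fh f p) (a b : Fin 2) :
    OrdAt (m + 1) (fun q => ((Ah q)⁻¹ * A q) (Sum.inr a) (Sum.inl b)) p := by
  refine (hc.ordAt hh.frame h.frame a b).congr ?_
  filter_upwards [hh.frame.mem] with q hq
  rw [inv_mul_apply_inr hq]

/-- Contact of order four at a point, up to the action of the group, forces the invariants `k` to
agree there. -/
theorem NormalAt.k_eq (h : NormalAt f z A k r p) (hh : NormalAt fh z Ah kh rh p)
    (hz : IsCoordAt z p) {D : Sp2} (hc : HasContact 4 fh (fun q => IsotropicCurve.act D (f q)) p) :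
    k p = kh p := by
  have h' := h.act D
  have L : ∀ a b, OrdAt 5 (fun q => ((Ah q)⁻¹ * ((D : Mat4) * A q)) (Sum.inr a) (Sum.inl b)) p :=
    fun a b => NormalAt.lower_left h' hh hc a b
  have h1 := NormalAt.transitionAt h' hh hz
  have h2 := NormalAt.det_ne_zero h' hh
  exact TransitionAt.k_eq h1 h2 (L 0 0) (L 0 1) (L 1 0) (L 1 1)

theorem NormalAt.r_eq (h : NormalAt f z A k r p) (hh : NormalAt fh z Ah kh rh p)
    (hz : IsCoordAt z p) (hk : k =ᶠ[𝓝 p] kh) {D : Sp2}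
    (hc : HasContact 5 fh (fun q => IsotropicCurve.act D (f q)) p) :
    r p = rh p := by
  have h' := h.act D
  have hh' : NormalAt fh z Ah k rh p := hh.congr .rfl .rfl hk.symm .rfl
  have L : ∀ a b, OrdAt 6 (fun q => ((Ah q)⁻¹ * ((D : Mat4) * A q)) (Sum.inr a) (Sum.inl b)) p :=
    fun a b => NormalAt.lower_left h' hh' hc a b
  have h1 := NormalAt.transitionAt h' hh' hz
  have h2 := NormalAt.det_ne_zero h' hh'
  exact TransitionAt.r_eq h1 h2 (L 0 0) (L 0 1) (L 1 0) (L 1 1)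

/-- If the invariants `k` agree, the frames differ by a motion giving contact of order four. -/
theorem NormalAt.hasContact (h : NormalAt f z A k r p) (hh : NormalAt fh z Ah k rh p)
    (hz : IsCoordAt z p) {D : Sp2} (hD : (D : Mat4) * A p = Ah p) :
    HasContact 4 fh (fun q => IsotropicCurve.act D (f q)) p := by
  have h' := h.act D
  have hT : (Ah p)⁻¹ * ((D : Mat4) * A p) = 1 := by
    rw [hD, Matrix.nonsing_inv_mul _ (isUnit_of_mem_symplectic hh.frame.mem.self_of_nhds)]
  obtain ⟨t31, t32, t41, t42⟩ := (NormalAt.transitionAt h' hh hz).ordAt_five hT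
  refine HasContact.of_ordAt hh.frame h'.frame hD.symm fun a b => ?_
  fin_cases a <;> fin_cases b
  exacts [t31, t32, t41, t42]

/-- The functions `k` and `r` do not depend on the normal frame. -/
theorem NormalAt.unique (h : NormalAt f z A k r p) (hh : NormalAt f z Ah kh rh p)
    (hz : IsCoordAt z p) : k =ᶠ[𝓝 p] kh ∧ r =ᶠ[𝓝 p] rh := by
  have e1 : k =ᶠ[𝓝 p] kh := by
    filter_upwards [h.eventually, hh.eventually, hz.eventually] with q h1 h2 h3
    have L := h1.frame.ordAt_lower_left h2.frame 5
    exact (NormalAt.transitionAt h1 h2 h3).k_eq (NormalAt.det_ne_zero h1 h2)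
      (L 0 0) (L 0 1) (L 1 0) (L 1 1)
  refine ⟨e1, ?_⟩
  filter_upwards [h.eventually, hh.eventually, hz.eventually, e1.eventuallyEq_nhds]
    with q h1 h2 h3 h4
  have h2' : NormalAt f z Ah k rh q := h2.congr .rfl .rfl h4.symm .rfl
  have L := h1.frame.ordAt_lower_left h2.frame 6
  exact (NormalAt.transitionAt h1 h2' h3).r_eq (NormalAt.det_ne_zero h1 h2)
    (L 0 0) (L 0 1) (L 1 0) (L 1 1)

/-- Curves with the same invariants are locally congruent. -/
theorem NormalAt.congruent (h : NormalAt f z A k r p) (hh : NormalAt fh z Ah k r p)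
    (hz : IsCoordAt z p) :
    ∃ X : Sp2, ∀ᶠ q in 𝓝 p, fh q = IsotropicCurve.act X (f q) := by
  have hX : MHolAt (fun q => Ah q * (A q)⁻¹) p := hh.frame.hol.mul (h.frame.hol.inv h.frame.mem)
  have hmem : ∀ {M : Mat4} (hM : M ∈ Matrix.symplecticGroup (Fin 2) ℂ),
      M⁻¹ ∈ Matrix.symplecticGroup (Fin 2) ℂ := fun {M} hM => by
    have := SymplecticGroup.coe_inv' ⟨M, hM⟩
    rw [← show ((⟨M, hM⟩ : Sp2)⁻¹ : Sp2).1 = M⁻¹ from this]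
    exact ((⟨M, hM⟩ : Sp2)⁻¹).2
  have e : (fun q => (Ah q * (A q)⁻¹) * A q) =ᶠ[𝓝 p] Ah := by
    filter_upwards [h.frame.mem] with q hq
    rw [Matrix.mul_assoc, Matrix.nonsing_inv_mul _ (isUnit_of_mem_symplectic hq), Matrix.mul_one]
  have hd : ∀ᶠ q in 𝓝 p, mderiv z (fun q => Ah q * (A q)⁻¹) q = 0 := by
    filter_upwards [h.mderiv_eq, hh.mderiv_eq, h.frame.mem, h.frame.hol.eventually,
      hX.eventually, e, e.eventuallyEq_nhds] with q h1 h2 h3 h4 h5 h6 h7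
    have h8 := mderiv_congr (z := z) h7
    rw [mderiv_mul z h5 h4, h1, h2, ← Matrix.mul_assoc, h6, add_eq_right] at h8
    have hu := isUnit_of_mem_symplectic h3
    have := congrArg (fun M => M * (A q)⁻¹) h8
    simpa only [Matrix.mul_assoc, Matrix.mul_nonsing_inv _ hu, Matrix.mul_one,
      Matrix.zero_mul] using this
  have hconst : ∀ᶠ q in 𝓝 p, Ah q * (A q)⁻¹ = Ah p * (A p)⁻¹ := by
    have : ∀ᶠ q in 𝓝 p, ∀ i j, (Ah q * (A q)⁻¹) i j = (Ah p * (A p)⁻¹) i j :=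
      eventually_all.2 fun i => eventually_all.2 fun j =>
        HolAt.eventually_eq_of_cderiv_eq_zero hz (hX i j)
          (hd.mono fun q hq => congrFun (congrFun hq i) j)
    exact this.mono fun q hq => Matrix.ext hq
  refine ⟨⟨Ah p * (A p)⁻¹, mul_mem hh.frame.mem.self_of_nhds
    (hmem h.frame.mem.self_of_nhds)⟩, ?_⟩
  filter_upwards [hconst, e, hh.frame.span_eq, (h.frame.act ⟨Ah p * (A p)⁻¹,
    mul_mem hh.frame.mem.self_of_nhds (hmem h.frame.mem.self_of_nhds)⟩).span_eq] with q h1 h2 h3 h4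
  ext1
  rw [h3, h4, ← h1, h2]

end Invariants

/-! ### Existence of normal frames, the quartic differential -/

section NormalFrames

variable {S : Type*} [TopologicalSpace S] [ChartedSpace ℂ S]

theorem quarticCoeff_chain (f : S → Q3) {z w : S → ℂ} {p : S} (hz : IsCoordAt z p) :
    quarticCoeff f w p = quarticCoeff f z p * cderiv w z p ^ 4 := by
  unfold quarticCoeff
  split_ifs with h
  · rw [mc_chain h.choose hz]
    simp only [Matrix.smul_apply, smul_eq_mul]
    ring
  · simp

theorem omega_vderiv_eq_zero {z : S → ℂ} {v u : S → C4} {p : S} (hv : VHolAt v p) (hu : VHolAt u p)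
    (h : ∀ᶠ q in 𝓝 p, omega (v q) (u q) = 0) :
    omega (vderiv z v p) (u p) + omega (v p) (vderiv z u p) = 0 := by
  rw [← cderiv_omega z hv hu, cderiv_congr (h := fun _ => 0) h, cderiv_const]

/-- The structure equations of a normal frame. -/
theorem NormalAt.vderiv_col {f : S → Q3} {z : S → ℂ}
    {A : S → Mat4} {k r : S → ℂ} {p : S} (h : NormalAt f z A k r p) : ∀ᶠ q in 𝓝 p,
    vderiv z (fun q => (A q).col i1) q = (A q).col i2 ∧
    vderiv z (fun q => (A q).col i2) q = (3 / 4 * k q) • (A q).col i1 + (A q).col i4 ∧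
    vderiv z (fun q => (A q).col i4) q = k q • (A q).col i2 - (A q).col i3 := by
  filter_upwards [h.mderiv_eq] with q e
  have m : ∀ j, vderiv z (fun q => (A q).col j) q = (mderiv z A q).col j := fun j => rfl
  rw [m, m, m, e]
  refine ⟨?_, ?_, ?_⟩ <;> ext c
  · exact (mul_Phi1_apply (A q) (k q) (r q) c).1
  · refine (mul_Phi1_apply (A q) (k q) (r q) c).2.1.trans ?_
    simp [Matrix.col]; ring
  · exact (mul_Phi1_apply (A q) (k q) (r q) c).2.2.2

theorem finrank_span_pair {v w : C4} (h : LinearIndependent ℂ ![v, w]) :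
    Module.finrank ℂ (Submodule.span ℂ {v, w}) = 2 := by
  have := finrank_span_eq_card h
  rwa [Matrix.range_cons, Matrix.range_cons, Matrix.range_empty, Set.union_empty,
    Set.singleton_union, Fintype.card_fin] at this

variable [IsManifold 𝓘(ℂ) ω S]
  {f : S → Q3} {z w : S → ℂ} {A : S → Mat4} {θ s k r : S → ℂ} {V : Set S} {p : S}

theorem IsFrameOn.frameAt (h : IsFrameOn f A V) (hp : p ∈ V) : FrameAt f A p where
  hol i j := (h.hol i j).holAt h.isOpen hp
  mem := (h.isOpen.eventually_mem hp).mono h.mem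
  span_eq := (h.isOpen.eventually_mem hp).mono h.span_eq

theorem FrameAt.exists_isFrameOn (h : FrameAt f A p) {P : S → Prop} (hP : ∀ᶠ q in 𝓝 p, P q) :
    ∃ V, p ∈ V ∧ IsFrameOn f A V ∧ ∀ q ∈ V, P q := by
  obtain ⟨V, hV, hVo, hpV⟩ := eventually_nhds_iff.1 (h.eventually.and hP)
  exact ⟨V, hpV, ⟨hVo, fun i j => (holOn_iff hVo).2 fun q hq => (hV q hq).1.hol i j,
    fun q hq => (hV q hq).1.mem.self_of_nhds, fun q hq => (hV q hq).1.span_eq.self_of_nhds⟩,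
    fun q hq => (hV q hq).2⟩

theorem isCoordAt_chartAt_self (p : S) : IsCoordAt (chartAt ℂ p) p :=
  isCoordAt_chart (mem_chart_source ℂ p)

theorem IsAdaptedFrameOn.adaptedAt (h : IsAdaptedFrameOn f A V) (hp : p ∈ V)
    (hz : IsCoordAt z p) :
    AdaptedAt f z A (fun q => mc z A q i4 i2) (fun q => mc z A q i2 i2)
      (fun q => mc z A q i2 i4) (fun q => mc z A q i1 i3) p := by
  have hA := h.frame.frameAt hp
  have hmc := hA.hol.mc hz hA.mem
  have had : ∀ q ∈ V, IsCoordAt z q → IsAdaptedForm (mc z A q) := fun q hq hzq => by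
    rw [mc_chain A (isCoordAt_chartAt_self q)]
    exact (h.adapted q hq).smul (cderiv_ne_zero hzq (isCoordAt_chartAt_self q))
  refine ⟨hA, hmc _ _, hmc _ _, hmc _ _, hmc _ _, (had p hp hz).e42, ?_⟩
  filter_upwards [h.frame.isOpen.eventually_mem hp, hz.eventually] with q h1 h2
  exact eq_Phi_of_isAdaptedForm (h.frame.frameAt h1).hol (h.frame.frameAt h1).mem (had q h1 h2)

theorem AdaptedAt.exists_isAdaptedFrameOn (h : AdaptedAt f z A θ s k r p) (hz : IsCoordAt z p)
    {P : S → Prop} (hP : ∀ᶠ q in 𝓝 p, P q) :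
    ∃ V, p ∈ V ∧ IsAdaptedFrameOn f A V ∧ ∀ q ∈ V, P q := by
  obtain ⟨V, hpV, hV, hVP⟩ := h.frame.exists_isFrameOn (h.eventually.and (hz.eventually.and hP))
  refine ⟨V, hpV, ⟨hV, fun q hq => ?_⟩, fun q hq => (hVP q hq).2.2⟩
  obtain ⟨h1, h2, -⟩ := hVP q hq
  rw [mc_chain A h2, h1.eq.self_of_nhds]
  exact (isAdaptedForm_Phi h1.ne _ _ _).smul (cderiv_ne_zero (isCoordAt_chartAt_self q) h2)

/-- The quartic differential is the invariant `r` of a normal frame. -/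
theorem NormalAt.quarticCoeff_eq (h : NormalAt f z A k r p) (hz : IsCoordAt z p) :
    quarticCoeff f z p = r p := by
  obtain ⟨V, hpV, hV, -⟩ := h.exists_isAdaptedFrameOn hz (P := fun _ => True) (by simp)
  have hex : ∃ A V, p ∈ V ∧ IsAdaptedFrameOn f A V := ⟨A, V, hpV, hV⟩
  obtain ⟨W, hpW, hW⟩ := hex.choose_spec
  rw [quarticCoeff, dif_pos hex]
  obtain ⟨B, hB⟩ := (hW.adaptedAt hpW hz).exists_normal hz _ .rfl
  exact (hB.unique h hz).2.self_of_nhds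

/-- A Legendre curve `l` normalized by `ω(l', l'') = 1` is the first column of a normal frame of
`[l ∧ l']`. -/
theorem exists_normalAt_of_legendre {l : S → C4} (hl : VHolAt l p) (hz : IsCoordAt z p)
    (hspan : ∀ᶠ q in 𝓝 p, (f q).plane = Submodule.span ℂ {l q, vderiv z l q})
    (hone : ∀ᶠ q in 𝓝 p, omega (vderiv z l q) (vderiv z (vderiv z l) q) = 1) :
    ∃ A k r, NormalAt f z A k r p := by
  set l1 := vderiv z l with hl1
  set l2 := vderiv z l1 with hl2
  set l3 := vderiv z l2 with hl3
  have H1 : VHolAt l1 p := hl.vderiv hz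
  have H2 : VHolAt l2 p := H1.vderiv hz
  have H3 : VHolAt l3 p := H2.vderiv hz
  have o01 : ∀ᶠ q in 𝓝 p, omega (l q) (l1 q) = 0 := by
    filter_upwards [hspan] with q hq
    refine (f q).isotropic _ ?_ _ ?_ <;> rw [hq] <;> exact Submodule.subset_span (by simp)
  have o02 : ∀ᶠ q in 𝓝 p, omega (l q) (l2 q) = 0 := by
    filter_upwards [o01.eventually_nhds, hl.eventually, H1.eventually] with q h0 h1 h2
    have := cderiv_omega z h1 h2
    rw [cderiv_congr (h := fun _ => 0) h0, cderiv_const, ← hl1, omega_self] at this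
    simpa using this.symm
  have o03 : ∀ᶠ q in 𝓝 p, omega (l q) (l3 q) = -1 := by
    filter_upwards [o02.eventually_nhds, hl.eventually, H2.eventually, hone] with q h0 h1 h2 h3
    have := cderiv_omega z h1 h2
    rw [cderiv_congr (h := fun _ => 0) h0, cderiv_const, ← hl1, h3] at this
    linear_combination -this
  have o13 : ∀ᶠ q in 𝓝 p, omega (l1 q) (l3 q) = 0 := by
    filter_upwards [hone.eventually_nhds, H1.eventually, H2.eventually] with q h0 h1 h2
    have := cderiv_omega z h1 h2
    rw [cderiv_congr (h := fun _ => 1) h0, cderiv_const, ← hl2, omega_self] at this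
    simpa using this.symm
  -- the value of `k` for which the last two columns below are `ω`-orthogonal
  set k : S → ℂ := fun q => -(2 / 5) * omega (l2 q) (l3 q) with hk
  have Hk : HolAt k p := (HolAt.const _ p).mul (H2.omega H3)
  set a4 : S → C4 := fun q => l2 q - (3 / 4 * k q) • l q with ha4
  have H4 : VHolAt a4 p := H2.sub (VHolAt.smul ((HolAt.const _ p).mul Hk) hl)
  set a3 : S → C4 := fun q => k q • l1 q - vderiv z a4 q with ha3
  have Ha3 : VHolAt a3 p := (VHolAt.smul Hk H1).sub (H4.vderiv hz)
  have ea3 : ∀ᶠ q in 𝓝 p,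
      a3 q = (7 / 4 * k q) • l1 q + (3 / 4 * cderiv z k q) • l q - l3 q := by
    filter_upwards [hl.eventually, H2.eventually, Hk.eventually] with q h0 h2 hk
    simp only [ha3, ha4]
    rw [vderiv_sub z h2 (VHolAt.smul ((HolAt.const _ q).mul hk) h0),
      vderiv_smul z ((HolAt.const _ q).mul hk) h0, cderiv_const_mul z _ hk, ← hl3, ← hl1]
    module
  set A : S → Mat4 := fun q => Matrix.of fun c j => Sum.elim ![l q c, l1 q c] ![a3 q c, a4 q c] j
    with hA
  have c1 : ∀ q, (A q).col i1 = l q := fun q => rfl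
  have c2 : ∀ q, (A q).col i2 = l1 q := fun q => rfl
  have c3 : ∀ q, (A q).col i3 = a3 q := fun q => rfl
  have c4 : ∀ q, (A q).col i4 = a4 q := fun q => rfl
  have HA : MHolAt A p := by
    intro c j
    rcases j with j | j <;> fin_cases j
    exacts [hl c, H1 c, Ha3 c, H4 c]
  have orth : ∀ᶠ q in 𝓝 p, omega (l q) (l1 q) = 0 ∧ omega (l q) (a3 q) = 1 ∧
      omega (l q) (a4 q) = 0 ∧ omega (l1 q) (a3 q) = 0 ∧ omega (l1 q) (a4 q) = 1 ∧
      omega (a3 q) (a4 q) = 0 := by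
    filter_upwards [o01, o02, o03, hone, o13, ea3] with q e01 e02 e03 e12 e13 e
    have e10 := (omega_swap (l1 q) (l q)).trans (by rw [e01, neg_zero])
    have e30 := (omega_swap (l3 q) (l q)).trans (by rw [e03, neg_neg])
    have e32 := omega_swap (l3 q) (l2 q)
    rw [e]
    simp only [ha4, omega_add_left, omega_add_right, omega_sub_left, omega_sub_right,
      omega_smul_left, omega_smul_right, omega_self, e01, e02, e03, e12, e13, e10, e30, e32]
    refine ⟨trivial, ?_, ?_, ?_, ?_, ?_⟩
    all_goals simp only [hk]; ring
  have hmem : ∀ᶠ q in 𝓝 p, A q ∈ Matrix.symplecticGroup (Fin 2) ℂ := by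
    filter_upwards [orth] with q hq
    rw [mem_symplectic_iff_col]
    exact hq
  refine ⟨A, k, fun q => mc z A q i1 i3, ⟨⟨HA, hmem, hspan⟩, .const _ p, .const _ p, Hk,
    HA.mc hz hmem i1 i3, one_ne_zero, ?_⟩⟩
  filter_upwards [HA.eventually, hmem.eventually_nhds, orth] with q h1 h2
    ⟨h12, h13, h14, h23, h24, h34⟩
  obtain ⟨d11, d21, d31, d41⟩ := mc_apply (z := z) h2.self_of_nhds i1
  obtain ⟨d12, d22, -, d42⟩ := mc_apply (z := z) h2.self_of_nhds i2
  obtain ⟨d14, d24, -, -⟩ := mc_apply (z := z) h2.self_of_nhds i4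
  have w1 : vderiv z (fun q => (A q).col i1) q = l1 q := rfl
  have w2 : vderiv z (fun q => (A q).col i2) q = a4 q + (3 / 4 * k q) • l q :=
    (sub_add_cancel (l2 q) _).symm
  have w4 : vderiv z (fun q => (A q).col i4) q = k q • l1 q - a3 q :=
    (sub_sub_cancel _ (vderiv z a4 q)).symm
  have h21 := (omega_swap (l1 q) (l q)).trans (by rw [h12, neg_zero])
  have h43 := (omega_swap (a4 q) (a3 q)).trans (by rw [h34, neg_zero])
  have h42 := (omega_swap (a4 q) (l1 q)).trans (by rw [h24])
  rw [w1] at d11 d21 d31 d41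
  rw [w2] at d12 d22 d42
  rw [w4] at d14 d24
  simp only [c1, c2, c3, c4, omega_add_left, omega_sub_left, omega_smul_left, omega_self, h12,
    h13, h14, h23, h24, h34, h21, h43, h42] at d11 d21 d31 d41 d12 d22 d42 d14 d24
  have hform : IsAdaptedForm (mc z A q) := by
    constructor
    · rw [d31]; ring
    · rw [d41]; ring
    · rw [d21, d42]; ring
    · rw [d11, d22]; ring
    · rw [d12, d24]; ring
    · rw [d14]; ring
    · rw [d42]; norm_num
  rw [eq_Phi_of_isAdaptedForm h1 h2 hform, d42, d22, d24]
  simp [Phi]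

/-- A curve has normal frames near the points that are critical neither for the curve nor for
its Legendre associate: rescale a lift of the Legendre associate. -/
theorem IsRegularAt.exists_normalAt (h : IsRegularAt f p) (hz : IsCoordAt z p) :
    ∃ A k r, NormalAt f z A k r p := by
  obtain ⟨⟨V₁, u, hp1, hu, hm⟩, V₂, v, hp2, hv, hli⟩ := h
  have Hv : VHolAt v p := fun c => (hv.hol c).holAt hv.isOpen hp2
  set v1 := vderiv z v with hv1
  set v2 := vderiv z v1 with hv2
  have H1 : VHolAt v1 p := Hv.vderiv hz
  have H2 : VHolAt v2 p := H1.vderiv hz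
  have mem1 : ∀ᶠ q in 𝓝 p, v1 q ∈ (f q).plane := by
    filter_upwards [hv.isOpen.eventually_mem hp2] with q hq
    refine (f q).mem_of_omega fun w hw => ?_
    rw [hv1, vderiv_chain v (isCoordAt_chartAt_self q), omega_smul_right, hv.ker q hq w hw,
      mul_zero]
  have mem0 : ∀ᶠ q in 𝓝 p, v q ∈ (f q).plane := (hv.isOpen.eventually_mem hp2).mono hv.mem
  have o01 : ∀ᶠ q in 𝓝 p, omega (v q) (v1 q) = 0 := by
    filter_upwards [mem0, mem1] with q h0 h1 using (f q).isotropic _ h0 _ h1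
  have o02 : ∀ᶠ q in 𝓝 p, omega (v q) (v2 q) = 0 := by
    filter_upwards [o01.eventually_nhds, Hv.eventually, H1.eventually] with q h0 h1 h2
    simpa [← hv1, omega_self] using omega_vderiv_eq_zero (z := z) h1 h2 h0
  have hspan_p : (f p).plane = Submodule.span ℂ {v p, v1 p} := by
    have hli' : LinearIndependent ℂ ![v p, v1 p] := by
      have hc := cderiv_ne_zero hz (isCoordAt_chartAt_self p)
      rw [hv1, vderiv_chain v (isCoordAt_chartAt_self p)]
      rw [LinearIndependent.pair_iff] at hli ⊢
      intro a b hab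
      rw [smul_smul] at hab
      obtain ⟨h1, h2⟩ := hli _ _ hab
      exact ⟨h1, (mul_eq_zero.1 h2).resolve_right hc⟩
    refine (Submodule.eq_of_le_of_finrank_eq ?_ ?_).symm
    · rw [Submodule.span_le]
      rintro w (rfl | rfl)
      exacts [mem0.self_of_nhds, mem1.self_of_nhds]
    · rw [(f p).finrank_plane]
      exact finrank_span_pair hli'
  -- if this vanished, so would the differential of the curve
  have hm0 : omega (v1 p) (v2 p) ≠ 0 := by
    intro h0
    refine hm ?_
    have hU := hu.vHolAt hp1
    have key : ∀ w ∈ (f p).plane, ∀ j, omega w (vderiv z (u j) p) = 0 := by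
      have huj : ∀ᶠ q in 𝓝 p, ∀ j, u j q ∈ (f q).plane :=
        (hu.isOpen.eventually_mem hp1).mono fun q hq j => hu.mem hq j
      have e0 : ∀ j, omega (v p) (vderiv z (u j) p) = 0 := fun j => by
        have := omega_vderiv_eq_zero (z := z) Hv (hU j)
          (by filter_upwards [mem0, huj] with q h1 h2 using (f q).isotropic _ h1 _ (h2 j))
        rwa [← hv1, (f p).isotropic _ mem1.self_of_nhds _ (huj.self_of_nhds j), zero_add] at this
      have e1 : ∀ j, omega (v1 p) (vderiv z (u j) p) = 0 := fun j => by
        have h3 := omega_vderiv_eq_zero (z := z) H1 (hU j)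
          (by filter_upwards [mem1, huj] with q h1 h2 using (f q).isotropic _ h1 _ (h2 j))
        have h4 := huj.self_of_nhds j
        rw [hspan_p, Submodule.mem_span_pair] at h4
        obtain ⟨a, b, hab⟩ := h4
        rwa [← hv2, ← hab, omega_swap, omega_add_left, omega_smul_left, omega_smul_left,
          o02.self_of_nhds, h0, mul_zero, mul_zero, add_zero, neg_zero, zero_add] at h3
      intro w hw j
      rw [hspan_p, Submodule.mem_span_pair] at hw
      obtain ⟨a, b, rfl⟩ := hw
      rw [omega_add_left, omega_smul_left, omega_smul_left, e0, e1, mul_zero, mul_zero, add_zero]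
    ext i j
    have := key _ (hu.mem hp1 i) j
    rw [vderiv_chain _ (isCoordAt_chartAt_self p), omega_smul_right] at this
    exact (mul_eq_zero.1 this).resolve_left (cderiv_ne_zero hz (isCoordAt_chartAt_self p))
  -- `ω(l', l'') = g² ω(v', v'')` for `l = g v`
  obtain ⟨g, hg, hg0, hgm⟩ := ((H1.omega H2).inv hm0).exists_root (inv_ne_zero hm0) two_ne_zero
  have Hl : VHolAt (fun q => g q • v q) p := VHolAt.smul hg Hv
  have dl : vderiv z (fun q => g q • v q) =ᶠ[𝓝 p] fun q => cderiv z g q • v q + g q • v1 q := by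
    filter_upwards [hg.eventually, Hv.eventually] with q h1 h2 using vderiv_smul z h1 h2
  suffices h : (∀ᶠ q in 𝓝 p, (f q).plane =
      Submodule.span ℂ {g q • v q, vderiv z (fun q => g q • v q) q}) ∧
      ∀ᶠ q in 𝓝 p, omega (vderiv z (fun q => g q • v q) q)
        (vderiv z (vderiv z (fun q => g q • v q)) q) = 1 by
    exact exists_normalAt_of_legendre Hl hz h.1 h.2
  constructor
  · filter_upwards [dl, hg.eventually_ne hg0, mem0, mem1, (H1.omega H2).eventually_ne hm0, o02,
      (hv.isOpen.eventually_mem hp2)] with q h1 h2 h3 h4 h5 h6 h7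
    rw [h1, span_pair_triangular h2 h2]
    refine (Submodule.eq_of_le_of_finrank_eq ?_ ?_).symm
    · rw [Submodule.span_le]
      rintro w (rfl | rfl)
      exacts [h3, h4]
    · have hli' : LinearIndependent ℂ ![v q, v1 q] := by
        rw [LinearIndependent.pair_iff]
        intro a b hab
        have h8 := congrArg (fun w => omega w (v2 q)) hab
        simp only [omega_add_left, omega_smul_left, h6, mul_zero, zero_add] at h8
        have hb : b = 0 := (mul_eq_zero.1 (h8.trans (by simp [omega]))).resolve_right h5
        rw [hb, zero_smul, add_zero] at hab
        exact ⟨(smul_eq_zero.1 hab).resolve_right (hv.ne_zero q h7), hb⟩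
      rw [(f q).finrank_plane]
      exact finrank_span_pair hli'
  · filter_upwards [dl.eventuallyEq_nhds, hg.eventually, Hv.eventually, H1.eventually, o01, o02,
      (hg.cderiv hz).eventually, hgm, (H1.omega H2).eventually_ne hm0]
      with q h1 h2 h3 h4 h5 h6 h7 h8 h9
    rw [vderiv_congr h1, h1.self_of_nhds, vderiv_add z (VHolAt.smul h7 h3) (VHolAt.smul h2 h4),
      vderiv_smul z h7 h3, vderiv_smul z h2 h4, ← hv1, ← hv2]
    have h10 := (omega_swap (v1 q) (v q)).trans (by rw [h5, neg_zero])
    simp only [omega_add_left, omega_add_right, omega_smul_left, omega_smul_right, omega_self,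
      h5, h6, h10]
    rw [← inv_mul_cancel₀ h9, ← h8]
    ring

/-- The converse: a curve that has a normal frame is regular. -/
theorem NormalAt.isRegularAt (h : NormalAt f z A k r p) (hz : IsCoordAt z p) :
    IsRegularAt f p := by
  obtain ⟨V, hpV, hV, hVP⟩ := h.frame.exists_isFrameOn (h.eventually.and hz.eventually)
  have hzc : ∀ q ∈ V, cderiv (chartAt ℂ q) z q ≠ 0 := fun q hq =>
    cderiv_ne_zero (isCoordAt_chartAt_self q) (hVP q hq).2
  have hd : ∀ q ∈ V, vderiv (chartAt ℂ q) (fun q => (A q).col i1) q =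
      cderiv (chartAt ℂ q) z q • (A q).col i2 ∧
      vderiv (chartAt ℂ q) (fun q => (A q).col i2) q =
      cderiv (chartAt ℂ q) z q • ((3 / 4 * k q) • (A q).col i1 + (A q).col i4) := by
    intro q hq
    obtain ⟨e1, e2, -⟩ := (NormalAt.vderiv_col (hVP q hq).1).self_of_nhds
    rw [vderiv_chain (fun q => (A q).col i1) (hVP q hq).2,
      vderiv_chain (fun q => (A q).col i2) (hVP q hq).2, e1, e2]
    exact ⟨rfl, rfl⟩
  have hcol : ∀ q ∈ V, _ := fun q hq => (mem_symplectic_iff_col (A q)).1 (hV.mem q hq)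
  refine ⟨⟨V, fun i q => (A q).col (Sum.inl i), hpV, ⟨hV.isOpen, fun i c => hV.hol c _, ?_⟩, ?_⟩,
    V, fun q => (A q).col i1, hpV, ⟨hV.isOpen, fun c => hV.hol c _, ?_, ?_, ?_⟩, ?_⟩
  · intro q hq
    rw [hV.span_eq q hq, range_fin_two_apply fun i q => (A q).col (Sum.inl i)]
  · intro h0
    have h1 := congrFun (congrFun h0 1) 1
    have h2 : omega ((A p).col i2) (vderiv (chartAt ℂ p) (fun q => (A q).col i2) p) = 0 := h1
    obtain ⟨h12, -, -, -, h24, -⟩ := hcol p hpV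
    rw [(hd p hpV).2, omega_smul_right, omega_add_right, omega_smul_right, h24, omega_swap, h12]
      at h2
    simp at h2
    exact hzc p hpV h2
  · intro q hq h0
    obtain ⟨-, h13, -⟩ := hcol q hq
    rw [h0] at h13
    simp [omega] at h13
  · intro q hq
    rw [hV.span_eq q hq]
    exact Submodule.subset_span (by simp)
  · intro q hq w hw
    rw [(hd q hq).1, omega_smul_right, (f q).isotropic w hw, mul_zero]
    rw [hV.span_eq q hq]
    exact Submodule.subset_span (by simp)
  · change LinearIndependent ℂ ![(A p).col i1, vderiv (chartAt ℂ p) (fun q => (A q).col i1) p]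
    rw [(hd p hpV).1, LinearIndependent.pair_iff]
    intro a b hab
    obtain ⟨h12, h13, h14, h23, h24, h34⟩ := hcol p hpV
    have h3 := congrArg (fun w => omega w ((A p).col i3)) hab
    have h4 := congrArg (fun w => omega w ((A p).col i4)) hab
    simp only [omega_add_left, omega_smul_left, h13, h14, h23, h24] at h3 h4
    have e0 : ∀ v, omega 0 v = 0 := fun v => by simp [omega]
    rw [e0] at h3 h4
    simp at h3 h4
    exact ⟨h3, h4.resolve_right (hzc p hpV)⟩
end NormalFrames

/-! ### The identity theorem for holomorphic curves -/

section Identity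

/-- A property that spreads, near each point of a connected set, from open subsets to a
neighbourhood, holds everywhere once it holds on a nonempty open subset. -/
theorem forall_of_isPreconnected {S : Type*} [TopologicalSpace S] {U : Set S} {P : S → Prop}
    (hU : IsPreconnected U)
    (hP : ∀ p ∈ U, (∃ᶠ q in 𝓝 p, ∀ᶠ x in 𝓝 q, P x) → ∀ᶠ x in 𝓝 p, P x)
    (h0 : ∃ p ∈ U, ∀ᶠ x in 𝓝 p, P x) : ∀ p ∈ U, P p := by
  obtain ⟨p, hp, hpP⟩ := h0
  have h := hU.subset_of_closure_inter_subset (u := {p | ∀ᶠ x in 𝓝 p, P x})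
    isOpen_setOfPred_eventually_nhds ⟨p, hp, hpP⟩ fun q hq =>
      hP q hq.2 (mem_closure_iff_frequently.1 hq.1)
  exact fun q hq => (h hq).self_of_nhds

variable {S : Type*} [TopologicalSpace S] [ChartedSpace ℂ S] {f g : S → Q3}
  {u v : Fin 2 → S → C4} {U V V' W : Set S} {p : S}

theorem HolAt.eventually_eq_zero_of_frequently {g : S → ℂ} (hg : HolAt g p)
    (h : ∃ᶠ q in 𝓝 p, ∀ᶠ x in 𝓝 q, g x = 0) : ∀ᶠ x in 𝓝 p, g x = 0 := by
  rcases hg.eventually_eq_zero_or with h1 | h1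
  · exact h1
  · obtain ⟨q, hq, hq'⟩ := (h.and_eventually (eventually_nhdsWithin_iff.1 h1)).exists
    by_cases hqp : q = p
    · exact hqp ▸ hq
    · exact absurd hq.self_of_nhds (hq' hqp)

theorem IsLiftOn.mem_plane_iff (h : IsLiftOn f u V) (hp : p ∈ V) (w : C4) :
    w ∈ (f p).plane ↔ ∀ i, omega (u i p) w = 0 := by
  refine ⟨fun hw i => (f p).isotropic _ (h.mem hp i) _ hw, fun hw => (f p).mem_of_omega ?_⟩
  intro x hx
  obtain ⟨a, b, rfl⟩ := h.exists_of_mem hp hx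
  rw [omega_add_left, omega_smul_left, omega_smul_left, hw, hw, mul_zero, mul_zero, add_zero]

theorem IsLiftOn.eq_iff (h : IsLiftOn f u V) (hg : IsLiftOn g v V') (hp : p ∈ V) (hp' : p ∈ V') :
    f p = g p ↔ ∀ i j, omega (u i p) (v j p) = 0 := by
  constructor
  · intro e i j
    exact (f p).isotropic _ (h.mem hp i) _ (e ▸ hg.mem hp' j)
  · intro e
    refine Q3.eq_of_omega fun x hx y hy => ?_
    obtain ⟨a, b, rfl⟩ := hg.exists_of_mem hp' hy
    have e' : ∀ j, v j p ∈ (f p).plane := fun j => (h.mem_plane_iff hp _).2 fun i => e i j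
    rw [omega_add_right, omega_smul_right, omega_smul_right, (f p).isotropic x hx _ (e' 0),
      (f p).isotropic x hx _ (e' 1), mul_zero, mul_zero, add_zero]

theorem HolCurveOn.const (P : Q3) (hU : IsOpen U) : HolCurveOn (fun _ => P) U := by
  intro p hp
  let b := Module.finBasisOfFinrankEq ℂ P.plane P.finrank_plane
  refine ⟨U, fun i _ => (b i : C4), hp, subset_rfl, hU,
    fun i c q _ => mdifferentiableWithinAt_const, fun q _ => ?_⟩
  have h := congrArg (Submodule.map P.plane.subtype) b.span_eq
  rw [Submodule.map_span, ← Set.range_comp, Submodule.map_top, Submodule.range_subtype] at h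
  exact h.symm

variable [IsManifold 𝓘(ℂ) ω S]

theorem HolCurveOn.act (h : HolCurveOn f U) (X : Sp2) :
    HolCurveOn (fun q => IsotropicCurve.act X (f q)) U := by
  intro p hp
  obtain ⟨V, u, hpV, hVU, hu⟩ := h p hp
  refine ⟨V, fun i q => (X : Mat4).mulVec (u i q), hpV, hVU, hu.isOpen,
    fun i c => (holOn_iff hu.isOpen).2 fun q hq => ?_, fun q hq => ?_⟩
  · change HolAt (fun q => ∑ j, (X : Mat4) c j * u i q j) q
    exact HolAt.sum fun j _ => (HolAt.const _ q).mul (hu.vHolAt hq i j)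
  · change Submodule.map _ _ = _
    rw [hu.span_eq q hq, Submodule.map_span, ← Set.range_comp]
    rfl

/-- The identity theorem for holomorphic curves in `ℚ₃`. -/
theorem HolCurveOn.eq_of_eventually_eq (hf : HolCurveOn f U) (hg : HolCurveOn g U)
    (hU : IsPreconnected U) (h : ∃ p ∈ U, ∀ᶠ x in 𝓝 p, f x = g x) : ∀ p ∈ U, f p = g p := by
  refine forall_of_isPreconnected hU (fun p hp hfr => ?_) h
  obtain ⟨V, u, hpV, -, hu⟩ := hf p hp
  obtain ⟨V', v, hpV', -, hv⟩ := hg p hp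
  have hVV : ∀ᶠ x in 𝓝 p, x ∈ V ∩ V' :=
    (hu.isOpen.inter hv.isOpen).mem_nhds ⟨hpV, hpV'⟩
  have key : ∀ i j, ∀ᶠ x in 𝓝 p, omega (u i x) (v j x) = 0 := fun i j => by
    refine HolAt.eventually_eq_zero_of_frequently ((hu.vHolAt hpV i).omega (hv.vHolAt hpV' j)) ?_
    refine (hfr.and_eventually hVV.eventually_nhds).mono fun q hq => ?_
    filter_upwards [hq.1, hq.2] with x h1 h2 using (hu.eq_iff hv h2.1 h2.2).1 h1 i j
  filter_upwards [hVV, eventually_all.2 fun i => eventually_all.2 fun j => key i j] with x h1 h2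
    using (hu.eq_iff hv h1.1 h1.2).2 h2

theorem HolCurveOn.mem_of_eventually_mem (hf : HolCurveOn f U) (hU : IsPreconnected U) {ξ : C4}
    (h : ∃ p ∈ U, ∀ᶠ x in 𝓝 p, ξ ∈ (f x).plane) : ∀ p ∈ U, ξ ∈ (f p).plane := by
  refine forall_of_isPreconnected hU (fun p hp hfr => ?_) h
  obtain ⟨V, u, hpV, -, hu⟩ := hf p hp
  have hV : ∀ᶠ x in 𝓝 p, x ∈ V := hu.isOpen.mem_nhds hpV
  have key : ∀ i, ∀ᶠ x in 𝓝 p, omega (u i x) ξ = 0 := fun i => by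
    refine HolAt.eventually_eq_zero_of_frequently ((hu.vHolAt hpV i).omega (.const ξ p)) ?_
    refine (hfr.and_eventually hV.eventually_nhds).mono fun q hq => ?_
    filter_upwards [hq.1, hq.2] with x h1 h2 using (hu.mem_plane_iff h2 ξ).1 h1 i
  filter_upwards [hV, eventually_all.2 key] with x h1 h2 using (hu.mem_plane_iff h1 ξ).2 h2

end Identity

/-! ### Density of the regular points -/

section Density

variable {S : Type*} [TopologicalSpace S] [ChartedSpace ℂ S] {f : S → Q3}
  {u : Fin 2 → S → C4} {U V W : Set S} {p : S}

theorem exists_minor_ne_zero {x y : C4}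
    (h : ∀ a b : ℂ, a • x + b • y = 0 → a = 0 ∧ b = 0) :
    ∃ a b, x a * y b - x b * y a ≠ 0 := by
  by_contra! hm
  have h2 : ∀ a, x a = 0 := fun a => by
    have h1 := h (-y a) (x a) (by
      ext b; simp only [Pi.add_apply, Pi.smul_apply, smul_eq_mul, Pi.zero_apply]
      linear_combination hm a b)
    exact h1.2
  have := h 1 0 (by ext b; simp [h2])
  exact one_ne_zero this.1

variable [IsManifold 𝓘(ℂ) ω S]

/-- A curve whose differential vanishes near `p` is constant near `p`: the lift that is the
identity on two coordinates is constant. -/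
theorem IsLiftOn.eventually_eq_of_mdot_eq_zero (h : IsLiftOn f u V) (hp : p ∈ V)
    (h0 : ∀ᶠ q in 𝓝 p, mdot u q = 0) : ∀ᶠ q in 𝓝 p, f q = f p := by
  obtain ⟨a, b, hab⟩ := exists_minor_ne_zero fun a b => h.eq_zero hp (a := a) (b := b)
  have hu := h.vHolAt hp
  set d : S → ℂ := fun q => u 0 q a * u 1 q b - u 0 q b * u 1 q a with hd
  have Hd : HolAt d p := ((hu 0 a).mul (hu 1 b)).sub ((hu 0 b).mul (hu 1 a))
  -- the two vectors of the graph lift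
  set x : S → C4 := fun q => (u 1 q b / d q) • u 0 q - (u 0 q b / d q) • u 1 q with hx
  set y : S → C4 := fun q => (u 0 q a / d q) • u 1 q - (u 1 q a / d q) • u 0 q with hy
  have Hx : VHolAt x p := (VHolAt.smul ((hu 1 b).div Hd hab) (hu 0)).sub
    (VHolAt.smul ((hu 0 b).div Hd hab) (hu 1))
  have Hy : VHolAt y p := (VHolAt.smul ((hu 0 a).div Hd hab) (hu 1)).sub
    (VHolAt.smul ((hu 1 a).div Hd hab) (hu 0))
  have hc := isCoordAt_chartAt_self p
  have hV : ∀ᶠ q in 𝓝 p, q ∈ V := h.isOpen.mem_nhds hp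
  have hne := Hd.eventually_ne hab
  have norm : ∀ᶠ q in 𝓝 p, (x q a = 1 ∧ x q b = 0) ∧ y q a = 0 ∧ y q b = 1 := by
    filter_upwards [hne] with q hq
    simp only [hx, hy, Pi.sub_apply, Pi.smul_apply, smul_eq_mul]
    refine ⟨⟨?_, ?_⟩, ?_, ?_⟩ <;> field_simp <;> simp only [hd] <;> ring
  have back : ∀ᶠ q in 𝓝 p, u 0 q = u 0 q a • x q + u 0 q b • y q ∧
      u 1 q = u 1 q a • x q + u 1 q b • y q := by
    filter_upwards [hne] with q hq
    constructor <;> ext c <;>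
      simp only [hx, hy, Pi.sub_apply, Pi.smul_apply, Pi.add_apply, smul_eq_mul] <;>
      field_simp <;> simp only [hd] <;> ring
  have mem : ∀ᶠ q in 𝓝 p, x q ∈ (f q).plane ∧ y q ∈ (f q).plane := by
    filter_upwards [hV] with q hq
    exact ⟨sub_mem (Submodule.smul_mem _ _ (h.mem hq 0)) (Submodule.smul_mem _ _ (h.mem hq 1)),
      sub_mem (Submodule.smul_mem _ _ (h.mem hq 1)) (Submodule.smul_mem _ _ (h.mem hq 0))⟩
  have zero : ∀ᶠ q in 𝓝 p, ∀ j, ∀ w ∈ (f q).plane,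
      omega w (vderiv (chartAt ℂ p) (u j) q) = 0 := by
    filter_upwards [hV, h0] with q hq hq0 j w hw
    obtain ⟨s, t, rfl⟩ := h.exists_of_mem hq hw
    have h1 : ∀ i, omega (u i q) (vderiv (chartAt ℂ q) (u j) q) = 0 := fun i =>
      congrFun (congrFun hq0 i) j
    rw [vderiv_chain _ (isCoordAt_chartAt_self q), omega_smul_right, omega_add_left,
      omega_smul_left, omega_smul_left, h1, h1]
    simp
  have const : ∀ v : S → C4, VHolAt v p → (∃ s t : S → ℂ, HolAt s p ∧ HolAt t p ∧
      ∀ᶠ q in 𝓝 p, v q = s q • u 0 q + t q • u 1 q) →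
      (∃ s t, ∀ᶠ q in 𝓝 p, v q a = s ∧ v q b = t) → ∀ᶠ q in 𝓝 p, v q = v p := by
    rintro v hv ⟨s, t, hs, ht, e⟩ ⟨s', t', e'⟩
    have d0 : ∀ᶠ q in 𝓝 p, vderiv (chartAt ℂ p) v q = 0 := by
      filter_upwards [e.eventually_nhds, e'.eventually_nhds, zero, hs.eventually, ht.eventually,
        (hu 0).eventually, (hu 1).eventually, hV, back, norm] with q q1 q2 q3 q4 q5 q6 q7 q8 q9 q10
      have m : vderiv (chartAt ℂ p) v q ∈ (f q).plane := by
        refine (f q).mem_of_omega fun w hw => ?_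
        rw [vderiv_congr q1, vderiv_add _ (VHolAt.smul q4 q6) (VHolAt.smul q5 q7),
          vderiv_smul _ q4 q6, vderiv_smul _ q5 q7]
        simp only [omega_add_right, omega_smul_right, q3 _ w hw, (f q).isotropic w hw _
          (h.mem q8 0), (f q).isotropic w hw _ (h.mem q8 1)]
        ring
      have va : vderiv (chartAt ℂ p) v q a = 0 :=
        (cderiv_congr (h := fun _ => s') (q2.mono fun _ hh => hh.1)).trans (cderiv_const _ _ _)
      have vb : vderiv (chartAt ℂ p) v q b = 0 :=
        (cderiv_congr (h := fun _ => t') (q2.mono fun _ hh => hh.2)).trans (cderiv_const _ _ _)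
      obtain ⟨α, β, hαβ⟩ := h.exists_of_mem q8 m
      rw [q9.1, q9.2] at hαβ
      have ea := congrFun hαβ a
      have eb := congrFun hαβ b
      simp only [Pi.add_apply, Pi.smul_apply, smul_eq_mul, q10.1.1, q10.1.2, q10.2.1, q10.2.2, va,
        vb, mul_zero, mul_one, add_zero, zero_add] at ea eb
      have : vderiv (chartAt ℂ p) v q =
          (α * u 0 q a + β * u 1 q a) • x q + (α * u 0 q b + β * u 1 q b) • y q := by
        rw [hαβ]; module
      rw [this, ← ea, ← eb]; simp
    have : ∀ᶠ q in 𝓝 p, ∀ c, v q c = v p c := eventually_all.2 fun c =>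
      HolAt.eventually_eq_of_cderiv_eq_zero hc (hv c) (d0.mono fun q hq => congrFun hq c)
    exact this.mono fun q hq => funext hq
  have cx := const x Hx ⟨_, fun q => -(u 0 q b / d q), (hu 1 b).div Hd hab,
    ((hu 0 b).div Hd hab).neg, .of_forall fun q => by rw [neg_smul, ← sub_eq_add_neg]⟩
    ⟨1, 0, norm.mono fun q hq => hq.1⟩
  have cy := const y Hy ⟨fun q => -(u 1 q a / d q), _, ((hu 1 a).div Hd hab).neg,
    (hu 0 a).div Hd hab, .of_forall fun q => by rw [neg_smul, neg_add_eq_sub]⟩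
    ⟨0, 1, norm.mono fun q hq => hq.2⟩
  filter_upwards [cx, cy, back, hV] with q h1 h2 h3 h4
  have hi : ∀ i, u i q ∈ (f p).plane := fun i => by
    have : u i q = u i q a • x p + u i q b • y p := by
      rw [← h1, ← h2]; fin_cases i; exacts [h3.1, h3.2]
    rw [this]
    exact add_mem (Submodule.smul_mem _ _ mem.self_of_nhds.1)
      (Submodule.smul_mem _ _ mem.self_of_nhds.2)
  refine Q3.eq_of_omega fun v hv w hw => ?_
  obtain ⟨s, t, rfl⟩ := h.exists_of_mem h4 hv
  exact (f p).isotropic _ (add_mem (Submodule.smul_mem _ _ (hi 0)) (Submodule.smul_mem _ _ (hi 1)))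
    _ hw

/-- The points that are critical neither for an isotropic curve nor for its Legendre associate
are dense. -/
theorem IsIsotropicOn.exists_isRegularAt (hf : IsIsotropicOn f U) (hW : IsOpen W) (hWU : W ⊆ U)
    (hne : W.Nonempty) : ∃ q ∈ W, IsRegularAt f q := by
  obtain ⟨p, hp⟩ := hne
  obtain ⟨V, u, hpV, hVU, hu⟩ := hf.hol p (hWU hp)
  have hWV := hW.inter hu.isOpen
  -- a point where the differential of the curve does not vanish
  obtain ⟨q, hq, hmq⟩ : ∃ q ∈ W ∩ V, mdot u q ≠ 0 := by
    by_contra! h0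
    refine hf.nonconst ⟨f p, hf.hol.eq_of_eventually_eq (.const _ hf.isOpen)
      hf.isConnected.isPreconnected ⟨p, hWU hp, ?_⟩⟩
    refine hu.eventually_eq_of_mdot_eq_zero hpV ?_
    filter_upwards [hWV.mem_nhds ⟨hp, hpV⟩] with q hq using h0 q hq
  obtain ⟨i, j, hij⟩ : ∃ i j, mdot u q i j ≠ 0 := by
    by_contra! h0
    exact hmq (by ext i j; exact h0 i j)
  have hU := hu.vHolAt hq.2
  have hz := isCoordAt_chartAt_self q
  set z := chartAt ℂ q with hz'
  set M : Fin 2 → Fin 2 → S → ℂ := fun i j x => omega (u i x) (vderiv z (u j) x) with hM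
  have HM : ∀ i j, HolAt (M i j) q := fun i j => (hU i).omega ((hU j).vderiv hz)
  have hVq : ∀ᶠ x in 𝓝 q, x ∈ W ∩ V := hWV.mem_nhds hq
  have sym : ∀ᶠ x in 𝓝 q, M 0 1 x = M 1 0 x := by
    filter_upwards [hVq.eventually_nhds, (hU 0).eventually, (hU 1).eventually] with x h1 h2 h3
    have := omega_vderiv_eq_zero (z := z) h2 h3
      (h1.mono fun y hy => (f y).isotropic _ (hu.mem hy.2 0) _ (hu.mem hy.2 1))
    rw [omega_swap] at this
    simp only [hM]
    linear_combination this
  have det : ∀ᶠ x in 𝓝 q, M 0 0 x * M 1 1 x - M 0 1 x * M 1 0 x = 0 := by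
    filter_upwards [hVq] with x h1
    have h2 := hf.isotropic V u hVU hu x h1.2
    rw [Matrix.det_fin_two] at h2
    have h3 : ∀ i j, M i j x = cderiv z (chartAt ℂ x) x * mdot u x i j := fun i j => by
      simp only [hM, mdot, Matrix.of_apply]
      rw [vderiv_chain _ (isCoordAt_chartAt_self x), omega_smul_right]
    rw [h3, h3, h3, h3]
    linear_combination (cderiv z (chartAt ℂ x) x) ^ 2 * h2
  -- the Legendre associate, computed from a row of the matrix `M`
  set v : S → C4 := fun x => M i 1 x • u 0 x - M i 0 x • u 1 x with hv
  have Hv : VHolAt v q := (VHolAt.smul (HM i 1) (hU 0)).sub (VHolAt.smul (HM i 0) (hU 1))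
  have hv0 : ∃ a, v q a ≠ 0 := by
    by_contra! h0
    have h1 : M i 1 q • u 0 q + (-M i 0 q) • u 1 q = 0 := by
      ext a
      have := h0 a
      simp only [hv, Pi.sub_apply, Pi.smul_apply, smul_eq_mul] at this
      simp only [Pi.add_apply, Pi.smul_apply, smul_eq_mul, Pi.zero_apply]
      linear_combination this
    obtain ⟨h2, h3⟩ := hu.eq_zero hq.2 h1
    rw [neg_eq_zero] at h3
    refine hij ?_
    fin_cases j
    exacts [h3, h2]
  obtain ⟨a, ha⟩ := hv0
  have hva := (Hv a).eventually_ne ha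
  have memv : ∀ᶠ x in 𝓝 q, v x ∈ (f x).plane := hVq.mono fun x hx =>
    sub_mem (Submodule.smul_mem _ _ (hu.mem hx.2 0)) (Submodule.smul_mem _ _ (hu.mem hx.2 1))
  have ker : ∀ᶠ x in 𝓝 q, ∀ w ∈ (f x).plane, omega w (vderiv z v x) = 0 := by
    filter_upwards [hVq, sym, det, memv.eventually_nhds, Hv.eventually, (hU 0).eventually,
      (hU 1).eventually, hVq.eventually_nhds] with x h1 h2 h3 h4 h5 h6 h7 h8
    have e1 : ∀ k, omega (v x) (vderiv z (u k) x) = 0 := fun k => by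
      simp only [hv, omega_sub_left, omega_smul_left]
      change M i 1 x * M 0 k x - M i 0 x * M 1 k x = 0
      fin_cases i <;> fin_cases k <;> simp only [Fin.zero_eta, Fin.mk_one]
      · linear_combination M 0 0 x * h2
      · linear_combination M 0 1 x * h2 - h3
      · linear_combination h3 + M 1 0 x * h2
      · linear_combination M 1 1 x * h2
    have e2 : ∀ k, omega (u k x) (vderiv z v x) = 0 := fun k => by
      have h9 : VHolAt (u k) x := hu.vHolAt h1.2 k
      have := omega_vderiv_eq_zero (z := z) h9 h5 (by
        filter_upwards [h4, h8] with y k1 k2 using (f y).isotropic _ (hu.mem k2.2 k) _ k1)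
      rwa [omega_swap, e1, neg_zero, zero_add] at this
    intro w hw
    obtain ⟨s, t, rfl⟩ := hu.exists_of_mem h1.2 hw
    rw [omega_add_left, omega_smul_left, omega_smul_left, e2, e2, mul_zero, mul_zero, add_zero]
  obtain ⟨V₂, hV₂, hV₂o, hqV₂⟩ := eventually_nhds_iff.1 ((((hva.and memv).and ker).and
    Hv.eventually).and (hVq.and (hz.eventually.and (((HM i j).eventually_ne hij)))))
  have hleg : IsLegendreLiftOn f v V₂ := by
    refine ⟨hV₂o, fun c => (holOn_iff hV₂o).2 fun x hx => (hV₂ x hx).1.2 c, fun x hx h0 => ?_,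
      fun x hx => (hV₂ x hx).1.1.1.2, fun x hx w hw => ?_⟩
    · exact (hV₂ x hx).1.1.1.1 (by rw [h0]; rfl)
    · rw [vderiv_chain _ (hV₂ x hx).2.2.1, omega_smul_right, (hV₂ x hx).1.1.2 w hw, mul_zero]
  -- otherwise the Legendre associate is constant and the curve lies in a null ray
  by_contra! hreg
  have hdep : ∀ x ∈ V₂, vderiv z v x = (vderiv z v x a / v x a) • v x := by
    intro x hx
    obtain ⟨⟨⟨⟨h1, -⟩, -⟩, -⟩, h2, h3, h4⟩ := hV₂ x hx
    have h5 : ¬ LinearIndependent ℂ ![v x, vderiv (chartAt ℂ x) v x] := fun hli =>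
      hreg x h2.1 ⟨⟨V, u, h2.2, hu, fun h0 => h4 ?_⟩, V₂, v, hx, hleg, hli⟩
    · rw [LinearIndependent.pair_iff] at h5
      push Not at h5
      obtain ⟨s, t, hst, hne⟩ := h5
      have ht : t ≠ 0 := by
        rintro rfl
        rw [zero_smul, add_zero] at hst
        have := congrFun hst a
        simp only [Pi.smul_apply, smul_eq_mul, Pi.zero_apply] at this
        exact hne ((mul_eq_zero.1 this).resolve_right h1) rfl
      rw [vderiv_chain _ (isCoordAt_chartAt_self x)]
      have h6 : vderiv (chartAt ℂ x) v x = (-s / t) • v x := by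
        ext c
        have := congrFun hst c
        simp only [Pi.add_apply, Pi.smul_apply, smul_eq_mul, Pi.zero_apply] at this ⊢
        field_simp
        linear_combination this
      rw [h6]
      ext c
      simp only [Pi.smul_apply, smul_eq_mul]
      field_simp
    · change omega (u i x) (vderiv z (u j) x) = 0
      rw [vderiv_chain _ (isCoordAt_chartAt_self x), omega_smul_right]
      exact mul_eq_zero_of_right _ (congrFun (congrFun h0 i) j)
  have hcon : ∀ᶠ x in 𝓝 q, ∀ c, v x c / v x a = v q c / v q a := by
    refine eventually_all.2 fun c => HolAt.eventually_eq_of_cderiv_eq_zero hz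
      ((Hv c).div (Hv a) ha) ?_
    filter_upwards [hV₂o.mem_nhds hqV₂] with x hx
    obtain ⟨⟨⟨⟨h1, -⟩, -⟩, h2⟩, -⟩ := hV₂ x hx
    rw [cderiv_div z (h2 c) (h2 a) h1]
    have h3 := congrFun (hdep x hx) c
    simp only [Pi.smul_apply, smul_eq_mul] at h3
    change (vderiv z v x c * v x a - v x c * vderiv z v x a) / v x a ^ 2 = 0
    rw [h3]
    field_simp
    simp
  refine hf.not_nullRay ⟨(v q a)⁻¹ • v q, fun h0 => ?_,
    hf.hol.mem_of_eventually_mem hf.isConnected.isPreconnected ⟨q, hWU hq.1, ?_⟩⟩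
  · have := congrFun h0 a
    simp only [Pi.smul_apply, smul_eq_mul, inv_mul_cancel₀ ha] at this
    exact one_ne_zero this
  · filter_upwards [hcon, memv] with x h1 h2
    have : (v q a)⁻¹ • v q = (v x a)⁻¹ • v x := by
      ext c
      have := h1 c
      simp only [Pi.smul_apply, smul_eq_mul]
      rw [← div_eq_inv_mul, ← div_eq_inv_mul, this]
    rw [this]
    exact Submodule.smul_mem _ _ h2

end Density

/-! ### The projective structure and the quadratic differential -/

section Projective

variable {S : Type*} [TopologicalSpace S] [ChartedSpace ℂ S]

theorem isCoordAt_of_cderiv_ne_zero {z w : S → ℂ} {p : S} (hw : HolAt w p)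
    (h : cderiv z w p ≠ 0) : IsCoordAt w p :=
  ⟨hw, fun h0 => h (by rw [cderiv_eq, h0, zero_div])⟩

theorem cderiv_mul_cderiv {z w : S → ℂ} {p : S} (hz : IsCoordAt z p) (hw : IsCoordAt w p) :
    cderiv w z p * cderiv z w p = 1 := by
  rw [← cderiv_chain w hz, cderiv_self hw]

/-- The coefficients of the form `η` do not vanish. -/
theorem cartanForm_coeff_ne_zero : -(((3 / 32 : ℝ) ^ (1 / 3 : ℝ) : ℝ) : ℂ) ≠ 0 ∧
    -(((6 : ℝ) ^ (-1 / 3 : ℝ) : ℝ) : ℂ) ≠ 0 := by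
  constructor <;> rw [neg_ne_zero, Complex.ofReal_ne_zero] <;>
    exact (Real.rpow_pos_of_pos (by norm_num) _).ne'

/-- The value of `φ⁴₂/dw` in an adapted frame that exhibits `w` as a projective chart. -/
noncomputable def projectiveScale : ℂ := (-(((6 : ℝ) ^ (-1 / 3 : ℝ) : ℝ) : ℂ))⁻¹

theorem projectiveScale_ne_zero : projectiveScale ≠ 0 := inv_ne_zero cartanForm_coeff_ne_zero.2

theorem cartanForm_eq_iff (M : Mat4) : cartanForm M = !![0, 0; 1, 0] ↔
    M i2 i2 = 0 ∧ M i2 i4 = 0 ∧ M i4 i2 = projectiveScale := by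
  obtain ⟨h1, h2⟩ := cartanForm_coeff_ne_zero
  constructor
  · intro h
    have e00 := congrFun (congrFun h 0) 0
    have e01 := congrFun (congrFun h 0) 1
    have e10 := congrFun (congrFun h 1) 0
    refine ⟨e00, (mul_eq_zero.1 e01).resolve_left h1, ?_⟩
    exact eq_inv_of_mul_eq_one_right e10
  · rintro ⟨e1, e2, e3⟩
    rw [cartanForm, e1, e2, e3, projectiveScale, mul_zero, neg_zero, mul_inv_cancel₀ h2]

variable [IsManifold 𝓘(ℂ) ω S] {f : S → Q3} {z w : S → ℂ} {A : S → Mat4} {k r : S → ℂ}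
  {V : Set S} {p : S}

/-- In terms of a projective chart `w`, the invariant `k` is the Schwarzian derivative of `w`
up to a factor `-2`. -/
theorem IsProjectiveChartOn.exists_normalAt (h : IsProjectiveChartOn f w V) (hp : p ∈ V)
    (hz : IsCoordAt z p) : ∃ B k r, NormalAt f z B k r p ∧
      k p = -2 * (cderiv z (cderiv z (cderiv z w)) p / cderiv z w p) +
        3 * (cderiv z (cderiv z w) p / cderiv z w p) ^ 2 := by
  obtain ⟨hw, A, hA, hη⟩ := h
  have hwp := hw.isCoordAt hp
  set y := cderiv z w with hy
  have Hy : HolAt y p := hwp.1.cderiv hz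
  have hy0 : y p ≠ 0 := cderiv_ne_zero hz hwp
  have c0 := projectiveScale_ne_zero
  set c := projectiveScale
  have hval : ∀ᶠ q in 𝓝 p, mc z A q i4 i2 = c * y q ∧ mc z A q i2 i2 = 0 ∧
      mc z A q i2 i4 = 0 := by
    filter_upwards [hw.isOpen.mem_nhds hp] with q hq
    obtain ⟨e1, e2, e3⟩ := (cartanForm_eq_iff _).1 (hη q hq)
    rw [mc_chain A (hw.isCoordAt hq)]
    simp only [Matrix.smul_apply, smul_eq_mul, e1, e2, e3, mul_zero, and_self, and_true]
    exact mul_comm _ _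
  have had := (hA.adaptedAt hp hz).congr (θ' := fun q => c * y q) (s' := fun _ => 0)
    (k' := fun _ => 0) (hval.mono fun q hq => hq.1) (hval.mono fun q hq => hq.2.1)
    (hval.mono fun q hq => hq.2.2) .rfl
  set τ : S → ℂ := fun q => -2 * c⁻¹ * (cderiv z y q / y q ^ 2) with hτ
  have Hτ : τ =ᶠ[𝓝 p] fun q => 4 * (0 - cderiv z (fun q => c * y q) q / (2 * (c * y q))) /
      (c * y q) := by
    filter_upwards [Hy.eventually, Hy.eventually_ne hy0] with q h1 h2
    rw [cderiv_const_mul z c h1]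
    simp only [hτ]
    field_simp
    ring
  obtain ⟨B, hB⟩ := had.exists_normal hz τ Hτ
  refine ⟨B, _, _, hB, ?_⟩
  have dτ : cderiv z τ p = -2 * c⁻¹ * ((cderiv z (cderiv z y) p * y p ^ 2 -
      cderiv z y p * (2 * y p * cderiv z y p)) / (y p ^ 2) ^ 2) := by
    simp only [hτ]
    rw [cderiv_const_mul z _ ((Hy.cderiv hz).div (Hy.pow 2) (pow_ne_zero 2 hy0)),
      cderiv_div z (Hy.cderiv hz) (Hy.pow 2) (pow_ne_zero 2 hy0), cderiv_pow z Hy]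
    norm_num
  simp only [dτ]
  simp only [hτ]
  field_simp
  ring

/-- Near a point with a normal frame there is a projective chart: the quotient of two solutions
of `u'' = (k/4) u`. -/
theorem NormalAt.exists_isProjectiveChartOn (h : NormalAt f z A k r p) (hz : IsCoordAt z p) :
    ∃ w V, p ∈ V ∧ IsProjectiveChartOn f w V := by
  have c0 := projectiveScale_ne_zero
  obtain ⟨Y, HY, hY1, hY⟩ := exists_matrix_ode_solution hz
    (M := fun q => !![0, k q / 4; 1, 0]) (by
      rw [Fin.forall_fin_two, Fin.forall_fin_two, Fin.forall_fin_two]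
      exact ⟨⟨.const 0 p, h.holk.div (.const 4 p) (by norm_num)⟩, .const 1 p, .const 0 p⟩) 1
  have hY' : ∀ᶠ q in 𝓝 p, ∀ i, cderiv z (fun q => Y q i 0) q = Y q i 1 ∧
      cderiv z (fun q => Y q i 1) q = k q / 4 * Y q i 0 := by
    filter_upwards [hY] with q hq i
    rw [hq, hq]
    simp [Matrix.mul_apply, Fin.sum_univ_two, mul_comm]
  have HYe : ∀ᶠ q in 𝓝 p, ∀ i j, HolAt (fun q => Y q i j) q :=
    eventually_all.2 fun i => eventually_all.2 fun j => (HY i j).eventually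
  have hY00 : Y p 0 0 ≠ 0 := by rw [hY1]; simp
  have hY0 := (HY 0 0).eventually_ne hY00
  have wron : ∀ᶠ q in 𝓝 p, Y q 0 0 * Y q 1 1 - Y q 0 1 * Y q 1 0 = 1 := by
    have := HolAt.eventually_eq_of_cderiv_eq_zero hz
      (((HY 0 0).mul (HY 1 1)).sub ((HY 0 1).mul (HY 1 0))) (by
        filter_upwards [hY', HYe] with q h1 h2
        rw [cderiv_sub z ((h2 0 0).mul (h2 1 1)) ((h2 0 1).mul (h2 1 0)),
          cderiv_mul z (h2 0 0) (h2 1 1), cderiv_mul z (h2 0 1) (h2 1 0), (h1 0).1, (h1 0).2,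
          (h1 1).1, (h1 1).2]
        ring)
    refine this.mono fun q hq => hq.trans ?_
    rw [hY1]; simp
  set c := projectiveScale
  set w : S → ℂ := fun q => c⁻¹ * (Y q 1 0 / Y q 0 0) with hw
  have Hw : HolAt w p := (HolAt.const _ p).mul ((HY 1 0).div (HY 0 0) hY00)
  have dw : ∀ᶠ q in 𝓝 p, cderiv z w q = c⁻¹ * (Y q 0 0)⁻¹ ^ 2 := by
    filter_upwards [hY', HYe, hY0, wron] with q h1 h2 h3 h4
    simp only [hw]
    rw [cderiv_const_mul z _ ((h2 1 0).div (h2 0 0) h3), cderiv_div z (h2 1 0) (h2 0 0) h3,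
      (h1 0).1, (h1 1).1]
    have : Y q 1 1 * Y q 0 0 - Y q 1 0 * Y q 0 1 = 1 := by linear_combination h4
    rw [this, one_div, inv_pow]
  have hwp : IsCoordAt w p := isCoordAt_of_cderiv_ne_zero (z := z) Hw (by
    rw [dw.self_of_nhds]
    exact mul_ne_zero (inv_ne_zero c0) (pow_ne_zero 2 (inv_ne_zero hY00)))
  -- this change of frame makes `φ⁴₂` a constant multiple of `dw`, and `φ²₂` and `φ²₄` zero
  set b : S → ℂ := fun q => (Y q 0 0)⁻¹ with hb
  set τ : S → ℂ := fun q => -4 * (Y q 0 1 / Y q 0 0) with hτ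
  have Hb : HolAt b p := (HY 0 0).inv hY00
  have Hτ : HolAt τ p := (HolAt.const _ p).mul ((HY 0 1).div (HY 0 0) hY00)
  have had := (h.gauge hz Hb Hτ (inv_ne_zero hY00)).congr (θ' := fun q => c * cderiv z w q)
    (s' := fun _ => 0) (k' := fun _ => 0) (r' := fun q => r q / b q ^ 6) ?_ ?_ ?_ .rfl
  · obtain ⟨V, hpV, hV, hVP⟩ := had.exists_isAdaptedFrameOn hz (had.eventually.and
      (hz.eventually.and hwp.eventually))
    obtain ⟨V', hpV', hV', hVV⟩ := hwp.exists_isCoordOn (hV.frame.isOpen.mem_nhds hpV)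
    have hVV' : V' ⊆ V := hVV
    refine ⟨w, V', hpV', hV', _, ⟨⟨hV'.isOpen, fun i j => (hV.frame.hol i j).mono hVV',
      fun q hq => hV.frame.mem q (hVV' hq), fun q hq => hV.frame.span_eq q (hVV' hq)⟩,
      fun q hq => hV.adapted q (hVV' hq)⟩, fun q hq => ?_⟩
    obtain ⟨h1, h2, h3⟩ := hVP q (hVV' hq)
    rw [cartanForm_eq_iff, mc_chain _ h2, h1.eq.self_of_nhds, Phi_smul]
    have := cderiv_mul_cderiv h2 h3
    refine ⟨?_, ?_, ?_⟩ <;> simp [Phi]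
    linear_combination c * this
  · filter_upwards [dw] with q hq
    rw [hq, mul_inv_cancel_left₀ c0, mul_one]
  · filter_upwards [hY', HYe, hY0] with q h1 h2 h3
    simp only [hb, hτ]
    rw [cderiv_inv z (h2 0 0) h3, (h1 0).1]
    field_simp
    ring
  · filter_upwards [hY', HYe, hY0] with q h1 h2 h3
    have : cderiv z τ q = -4 * ((k q / 4 * Y q 0 0 * Y q 0 0 - Y q 0 1 * Y q 0 1) /
        Y q 0 0 ^ 2) := by
      simp only [hτ]
      rw [cderiv_const_mul z _ ((h2 0 1).div (h2 0 0) h3), cderiv_div z (h2 0 1) (h2 0 0) h3,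
        (h1 0).1, (h1 0).2]
    rw [this]
    simp only [hτ]
    field_simp
    ring

/-- The quadratic differential `γ` in terms of the invariant `k` and a fourth root of the quartic
differential. -/
theorem NormalAt.quadraticCoeff_eq (h : NormalAt f z A k r p) (hz : IsCoordAt z p) {a : S → ℂ}
    (ha : HolAt a p) (ha0 : a p ≠ 0) (hra : ∀ᶠ q in 𝓝 p, quarticCoeff f z q = a q ^ 4) :
    quadraticCoeff f z p = k p +
      (2 * (cderiv z (cderiv z a) p / a p) - 3 * (cderiv z a p / a p) ^ 2) := by
  have hex := h.exists_isProjectiveChartOn hz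
  rw [quadraticCoeff, dif_pos hex]
  obtain ⟨V, hpV, hV⟩ := hex.choose_spec
  set w := hex.choose
  obtain ⟨B, k', r', hB, hk'⟩ := hV.exists_normalAt hpV hz
  rw [(h.unique hB hz).1.self_of_nhds, hk']
  have hw := hV.1.isCoordAt hpV
  set y := cderiv z w with hy
  have Hy : HolAt y p := hw.1.cderiv hz
  have hy0 : y p ≠ 0 := cderiv_ne_zero hz hw
  have hyne := Hy.eventually_ne hy0
  have dinv : ∀ᶠ q in 𝓝 p, cderiv w z q = (y q)⁻¹ := by
    filter_upwards [hz.eventually, hw.eventually] with q h1 h2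
    exact eq_inv_of_mul_eq_one_left (cderiv_mul_cderiv h1 h2)
  have hZ : quarticCoeff f w =ᶠ[𝓝 p] fun q => (a q / y q) ^ 4 := by
    filter_upwards [hz.eventually, hra, dinv] with q h1 h2 h3
    rw [quarticCoeff_chain f h1, h2, h3, div_eq_mul_inv, mul_pow]
  -- with `dz/dw = 1/y` one has `δ = (a/y)⁴ dw⁴`; `g` is the derivative of `a/y` by `w`
  set g : S → ℂ := fun q => cderiv z a q / y q ^ 2 - a q * cderiv z y q / y q ^ 3 with hg
  have Hg : HolAt g p := ((ha.cderiv hz).div (Hy.pow 2) (pow_ne_zero 2 hy0)).sub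
    ((ha.mul (Hy.cderiv hz)).div (Hy.pow 3) (pow_ne_zero 3 hy0))
  have d1 : cderiv w (quarticCoeff f w) =ᶠ[𝓝 p] fun q => 4 * ((a q / y q) ^ 3 * g q) := by
    filter_upwards [hZ.eventuallyEq_nhds, hz.eventually, dinv, ha.eventually, Hy.eventually,
      hyne] with q h1 h2 h3 h4 h5 h6
    rw [cderiv_congr h1, cderiv_chain _ h2, h3, cderiv_pow z (h4.div h5 h6),
      cderiv_div z h4 h5 h6]
    simp only [hg]
    push_cast
    field_simp
  have hay := ha.div Hy hy0
  have d2 : cderiv w (cderiv w (quarticCoeff f w)) p = (y p)⁻¹ * (4 *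
      (3 * (a p / y p) ^ 2 * (y p * g p) * g p + (a p / y p) ^ 3 * cderiv z g p)) := by
    rw [cderiv_congr d1, cderiv_chain _ hz, dinv.self_of_nhds,
      cderiv_const_mul z _ ((hay.pow 3).mul Hg), cderiv_mul z (hay.pow 3) Hg,
      cderiv_pow z hay, cderiv_div z ha Hy hy0]
    simp only [hg]
    push_cast
    field_simp
  have dg : cderiv z g p = (cderiv z (cderiv z a) p * y p ^ 2 -
      cderiv z a p * (2 * y p * cderiv z y p)) / (y p ^ 2) ^ 2 -
      ((cderiv z a p * cderiv z y p + a p * cderiv z (cderiv z y) p) * y p ^ 3 -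
        a p * cderiv z y p * (3 * y p ^ 2 * cderiv z y p)) / (y p ^ 3) ^ 2 := by
    simp only [hg]
    rw [cderiv_sub z ((ha.cderiv hz).div (Hy.pow 2) (pow_ne_zero 2 hy0))
      ((ha.mul (Hy.cderiv hz)).div (Hy.pow 3) (pow_ne_zero 3 hy0)),
      cderiv_div z (ha.cderiv hz) (Hy.pow 2) (pow_ne_zero 2 hy0),
      cderiv_div z (ha.mul (Hy.cderiv hz)) (Hy.pow 3) (pow_ne_zero 3 hy0),
      cderiv_mul z ha (Hy.cderiv hz), cderiv_pow z Hy, cderiv_pow z Hy]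
    norm_num
  rw [secondOrderOp, d2, d1.self_of_nhds, hZ.self_of_nhds, dg]
  simp only [hg]
  field_simp
  ring

end Projective

/-! ### Curves with prescribed invariants -/

section Construction

variable {S : Type*} [TopologicalSpace S] [ChartedSpace ℂ S]

/-- The base point `[e₁ ∧ e₂]` of `ℚ₃`. -/
noncomputable def basePlane : Q3 where
  plane := Submodule.span ℂ {Pi.single i1 1, Pi.single i2 1}
  finrank_plane := by
    refine finrank_span_pair ?_
    rw [LinearIndependent.pair_iff]
    intro s t h
    exact ⟨by simpa using congrFun h i1, by simpa using congrFun h i2⟩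
  isotropic v hv w hw := by
    rw [Submodule.mem_span_pair] at hv hw
    obtain ⟨a, b, rfl⟩ := hv
    obtain ⟨c, d, rfl⟩ := hw
    simp [omega]

theorem act_basePlane (A : Sp2) :
    (act A basePlane).plane = Submodule.span ℂ {(A : Mat4).col i1, (A : Mat4).col i2} := by
  change Submodule.map _ (Submodule.span ℂ _) = _
  rw [Submodule.map_span, Set.image_pair, Matrix.mulVecLin_apply, Matrix.mulVecLin_apply,
    Matrix.mulVec_single_one, Matrix.mulVec_single_one]

theorem exists_isConnected_nhds {p : S} {P : S → Prop} (hP : ∀ᶠ q in 𝓝 p, P q) :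
    ∃ U, p ∈ U ∧ IsOpen U ∧ IsConnected U ∧ ∀ q ∈ U, P q := by
  have := ChartedSpace.locallyConnectedSpace ℂ S
  obtain ⟨U, h1, h2, h3, h4⟩ :=
    locallyConnectedSpace_iff_subsets_isOpen_isConnected.1 this p _ hP
  exact ⟨U, h3, h2, h4, h1⟩

/-- The values of `Phi` lie in the symplectic Lie algebra. -/
theorem Phi_mul_J (θ s k r : ℂ) : Phi θ s k r * Matrix.J (Fin 2) ℂ +
    Matrix.J (Fin 2) ℂ * (Phi θ s k r).transpose = 0 := by
  rw [J_apply_eq, Phi, Matrix.fromBlocks_transpose, Matrix.fromBlocks_multiply,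
    Matrix.fromBlocks_multiply, Matrix.fromBlocks_add, ← Matrix.fromBlocks_zero]
  congr 1 <;> ext i j <;> fin_cases i <;> fin_cases j <;> simp

variable [IsManifold 𝓘(ℂ) ω S] {f fh : S → Q3} {z : S → ℂ} {A Ah : S → Mat4} {k r kh rh : S → ℂ}
  {U V W : Set S} {p : S}

/-- Every pair of holomorphic functions is the pair of invariants of a curve: integrate the
structure equations of a normal frame. -/
theorem exists_normalAt (hz : IsCoordAt z p) (hk : HolAt k p) (hr : HolAt r p) :
    ∃ f A, NormalAt f z A k r p := by
  classical
  obtain ⟨Y, HY, hY1, hY⟩ := exists_matrix_ode_solution hz (M := fun q => Phi1 (k q) (r q)) (by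
    intro i j
    rcases i with i | i <;> rcases j with j | j <;> fin_cases i <;> fin_cases j <;>
      simp [Phi, HolAt.const, hk, hr, HolAt.mul, HolAt.neg, -neg_mul]) 1
  have HY' : MHolAt Y p := HY
  have dY : ∀ᶠ q in 𝓝 p, mderiv z Y q = Y q * Phi1 (k q) (r q) := by
    filter_upwards [hY] with q hq
    ext i j
    exact hq i j
  have HJ := MHolAt.const (Matrix.J (Fin 2) ℂ) p
  have HT : MHolAt (fun q => (Y q).transpose) p := fun i j => HY j i
  -- the solution stays in the symplectic group
  have dJ : ∀ᶠ q in 𝓝 p, mderiv z (fun q => Y q * Matrix.J (Fin 2) ℂ * (Y q).transpose) q = 0 := by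
    filter_upwards [dY, HY'.eventually, HT.eventually] with q h1 h2 h3
    have e : mderiv z (fun q => (Y q).transpose) q = (mderiv z Y q).transpose := rfl
    rw [mderiv_mul z (h2.mul (.const _ q)) h3, mderiv_mul z h2 (.const _ q), e, h1, mderiv_const,
      Matrix.mul_zero, add_zero, Matrix.transpose_mul]
    have := congrArg (fun M => Y q * M * (Y q).transpose) (Phi_mul_J 1 0 (k q) (r q))
    simpa only [Matrix.mul_add, Matrix.add_mul, Matrix.mul_assoc, Matrix.mul_zero,
      Matrix.zero_mul] using this
  have hmem : ∀ᶠ q in 𝓝 p, Y q ∈ Matrix.symplecticGroup (Fin 2) ℂ := by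
    have : ∀ᶠ q in 𝓝 p, ∀ i j, (Y q * Matrix.J (Fin 2) ℂ * (Y q).transpose) i j =
        (Y p * Matrix.J (Fin 2) ℂ * (Y p).transpose) i j :=
      eventually_all.2 fun i => eventually_all.2 fun j =>
        HolAt.eventually_eq_of_cderiv_eq_zero hz ((HY'.mul HJ).mul HT i j)
          (dJ.mono fun q hq => congrFun (congrFun hq i) j)
    filter_upwards [this] with q hq
    rw [SymplecticGroup.mem_iff, Matrix.ext hq, hY1]
    simp
  refine ⟨fun q => if h : Y q ∈ Matrix.symplecticGroup (Fin 2) ℂ then act ⟨Y q, h⟩ basePlane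
    else basePlane, Y, ⟨HY, hmem, ?_⟩, .const _ p, .const _ p, hk, hr, one_ne_zero, ?_⟩
  · filter_upwards [hmem] with q hq
    rw [dif_pos hq, act_basePlane]
  · filter_upwards [dY, hmem] with q h1 h2 using (mderiv_eq_iff_mc h2).1 h1

/-- A curve with normal frames is isotropic. -/
theorem isIsotropicOn_of_normalAt (hU : IsOpen U) (hUc : IsConnected U)
    (h : ∀ q ∈ U, NormalAt f z A k r q ∧ IsCoordAt z q) : IsIsotropicOn f U := by
  have H1 : ∀ q ∈ U, ∀ j, VHolAt (fun q => (A q).col j) q := fun q hq j => (h q hq).1.frame.hol.col j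
  have hcol : ∀ q ∈ U, _ := fun q hq =>
    (mem_symplectic_iff_col (A q)).1 (h q hq).1.frame.mem.self_of_nhds
  have hd : ∀ q ∈ U, _ := fun q hq => (NormalAt.vderiv_col (h q hq).1).self_of_nhds
  have hmem : ∀ q ∈ U, ∀ a, (A q).col (Sum.inl a) ∈ (f q).plane := fun q hq =>
    (h q hq).1.frame.mem_plane.self_of_nhds
  obtain ⟨q₀, hq₀⟩ := hUc.nonempty
  refine ⟨hU, hUc, fun q hq => ⟨U, fun i q => (A q).col (Sum.inl i), hq, subset_rfl, hU,
    fun i c => (holOn_iff hU).2 fun x hx => H1 x hx _ c, fun x hx => ?_⟩, ?_, ?_, ?_⟩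
  · rw [(h x hx).1.frame.span_eq.self_of_nhds,
      range_fin_two_apply fun i q => (A q).col (Sum.inl i)]
  · rintro ⟨P, hP⟩
    have h1 := cderiv_omega z (VHolAt.const ((A q₀).col i2) q₀) (H1 q₀ hq₀ i2)
    rw [cderiv_congr (h := fun _ => 0), cderiv_const, vderiv_const, (hd q₀ hq₀).2.1,
      omega_add_right, omega_smul_right, (hcol q₀ hq₀).2.2.2.2.1, omega_swap _ ((A q₀).col i1),
      (hcol q₀ hq₀).1] at h1
    · simp [omega] at h1
    · filter_upwards [hU.mem_nhds hq₀] with x hx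
      exact P.isotropic _ (hP q₀ hq₀ ▸ hmem q₀ hq₀ 1) _ (hP x hx ▸ hmem x hx 1)
  · intro V u hVU hu q hq
    have hqU := hVU hq
    obtain ⟨a, b, hab⟩ := hu.exists_of_mem hq (hmem q hqU 0)
    have h0 : ∀ j, a * mdot u q 0 j + b * mdot u q 1 j = 0 := fun j => by
      have h1 := omega_vderiv_eq_zero (z := chartAt ℂ q) (H1 q hqU i1) (hu.vHolAt hq j) (by
        filter_upwards [hu.isOpen.mem_nhds hq] with x hx
        exact (f x).isotropic _ (hmem x (hVU hx) 0) _ (hu.mem hx j))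
      rw [vderiv_chain _ (h q hqU).2, (hd q hqU).1, omega_smul_left,
        (f q).isotropic _ (hmem q hqU 1) _ (hu.mem hq j), mul_zero, zero_add, hab,
        omega_add_left, omega_smul_left, omega_smul_left] at h1
      exact h1
    rw [Matrix.det_fin_two]
    by_cases ha : a = 0
    · have hb : b ≠ 0 := by
        rintro rfl
        have := (hcol q hqU).2.1
        rw [hab, ha] at this
        simp [omega] at this
      have e : ∀ j, mdot u q 1 j = 0 := fun j => by
        have := h0 j
        rw [ha, zero_mul, zero_add] at this
        exact (mul_eq_zero.1 this).resolve_left hb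
      rw [e, e]; ring
    · have : a * (mdot u q 0 0 * mdot u q 1 1 - mdot u q 0 1 * mdot u q 1 0) = 0 := by
        linear_combination mdot u q 1 1 * h0 0 - mdot u q 1 0 * h0 1
      exact (mul_eq_zero.1 this).resolve_left ha
  · rintro ⟨ξ, hξ, hall⟩
    refine hξ ?_
    have hder : ∀ v : S → C4, (∀ q ∈ U, VHolAt v q) → (∀ q ∈ U, omega (v q) ξ = 0) →
        ∀ q ∈ U, omega (vderiv z v q) ξ = 0 := fun v hv h0 q hq => by
      have := omega_vderiv_eq_zero (z := z) (hv q hq) (.const ξ q) (by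
        filter_upwards [hU.mem_nhds hq] with x hx using h0 x hx)
      simpa [omega] using this
    have e1 : ∀ q ∈ U, omega ((A q).col i1) ξ = 0 := fun q hq =>
      (f q).isotropic _ (hmem q hq 0) _ (hall q hq)
    have e2 : ∀ q ∈ U, omega ((A q).col i2) ξ = 0 := fun q hq =>
      (f q).isotropic _ (hmem q hq 1) _ (hall q hq)
    have e4 : ∀ q ∈ U, omega ((A q).col i4) ξ = 0 := fun q hq => by
      have := hder _ (fun q hq => H1 q hq i2) e2 q hq
      rwa [(hd q hq).2.1, omega_add_left, omega_smul_left, e1 q hq, mul_zero, zero_add] at this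
    have e3 : omega ((A q₀).col i3) ξ = 0 := by
      have := hder _ (fun q hq => H1 q hq i4) e4 q₀ hq₀
      rwa [(hd q₀ hq₀).2.2, omega_sub_left, omega_smul_left, e2 q₀ hq₀, mul_zero, zero_sub,
        neg_eq_zero] at this
    rw [eq_sum_col (h q₀ hq₀).1.frame.mem.self_of_nhds ξ, omega_swap ξ, omega_swap ξ, omega_swap ξ,
      omega_swap ξ, e1 q₀ hq₀, e2 q₀ hq₀, e3, e4 q₀ hq₀]
    simp

/-- Curves with the same invariant `k` are deformations of order four of each other. -/
theorem NormalAt.exists_isDeformationOn (h : NormalAt f z A k r p) (hh : NormalAt fh z Ah k rh p)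
    (hz : IsCoordAt z p) {P : S → Prop} (hP : ∀ᶠ q in 𝓝 p, P q) :
    ∃ U, p ∈ U ∧ (∀ q ∈ U, P q) ∧ IsDeformationOn 4 f fh U := by
  classical
  obtain ⟨U, hpU, hU, hUc, hall⟩ := exists_isConnected_nhds
    ((h.eventually.and hh.eventually).and (hz.eventually.and hP))
  have hD : ∀ q ∈ U, Ah q * (A q)⁻¹ ∈ Matrix.symplecticGroup (Fin 2) ℂ := fun q hq =>
    mul_mem (hall q hq).1.2.frame.mem.self_of_nhds (by
      have h1 := (hall q hq).1.1.frame.mem.self_of_nhds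
      rw [← SymplecticGroup.coe_inv' ⟨A q, h1⟩]
      exact Subtype.property _)
  -- the motion taking one normal frame to the other
  refine ⟨U, hpU, fun q hq => (hall q hq).2.2,
    isIsotropicOn_of_normalAt hU hUc fun q hq => ⟨(hall q hq).1.1, (hall q hq).2.1⟩,
    isIsotropicOn_of_normalAt hU hUc fun q hq => ⟨(hall q hq).1.2, (hall q hq).2.1⟩,
    fun q => if hq : Ah q * (A q)⁻¹ ∈ Matrix.symplecticGroup (Fin 2) ℂ then ⟨_, hq⟩ else 1, ?_, ?_⟩
  · refine fun i j => (holOn_iff hU).2 fun q hq => ?_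
    obtain ⟨⟨h1, h2⟩, -⟩ := hall q hq
    refine (h2.frame.hol.mul (h1.frame.hol.inv h1.frame.mem) i j).congr ?_
    filter_upwards [hU.mem_nhds hq] with x hx
    rw [dif_pos (hD x hx)]
  · intro q hq
    obtain ⟨⟨h1, h2⟩, h3, -⟩ := hall q hq
    refine NormalAt.hasContact h1 h2 h3 ?_
    beta_reduce
    rw [dif_pos (hD q hq)]
    change Ah q * (A q)⁻¹ * A q = Ah q
    rw [Matrix.mul_assoc, Matrix.nonsing_inv_mul _
      (isUnit_of_mem_symplectic h1.frame.mem.self_of_nhds), Matrix.mul_one]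

theorem isOpen_isRegularAt (f : S → Q3) : IsOpen {p | IsRegularAt f p} := by
  rw [isOpen_iff_eventually]
  intro p hp
  have hz := isCoordAt_chartAt_self p
  obtain ⟨A, k, r, hA⟩ := IsRegularAt.exists_normalAt hp hz
  filter_upwards [hA.eventually, hz.eventually] with q h1 h2 using NormalAt.isRegularAt h1 h2

/-- Isotropic curves with the same local invariants near a point are congruent. -/
theorem NormalAt.congruentOn (h : NormalAt f z A k r p) (hh : NormalAt fh z Ah k r p)
    (hz : IsCoordAt z p) (hf : IsIsotropicOn f U) (hfh : IsIsotropicOn fh U) (hp : p ∈ U) :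
    CongruentOn f fh U := by
  obtain ⟨X, hX⟩ := NormalAt.congruent h hh hz
  exact ⟨X, hfh.hol.eq_of_eventually_eq (hf.hol.act X) hf.isConnected.isPreconnected ⟨p, hp, hX⟩⟩

theorem IsDeformationOn.k_eq {m : ℕ} (hm : 4 ≤ m) (hd : IsDeformationOn m f fh U) (hp : p ∈ U)
    (h : NormalAt f z A k r p) (hh : NormalAt fh z Ah kh rh p) (hz : IsCoordAt z p) :
    k =ᶠ[𝓝 p] kh := by
  obtain ⟨D, -, hD⟩ := hd.contact
  filter_upwards [h.eventually, hh.eventually, hz.eventually,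
    hd.isotropic_left.isOpen.mem_nhds hp] with q h1 h2 h3 h4
  obtain ⟨V, u, v, hV, hu, hv, huv⟩ := hD q h4
  exact NormalAt.k_eq h1 h2 h3 ⟨V, u, v, hV, hu, hv, fun j hj => huv j (hj.trans hm)⟩

theorem NormalAt.quarticCoeff_chart (h : NormalAt f z A k r p) (hz : IsCoordAt z p) :
    quarticCoeff f (chartAt ℂ p) p = r p * cderiv (chartAt ℂ p) z p ^ 4 := by
  rw [quarticCoeff_chain f hz, NormalAt.quarticCoeff_eq h hz]

end Construction

/-! ### Deformations -/

section Deformations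

variable {S : Type*} [TopologicalSpace S] [ChartedSpace ℂ S] [IsManifold 𝓘(ℂ) ω S]
  {f fh : S → Q3} {U : Set S}

/-- Deformations of order five are trivial. -/
theorem IsDeformationOn.congruentOn (hd : IsDeformationOn 5 f fh U) : CongruentOn f fh U := by
  have hf := hd.isotropic_left
  have hfh := hd.isotropic_right
  obtain ⟨p, ⟨hpU, hp⟩, hp'⟩ := hfh.exists_isRegularAt (hf.isOpen.inter (isOpen_isRegularAt f))
    Set.inter_subset_left (hf.exists_isRegularAt hf.isOpen subset_rfl hf.isConnected.nonempty)
  have hz := isCoordAt_chartAt_self p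
  obtain ⟨A, k, r, hA⟩ := hp.exists_normalAt hz
  obtain ⟨Ah, kh, rh, hAh⟩ := hp'.exists_normalAt hz
  have hk := hd.k_eq (by norm_num) hpU hA hAh hz
  have hr : r =ᶠ[𝓝 p] rh := by
    obtain ⟨D, -, hD⟩ := hd.contact
    filter_upwards [hA.eventually, hAh.eventually, hz.eventually, hf.isOpen.mem_nhds hpU,
      hk.eventuallyEq_nhds] with q h1 h2 h3 h4 h5
    exact NormalAt.r_eq h1 h2 h3 h5 (hD q h4)
  exact NormalAt.congruentOn hA (hAh.congr .rfl .rfl hk.symm hr.symm) hz hf hfh hpU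

/-- A deformation of order four is determined up to congruence by its quartic differential. -/
theorem congruentOn_of_quarticCoeff_eq {f₁ f₂ : S → Q3} (h₁ : IsDeformationOn 4 f f₁ U)
    (h₂ : IsDeformationOn 4 f f₂ U) (h : ∀ p ∈ U, IsRegularAt f p →
      quarticCoeff f₁ (chartAt ℂ p) p = quarticCoeff f₂ (chartAt ℂ p) p) :
    CongruentOn f₁ f₂ U := by
  have hf := h₁.isotropic_left
  have hf₁ := h₁.isotropic_right
  have hf₂ := h₂.isotropic_right
  obtain ⟨p, ⟨⟨hpU, hp⟩, hp₁⟩, hp₂⟩ := hf₂.exists_isRegularAt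
    ((hf.isOpen.inter (isOpen_isRegularAt f)).inter (isOpen_isRegularAt f₁))
    (Set.inter_subset_left.trans Set.inter_subset_left)
    (hf₁.exists_isRegularAt (hf.isOpen.inter (isOpen_isRegularAt f)) Set.inter_subset_left
      (hf.exists_isRegularAt hf.isOpen subset_rfl hf.isConnected.nonempty))
  have hz := isCoordAt_chartAt_self p
  obtain ⟨A, k, r, hA⟩ := IsRegularAt.exists_normalAt hp hz
  obtain ⟨A₁, k₁, r₁, hA₁⟩ := IsRegularAt.exists_normalAt hp₁ hz
  obtain ⟨A₂, k₂, r₂, hA₂⟩ := hp₂.exists_normalAt hz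
  have hk₁ := h₁.k_eq le_rfl hpU hA hA₁ hz
  have hk₂ := h₂.k_eq le_rfl hpU hA hA₂ hz
  have hr : r₁ =ᶠ[𝓝 p] r₂ := by
    filter_upwards [hA.eventually, hA₁.eventually, hA₂.eventually, hz.eventually,
      hf.isOpen.mem_nhds hpU] with q e0 e1 e2 e3 e4
    have := h q e4 (NormalAt.isRegularAt e0 e3)
    rw [NormalAt.quarticCoeff_chart e1 e3, NormalAt.quarticCoeff_chart e2 e3] at this
    exact mul_right_cancel₀ (pow_ne_zero 4 (cderiv_ne_zero (isCoordAt_chartAt_self q) e3)) this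
  exact NormalAt.congruentOn hA₁ (hA₂.congr .rfl .rfl (hk₂.symm.trans hk₁) hr.symm) hz hf₁ hf₂ hpU

/-- Near a generic point the quartic differential of a deformation of order four can be
prescribed. -/
theorem IsGenericAt.exists_isDeformationOn {p₀ : S} {N : Set S} {h : S → ℂ}
    (hg : IsGenericAt f p₀) (hN : IsOpen N) (hp₀ : p₀ ∈ N) (hh : HolOn h N) (h0 : h p₀ ≠ 0) :
    ∃ U fh, p₀ ∈ U ∧ U ⊆ N ∧ IsGeneralTypeOn fh U ∧ IsDeformationOn 4 f fh U ∧
      ∀ p ∈ U, quarticCoeff fh (chartAt ℂ p) p = h p * quarticCoeff f (chartAt ℂ p) p := by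
  have hz := isCoordAt_chartAt_self p₀
  obtain ⟨A, k, r, hA⟩ := hg.1.exists_normalAt hz
  obtain ⟨fh, Ah, hAh⟩ := exists_normalAt hz hA.holk ((hh.holAt hN hp₀).mul hA.holr)
  obtain ⟨U, hpU, hU, hd⟩ := NormalAt.exists_isDeformationOn hA hAh hz
    ((hz.eventually.and (hN.eventually_mem hp₀)).and (hA.eventually.and hAh.eventually))
  have hq : ∀ p ∈ U, quarticCoeff fh (chartAt ℂ p) p =
      h p * quarticCoeff f (chartAt ℂ p) p := by
    intro p hp
    obtain ⟨⟨h1, -⟩, h2, h3⟩ := hU p hp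
    rw [NormalAt.quarticCoeff_chart h2 h1, NormalAt.quarticCoeff_chart h3 h1, mul_assoc]
  refine ⟨U, fh, hpU, fun q hq => (hU q hq).1.2, ⟨hd.isotropic_right, p₀, hpU,
    NormalAt.isRegularAt hAh hz, ?_⟩, hd, hq⟩
  rw [hq p₀ hpU]
  exact mul_ne_zero h0 hg.2

theorem CongruentOn.quarticCoeff_eq (hc : CongruentOn f fh U) (hU : IsOpen U) {p : S} (hp : p ∈ U)
    (hf : IsRegularAt f p) : quarticCoeff fh (chartAt ℂ p) p = quarticCoeff f (chartAt ℂ p) p := by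
  obtain ⟨X, hX⟩ := hc
  have hz := isCoordAt_chartAt_self p
  obtain ⟨A, k, r, hA⟩ := hf.exists_normalAt hz
  have h1 := hA.act X
  have h2 : NormalAt fh (chartAt ℂ p) (fun q => (X : Mat4) * A q) k r p :=
    ⟨⟨h1.frame.hol, h1.frame.mem, by
      filter_upwards [h1.frame.span_eq, hU.mem_nhds hp] with q e1 e2
      rw [hX q e2, e1]⟩, h1.holθ, h1.hols, h1.holk, h1.holr, h1.ne, h1.eq⟩
  rw [NormalAt.quarticCoeff_eq h2 hz, NormalAt.quarticCoeff_eq hA hz]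

/-- Near a generic point there is a deformation of order four that doubles the quartic
differential, hence is not trivial. -/
theorem isDeformable_four (f : S → Q3) : IsDeformable 4 f := by
  intro p₀ hg
  obtain ⟨U, fh, hpU, -, hfh, hd, hq⟩ := hg.exists_isDeformationOn (h := fun _ => 2) isOpen_univ
    (Set.mem_univ p₀) ((holOn_iff isOpen_univ).2 fun q _ => .const 2 q) two_ne_zero
  refine ⟨U, fh, hpU, hfh, hd, fun hc => hg.2 ?_⟩
  have := (hq p₀ hpU).symm.trans (hc.quarticCoeff_eq hd.isotropic_left.isOpen hpU hg.1)
  linear_combination this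

/-- The condition on the quadratic differentials says that the invariants `k` of normal frames
agree, which is what contact of order four means. -/
theorem isDeformationOn_iff_quadraticCoeff_eq {V : Set S} {z a : S → ℂ}
    (hgen : ∀ p ∈ V, IsGenericAt f p ∧ IsGenericAt fh p) (hz : IsCoordOn z V)
    (hf : ∀ p ∈ V, quarticCoeff f z p = 1) (ha : HolOn a V)
    (hfh : ∀ p ∈ V, quarticCoeff fh z p = a p ^ 4) :
    (∀ p ∈ V, ∃ W, p ∈ W ∧ W ⊆ V ∧ IsDeformationOn 4 f fh W) ↔
      ∀ p ∈ V, quadraticCoeff fh z p = quadraticCoeff f z p +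
        (2 * (cderiv z (cderiv z a) p / a p) - 3 * (cderiv z a p / a p) ^ 2) := by
  have key : ∀ p ∈ V, ∀ {A Ah : S → Mat4} {k r kh rh : S → ℂ}, NormalAt f z A k r p →
      NormalAt fh z Ah kh rh p → (quadraticCoeff fh z p = quadraticCoeff f z p +
        (2 * (cderiv z (cderiv z a) p / a p) - 3 * (cderiv z a p / a p) ^ 2) ↔ k p = kh p) := by
    intro p hp A Ah k r kh rh hA hAh
    have hzp := hz.isCoordAt hp
    have ha0 : a p ≠ 0 := fun h0 => (hgen p hp).2.2 (by
      rw [quarticCoeff_chain fh hzp, hfh p hp, h0]; ring)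
    have hV : ∀ᶠ q in 𝓝 p, q ∈ V := hz.isOpen.mem_nhds hp
    rw [NormalAt.quadraticCoeff_eq hAh hzp (ha.holAt hz.isOpen hp) ha0 (hV.mono hfh),
      NormalAt.quadraticCoeff_eq hA hzp (.const 1 p) one_ne_zero
        (hV.mono fun q hq => (hf q hq).trans (one_pow 4).symm),
      cderiv_congr (g := cderiv z fun _ => 1) (h := fun _ => 0)
        (.of_forall fun q => cderiv_const z 1 q), cderiv_const, cderiv_const, add_left_inj]
    norm_num
    exact eq_comm
  constructor
  · intro h p hp
    obtain ⟨W, hpW, -, hd⟩ := h p hp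
    obtain ⟨A, k, r, hA⟩ := (hgen p hp).1.1.exists_normalAt (hz.isCoordAt hp)
    obtain ⟨Ah, kh, rh, hAh⟩ := (hgen p hp).2.1.exists_normalAt (hz.isCoordAt hp)
    exact (key p hp hA hAh).2 (hd.k_eq le_rfl hpW hA hAh (hz.isCoordAt hp)).self_of_nhds
  · intro h p hp
    have hzp := hz.isCoordAt hp
    obtain ⟨A, k, r, hA⟩ := (hgen p hp).1.1.exists_normalAt hzp
    obtain ⟨Ah, kh, rh, hAh⟩ := (hgen p hp).2.1.exists_normalAt hzp
    have hk : k =ᶠ[𝓝 p] kh := by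
      filter_upwards [hA.eventually, hAh.eventually, hz.isOpen.mem_nhds hp] with q h1 h2 h3
      exact (key q h3 h1 h2).1 (h q h3)
    obtain ⟨W, hpW, hW, hd⟩ := NormalAt.exists_isDeformationOn hA
      (hAh.congr .rfl .rfl hk.symm .rfl) hzp (hz.isOpen.eventually_mem hp)
    exact ⟨W, hpW, hW, hd⟩

end Deformations

end IsotropicCurve

theorem theoremD {S : Type*} [TopologicalSpace S] [T2Space S] [ChartedSpace ℂ S]
    [IsManifold 𝓘(ℂ) ω S] (f : S → Q3) (hf : IsGeneralTypeOn f Set.univ) :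
    -- `f` is deformable of order four
    IsDeformable 4 f ∧
    -- local fourth order deformations are characterized by `γ_fh = γ_f + 𝔰`
    (∀ (V : Set S) (fh : S → Q3) (z a : S → ℂ),
      IsGeneralTypeOn fh V →
      (∀ p ∈ V, IsGenericAt f p ∧ IsGenericAt fh p) →
      IsCoordOn z V → (∀ p ∈ V, quarticCoeff f z p = 1) →
      HolOn a V → (∀ p ∈ V, quarticCoeff fh z p = a p ^ 4) →
      ((∀ p ∈ V, ∃ W, p ∈ W ∧ W ⊆ V ∧ IsDeformationOn 4 f fh W) ↔
        ∀ p ∈ V, quadraticCoeff fh z p = quadraticCoeff f z p +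
          (2 * (cderiv z (cderiv z a) p / a p) - 3 * (cderiv z a p / a p) ^ 2))) ∧
    -- they depend on one arbitrary holomorphic function `h`: existence
    (∀ (p₀ : S) (N : Set S) (h : S → ℂ),
      IsGenericAt f p₀ → IsOpen N → p₀ ∈ N → HolOn h N → h p₀ ≠ 0 →
      ∃ U fh, p₀ ∈ U ∧ U ⊆ N ∧ IsGeneralTypeOn fh U ∧ IsDeformationOn 4 f fh U ∧
        ∀ p ∈ U, quarticCoeff fh (chartAt ℂ p) p = h p * quarticCoeff f (chartAt ℂ p) p) ∧
    -- and uniqueness up to congruence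
    (∀ (U : Set S) (f₁ f₂ : S → Q3),
      IsGeneralTypeOn f₁ U → IsGeneralTypeOn f₂ U →
      IsDeformationOn 4 f f₁ U → IsDeformationOn 4 f f₂ U →
      (∀ p ∈ U, IsRegularAt f p →
        quarticCoeff f₁ (chartAt ℂ p) p = quarticCoeff f₂ (chartAt ℂ p) p) →
      CongruentOn f₁ f₂ U) ∧
    -- `f` is rigid to order five, and every fifth order deformation is congruent to `f`
    IsRigid 5 f ∧
    (∀ (U : Set S) (fh : S → Q3), IsDeformationOn 5 f fh U → CongruentOn f fh U) := by
  refine ⟨isDeformable_four f, fun V fh z a _ hgen hz hf' ha hfh =>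
      isDeformationOn_iff_quadraticCoeff_eq hgen hz hf' ha hfh,
    fun p₀ N h hg hN hp₀ hh h0 => hg.exists_isDeformationOn hN hp₀ hh h0,
    fun U f₁ f₂ _ _ h₁ h₂ h => congruentOn_of_quarticCoeff_eq h₁ h₂ h, fun hdef => ?_,
    fun U fh hd => hd.congruentOn⟩
  obtain ⟨p₀, -, hp₀⟩ := hf.quartic_ne_zero
  obtain ⟨U, fh, -, -, hd, hne⟩ := hdef p₀ hp₀
  exact hne hd.congruentOn
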